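/- **Setting.** Let $N\ge 1$, $0\le M\le N$ be integers, $h>0$, $T:=Nh$; let $\mathcal K\subseteq\mathbb R^m$ be a nonempty closed cone (not necessarily convex), $\check x_0\in\mathbb R^n$, $\xi_0\in C([-Mh,0],\mathbb R^n)$, and let $f,g_1,\dots,g_m:\mathbb R\times(\mathbb R^n)^{M+1}\to\mathbb R^n$ be bounded and of class $C^1$. Write $\{x(t-kh)\}_k=(x(t),x(t-h),\dots,x(t-Mh))$, $\|w\|=\sum_j|w^j|$ for $w\in\mathbb R^m$, and $z^-(t)$ for a left limit. For an $\mathbb R^m$-valued finite Borel measure $\mu$ on $[0,T]$, $|\mu|=\sum_j(\mu^j_++\mu^j_-)$ and $\mu^c$ is its continuous (atomless) component; $\mu$ *ranges over* $\mathcal K$ if $\frac{d\mu}{d|\mu|}\in\mathcal K$ $|\mu|$-a.e. Weak-$*$ convergence $\rightharpoonup^*$ is, componentwise, in duality with $C([0,T],\mathbb R)$. $\mathcal V_c(\mu)$ is the set of finite positive Borel measures $\nu$ on $[0,T]$ such that $\nu^c=|\mu^c|$ and $(\mu_i,|\mu_i|)\rightharpoonup^*(\mu,\nu)$ for some sequence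 of measures $\mu_i$ ranging over $\mathcal K$. **Impulse controls.** An impulse control $(\mu,\nu,\{\omega^r\}_{r\in[0,h]})$ consists of a measure $\mu$ ranging over $\mathcal K$, $\nu\in\mathcal V_c(\mu)$ and essentially bounded measurable $\omega^r=(\omega^r_1,\dots,\omega^r_N):[0,1]\to\mathcal K^N$ such that (with $\omega^h_0\equiv0$, $\omega^0_{N+1}\equiv 0$): for every $r\in[0,h]$, $\sum_{l=1}^N\|\omega^r_l(s)\|=\sum_{l=1}^N\int_0^1\|\omega^r_l\|$ for a.e. $s$; for $r\in\,]0,h[$, $l=1,\dots,N$, $\int_0^1\|\omega^r_l\|=\nu(\{r+(l-1)h\})$ and $\int_0^1\omega^r_l=\mu(\{r+(l-1)h\})$; for $l=0,\dots,N$, $\int_0^1(\|\omega^h_l\|+\|\omega^0_{l+1}\|)=\nu(\{lh\})$ and $\int_0^1(\omega^h_l+\omega^0_{l+1})=\mu(\{lh\})$. **Impulse processes.** $(\mu,\nu,\{\omega^r\},x,v)$ is an impulse process if moreover $x:[-Mh,T]\to\mathbb R^n$ and $v:[0,T]\to\mathbb R$ have bounded variation on $[0,T]$, $x=\xi_0$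 on $[-Mh,0[$, $(x,v)(0)=(\check x_0,0)$, $(x,v)((l-1)h)=(\zeta^0_l,\theta^0_l)(1)$ for $l=2,\dots,N+1$, and for $l=1,\dots,N$ and $t\in\,](l-1)h,lh[$ $$x(t)=\zeta^0_l(1)+\int_{(l-1)h}^t f(t',\{x(t'-kh)\}_k)\,dt'+\sum_{j=1}^m\int_{[(l-1)h,t]}g_j(t',\{x(t'-kh)\}_k)\,d(\mu^c)^j(t')+\sum_{r\in]0,t-(l-1)h]}\bigl(\zeta^r_l(1)-x^-(r+(l-1)h)\bigr),$$ $$v(t)=\theta^0_l(1)+\nu^c([(l-1)h,t])+\sum_{r\in]0,t-(l-1)h]}\bigl(\theta^r_l(1)-v^-(r+(l-1)h)\bigr).$$ Here, on $[0,1]$, $$\frac{d\zeta^r_l}{ds}=\sum_j g_j\bigl(r+(l-1)h,\{\zeta^r_{l-k}\}_k\bigr)(\omega^r_l)^j\ \text{ a.e.},\qquad \theta^r_l(s)=\theta^r_l(0)+\int_0^s\|\omega^r_l\|,$$ with $(\zeta^r_l,\theta^r_l)(0)=(x^-,v^-)(r+(l-1)h)$ if $r\in\,]0,h]$ and $(\zeta^0_l,\theta^0_l)(0)=(\zeta^h_{l-1},\theta^h_{l-1})(1)$;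 and $\theta^r_0\equiv0$, $\zeta^r_0(s)=\xi_0(r-h)$ except that $\zeta^h_0(1)=\check x_0$, and $\zeta^r_{-a}\equiv\xi_0(r-(a+1)h)$ for $a=1,\dots,M-1$. **Strict sense processes.** $(u,x,v)$ is a strict sense process if $u\in W^{1,1}([0,T],\mathbb R^m)$, $u(0)=0$, $\frac{du}{dt}\in\mathcal K$ a.e. in $[0,T]$, and $(du,|du|,\{\omega^r\equiv0\},x,v)$ is an impulse process. **Proposition.** Let $(\mu,\nu,\{\omega^r\}_{r\in[0,h]},x,v)$ be an impulse process. Then there exist a sequence of strict sense processes $(u_i,x_i,v_i)$ and a full measure subset $E\subseteq[0,T]$ with $0,T\in E$ such that $|du_i|=dv_i$ for every $i$, $$(du_i,|du_i|)\rightharpoonup^*(\mu,\nu),\qquad dx_i\rightharpoonup^*dx,\qquad (x_i,v_i)(t)\to(x,v)(t)\quad\text{for all }t\in E,$$ where $dx$, $dx_i$ are the Lebesgue–Stieltjes measures on $[0,T]$ determined by $dx([0,t])=x(t)-x(0)$, $t\in\,]0,T]$, and likewise for $x_i$. -/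

import Mathlib

open Set Filter Topology MeasureTheory

noncomputable section

namespace ImpulseDelay

/-! ### Vector-valued measures on an interval

An `ℝᵐ`-valued finite Borel measure is given by the tuple of its components, each a
`SignedMeasure ℝ`; measures on `[0,T]` are measures on `ℝ` that vanish outside `[0,T]`. -/

/-- The norm `‖w‖ = ∑ⱼ |wʲ|` on `ℝᵐ`. -/
def norm1 {m : ℕ} (w : Fin m → ℝ) : ℝ := ∑ j, |w j|

/-- The total variation `|μ| = ∑ⱼ (μʲ₊ + μʲ₋)` of a vector-valued measure. -/
def totalVar {m : ℕ} (μ : Fin m → SignedMeasure ℝ) : Measure ℝ :=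
  ∑ j, (μ j).totalVariation

/-- The continuous (atom-free) component of a finite measure. -/
def contPart (ν : Measure ℝ) : Measure ℝ := ν.restrict {t | ν {t} = 0}

/-- The continuous (atom-free) component of a signed measure. -/
def contPartSigned (s : SignedMeasure ℝ) : SignedMeasure ℝ := s.restrict {t | s {t} = 0}

/-- The signed measure `s` is carried by `[0,T]`. -/
def SupportedOn (T : ℝ) (s : SignedMeasure ℝ) : Prop := s.totalVariation (Icc 0 T)ᶜ = 0

/-- `s` is the Lebesgue--Stieltjes measure `dw` on `[0,T]` of a function `w` of bounded variation
on `[0,T]` which is right continuous on `]0,T]`: `dw([0,t]) = w(t) - w(0)` for `t ∈ ]0,T]`. -/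
def IsStieltjes (T : ℝ) (w : ℝ → ℝ) (s : SignedMeasure ℝ) : Prop :=
  SupportedOn T s ∧ ∀ t ∈ Ioc 0 T, s (Icc 0 t) = w t - w 0

/-- Weak-* convergence, in duality with `C([0,T],ℝ)`, of vector-valued measures. -/
def WeakStar {m : ℕ} (T : ℝ) (μs : ℕ → Fin m → SignedMeasure ℝ)
    (μ : Fin m → SignedMeasure ℝ) : Prop :=
  ∀ ψ : ℝ → ℝ, ContinuousOn ψ (Icc 0 T) → ∀ j,
    Tendsto (fun i => ∫ᵛ t in Icc 0 T, ψ t ∂<•(μs i j)) atTop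
      (𝓝 (∫ᵛ t in Icc 0 T, ψ t ∂<•(μ j)))

/-- Weak-* convergence, in duality with `C([0,T],ℝ)`, of nonnegative measures. -/
def WeakStarPos (T : ℝ) (νs : ℕ → Measure ℝ) (ν : Measure ℝ) : Prop :=
  ∀ ψ : ℝ → ℝ, ContinuousOn ψ (Icc 0 T) →
    Tendsto (fun i => ∫ t in Icc 0 T, ψ t ∂(νs i)) atTop (𝓝 (∫ t in Icc 0 T, ψ t ∂ν))

/-- The vector measures on `[0,T]` ranging over the closed cone `K`: the Radon--Nikodym density
`dμ/d|μ|` takes values in `K`, `|μ|`-almost everywhere. -/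
def RangesOver {m : ℕ} (T : ℝ) (K : Set (Fin m → ℝ)) (μ : Fin m → SignedMeasure ℝ) : Prop :=
  (∀ j, SupportedOn T (μ j)) ∧
    ∀ᵐ t ∂(totalVar μ), (fun j => (μ j).rnDeriv (totalVar μ) t) ∈ K

/-- `ν ∈ 𝒱_c(μ)`: the continuous component of `ν` is `|μᶜ|`, and `(μ,ν)` is the weak-* limit of
pairs `(μᵢ,|μᵢ|)` with `μᵢ` ranging over `K`. -/
def IsAssociatedVariation {m : ℕ} (T : ℝ) (K : Set (Fin m → ℝ)) (μ : Fin m → SignedMeasure ℝ)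
    (ν : Measure ℝ) : Prop :=
  IsFiniteMeasure ν ∧ ν (Icc 0 T)ᶜ = 0 ∧
  contPart ν = totalVar (fun j => contPartSigned (μ j)) ∧
  ∃ μs : ℕ → Fin m → SignedMeasure ℝ, (∀ i, RangesOver T K (μs i)) ∧
    WeakStar T μs μ ∧ WeakStarPos T (fun i => totalVar (μs i)) ν

/-! ### The delay system -/

/-- The data of the delayed control system together with the standing assumptions. The control set
`K` is a closed cone; `ξ₀` is the past history of the state, on `[-Mh,0]`. -/
structure DelaySystem (n m : ℕ) where
  N : ℕ
  M : ℕ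
  one_le_N : 1 ≤ N
  M_le_N : M ≤ N
  h : ℝ
  h_pos : 0 < h
  K : Set (Fin m → ℝ)
  K_nonempty : K.Nonempty
  K_closed : IsClosed K
  K_cone : ∀ c : ℝ, 0 ≤ c → ∀ w ∈ K, c • w ∈ K
  x₀ : Fin n → ℝ
  f : ℝ × (Fin (M + 1) → Fin n → ℝ) → Fin n → ℝ
  g : Fin m → ℝ × (Fin (M + 1) → Fin n → ℝ) → Fin n → ℝ
  f_contDiff : ContDiff ℝ 1 f
  g_contDiff : ∀ j, ContDiff ℝ 1 (g j)
  f_bounded : ∃ C, ∀ p, ‖f p‖ ≤ C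
  g_bounded : ∀ j, ∃ C, ∀ p, ‖g j p‖ ≤ C
  ξ₀ : ℝ → Fin n → ℝ
  ξ₀_continuous : ContinuousOn ξ₀ (Icc (-(M * h)) 0)

variable {n m : ℕ}

/-- The final time `T = N h`. -/
def DelaySystem.T (S : DelaySystem n m) : ℝ := S.N * S.h

/-- The delayed states `(x(t), x(t-h), …, x(t-Mh))`. -/
def DelaySystem.delayed (S : DelaySystem n m) (x : ℝ → Fin n → ℝ) (t : ℝ) :
    Fin (S.M + 1) → Fin n → ℝ :=
  fun k => x (t - (k : ℕ) * S.h)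

/-- `(μ, ν, {ω^r})` is an impulse control; `ω l r` is the function `ω^r_l` on `[0,1]`. Only the
indices `1 ≤ l ≤ N` and `r ∈ [0,h]` are meaningful; for other `l` the convention is `ω l r = 0`. -/
structure IsImpulseControl (S : DelaySystem n m) (μ : Fin m → SignedMeasure ℝ) (ν : Measure ℝ)
    (ω : ℤ → ℝ → ℝ → Fin m → ℝ) : Prop where
  ranges : RangesOver S.T S.K μ
  variation : IsAssociatedVariation S.T S.K μ ν
  memLp : ∀ l r, 1 ≤ l → l ≤ S.N → r ∈ Icc 0 S.h →
    MemLp (ω l r) ⊤ (volume.restrict (Icc 0 1))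
  mem_K : ∀ l r, 1 ≤ l → l ≤ S.N → r ∈ Icc 0 S.h → ∀ s ∈ Icc (0 : ℝ) 1, ω l r s ∈ S.K
  eq_zero : ∀ l r s, l < 1 ∨ S.N < l → ω l r s = 0
  /-- The total speed of the attached controls is constant on `[0,1]`. -/
  sum_norm : ∀ r ∈ Icc 0 S.h, ∀ᵐ s ∂(volume.restrict (Icc (0 : ℝ) 1)),
    ∑ l ∈ Finset.Icc (1 : ℤ) S.N, norm1 (ω l r s) =
      ∑ l ∈ Finset.Icc (1 : ℤ) S.N, ∫ s' in (0 : ℝ)..1, norm1 (ω l r s')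
  /-- Atoms of `ν` at the times `r + (l-1)h`, `0 < r < h`. -/
  atom_variation : ∀ r ∈ Ioo 0 S.h, ∀ l : ℤ, 1 ≤ l → l ≤ S.N →
    ∫ s in (0 : ℝ)..1, norm1 (ω l r s) = ν.real {r + (l - 1) * S.h}
  /-- Atoms of `ν` at the nodes `lh`, shared between `ω^h_l` and `ω^0_{l+1}`. -/
  atom_variation_node : ∀ l : ℤ, 0 ≤ l → l ≤ S.N →
    ∫ s in (0 : ℝ)..1, (norm1 (ω l S.h s) + norm1 (ω (l + 1) 0 s)) = ν.real {l * S.h}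
  /-- Atoms of `μ` at the times `r + (l-1)h`, `0 < r < h`. -/
  atom : ∀ r ∈ Ioo 0 S.h, ∀ l : ℤ, 1 ≤ l → l ≤ S.N → ∀ j,
    ∫ s in (0 : ℝ)..1, ω l r s j = μ j {r + (l - 1) * S.h}
  /-- Atoms of `μ` at the nodes `lh`. -/
  atom_node : ∀ l : ℤ, 0 ≤ l → l ≤ S.N → ∀ j,
    ∫ s in (0 : ℝ)..1, (ω l S.h s j + ω (l + 1) 0 s j) = μ j {l * S.h}

/-- The jump arcs `ζ^r_l`, `θ^r_l` on `[0,1]` (written `ζ l r`, `θ l r`) generated by the attached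
controls `ω` along `(x,v)`. The pairs `(l,r)` in question are those with `1 ≤ l ≤ N`, `r ∈ [0,h]`,
together with `(N+1, 0)`; the remaining values of `ζ` encode the past history. -/
structure IsJumpArcs (S : DelaySystem n m) (ω : ℤ → ℝ → ℝ → Fin m → ℝ)
    (x : ℝ → Fin n → ℝ) (v : ℝ → ℝ)
    (ζ : ℤ → ℝ → ℝ → Fin n → ℝ) (θ : ℤ → ℝ → ℝ → ℝ) : Prop where
  /-- `ζ^r_0`. -/
  ζ_zero : ∀ r ∈ Icc 0 S.h, ∀ s ∈ Icc (0 : ℝ) 1,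
    ((s < 1 ∨ r < S.h) → ζ 0 r s = S.ξ₀ (r - S.h)) ∧ (s = 1 → r = S.h → ζ 0 r s = S.x₀)
  /-- `ζ^r_{-a}`, for `a = 1, …, M-1`. -/
  ζ_neg : ∀ a : ℕ, 1 ≤ a → a + 1 ≤ S.M → ∀ r ∈ Icc 0 S.h, ∀ s ∈ Icc (0 : ℝ) 1,
    ζ (-a) r s = S.ξ₀ (r - (a + 1) * S.h)
  θ_zero : ∀ r ∈ Icc 0 S.h, ∀ s ∈ Icc (0 : ℝ) 1, θ 0 r s = 0
  ζ_continuous : ∀ (l : ℤ) (r : ℝ), 1 ≤ l → l ≤ S.N + 1 → r ∈ Icc 0 S.h → (l = S.N + 1 → r = 0) →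
    ContinuousOn (ζ l r) (Icc 0 1)
  /-- The jump equation for `ζ^r_l`, in integral form. -/
  ζ_ode : ∀ (l : ℤ) (r : ℝ), 1 ≤ l → l ≤ S.N + 1 → r ∈ Icc 0 S.h → (l = S.N + 1 → r = 0) →
    ∀ s ∈ Icc (0 : ℝ) 1, ζ l r s = ζ l r 0 + ∫ s' in (0 : ℝ)..s,
      ∑ j, ω l r s' j • S.g j (r + (l - 1) * S.h, fun k => ζ (l - (k : ℕ)) r s')
  ζ_init : ∀ (l : ℤ) (r : ℝ), 1 ≤ l → l ≤ S.N → r ∈ Ioc 0 S.h →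
    ζ l r 0 = Function.leftLim x (r + (l - 1) * S.h)
  ζ_init_node : ∀ l : ℤ, 1 ≤ l → l ≤ S.N + 1 → ζ l 0 0 = ζ (l - 1) S.h 1
  θ_eq : ∀ (l : ℤ) (r : ℝ), 1 ≤ l → l ≤ S.N + 1 → r ∈ Icc 0 S.h → (l = S.N + 1 → r = 0) →
    ∀ s ∈ Icc (0 : ℝ) 1, θ l r s = θ l r 0 + ∫ s' in (0 : ℝ)..s, norm1 (ω l r s')
  θ_init : ∀ (l : ℤ) (r : ℝ), 1 ≤ l → l ≤ S.N → r ∈ Ioc 0 S.h →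
    θ l r 0 = Function.leftLim v (r + (l - 1) * S.h)
  θ_init_node : ∀ l : ℤ, 1 ≤ l → l ≤ S.N + 1 → θ l 0 0 = θ (l - 1) S.h 1

/-- `(x,v)` is an impulse solution associated with `(μ, ν, {ω^r})`. The function `x` is meaningful
on `[-Mh,T]` and `v` on `[0,T]`. -/
structure IsImpulseSolution (S : DelaySystem n m) (μ : Fin m → SignedMeasure ℝ) (ν : Measure ℝ)
    (ω : ℤ → ℝ → ℝ → Fin m → ℝ) (x : ℝ → Fin n → ℝ) (v : ℝ → ℝ) : Prop where
  x_bv : BoundedVariationOn x (Icc 0 S.T)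
  v_bv : BoundedVariationOn v (Icc 0 S.T)
  x_past : ∀ t ∈ Ico (-(S.M * S.h)) 0, x t = S.ξ₀ t
  x_init : x 0 = S.x₀
  v_init : v 0 = 0
  arcs : ∃ (ζ : ℤ → ℝ → ℝ → Fin n → ℝ) (θ : ℤ → ℝ → ℝ → ℝ), IsJumpArcs S ω x v ζ θ ∧
    (∀ l : ℤ, 2 ≤ l → l ≤ S.N + 1 →
      x ((l - 1) * S.h) = ζ l 0 1 ∧ v ((l - 1) * S.h) = θ l 0 1) ∧
    ∀ l : ℤ, 1 ≤ l → l ≤ S.N → ∀ t ∈ Ioo ((l - 1) * S.h) (l * S.h),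
      Summable (fun r : Ioc 0 (t - (l - 1) * S.h) =>
        ζ l r 1 - Function.leftLim x (r + (l - 1) * S.h)) ∧
      Summable (fun r : Ioc 0 (t - (l - 1) * S.h) =>
        θ l r 1 - Function.leftLim v (r + (l - 1) * S.h)) ∧
      x t = ζ l 0 1 + (∫ t' in ((l - 1) * S.h)..t, S.f (t', S.delayed x t'))
        + (∑ j, ∫ᵛ t' in Icc ((l - 1) * S.h) t, S.g j (t', S.delayed x t')
            ∂<•(contPartSigned (μ j)))
        + ∑' r : Ioc 0 (t - (l - 1) * S.h),
            (ζ l r 1 - Function.leftLim x (r + (l - 1) * S.h)) ∧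
      v t = θ l 0 1 + (contPart ν).real (Icc ((l - 1) * S.h) t)
        + ∑' r : Ioc 0 (t - (l - 1) * S.h),
            (θ l r 1 - Function.leftLim v (r + (l - 1) * S.h))

/-- `(μ, ν, {ω^r}, x, v)` is an impulse process. -/
def IsImpulseProcess (S : DelaySystem n m) (μ : Fin m → SignedMeasure ℝ) (ν : Measure ℝ)
    (ω : ℤ → ℝ → ℝ → Fin m → ℝ) (x : ℝ → Fin n → ℝ) (v : ℝ → ℝ) : Prop :=
  IsImpulseControl S μ ν ω ∧ IsImpulseSolution S μ ν ω x v

/-- A strict sense control: `u ∈ W^{1,1}([0,T],ℝᵐ)`, `u(0) = 0` and `du/dt ∈ K` a.e. -/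
structure IsStrictSenseControl (S : DelaySystem n m) (u : ℝ → Fin m → ℝ) : Prop where
  ac : AbsolutelyContinuousOnInterval u 0 S.T
  init : u 0 = 0
  deriv_mem : ∀ᵐ t ∂(volume.restrict (Icc 0 S.T)), deriv u t ∈ S.K

/-- The vector measure `du = (du/dt) dt` on `[0,T]` of an absolutely continuous function `u`. -/
def controlMeasure (T : ℝ) (u : ℝ → Fin m → ℝ) : Fin m → SignedMeasure ℝ :=
  fun j => (volume.restrict (Icc 0 T)).withDensityᵥ (fun t => deriv u t j)

/-- `(u,x,v)` is a strict sense process: `u` is a strict sense control and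
`(du, |du|, {ω^r ≡ 0}, x, v)` is an impulse process. -/
def IsStrictSenseProcess (S : DelaySystem n m) (u : ℝ → Fin m → ℝ)
    (x : ℝ → Fin n → ℝ) (v : ℝ → ℝ) : Prop :=
  IsStrictSenseControl S u ∧
    IsImpulseProcess S (controlMeasure S.T u) (totalVar (controlMeasure S.T u))
      (fun _ _ _ => 0) x v

end ImpulseDelay

end

noncomputable section

namespace ImpulseDelay

/-! ### Signed measures with densities -/

section SignedMeasureTools

variable {E : Type*} [NormedAddCommGroup E] [NormedSpace ℝ E]

/-! The proof combines three devices: folding the time axis, unfolding the jumps, and regularizing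
the clock.

Folding. Regard the trajectory as `N` blocks x(r+(l-1)h), r ∈ [0,h], running in parallel. The
delayed values of block l at r are the values of blocks l-k at the same r, so the delay equation
becomes an ordinary system for the stack of blocks, coupled only by the rule that block l starts
where block l-1 ends. In the same way the delayed arguments of a jump equation are the arcs of the
earlier blocks at the same parameter s.

Unfolding. Let p be the measure on [0,h] made of Lebesgue measure, the translates of ν on the open
blocks, and at 0 and h the total mass of the controls attached there (an atom of ν at a node is
shared by two neighbouring blocks, so it has to be inserted separately). The distribution function
of p is the new time s ∈ [0,L]. Its generalized inverse, the clock, is 1-Lipschitz since p dominates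
Lebesgue measure, and it stands still on an interval of length p{r} over each atom r. There the jump
arcs are run. The total speed of the attached controls is constant and equal to p{r}, so after
rescaling every control has norm at most 1; away from the jumps the controls are densities of μᶜ,
obtained from a polar decomposition. The process thus turns into an integral system on [0,L] with
controls w of norm at most 1 and a clock rate a ∈ [0,1] (`IsImpulseProcess.exists_unfolding`,
resting on `IsClockMeasure.unfold_eq`). The measures μ, ν and dx are images under the clock of the
densities w, ‖w‖ and the unfolded field (`ClockData.eq_push`, `IsUnfolding.isStieltjes`).

Regularizing. The change of time cannot be undone directly because a may vanish. Replace a by c(a+ε)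
> 0, with c such that [0,L] is still mapped onto [0,h]. This clock is bi-Lipschitz, and dividing w
by its rate gives, in original time, a bounded control. Only nonnegative multiples of elements of
the cone occur, so no convexity is needed. Bounded controls generate strict sense processes, and the
blocks of these processes, read along the regularized clock, solve a small perturbation of the
unfolded system. Local Lipschitz bounds and Gronwall's inequality, applied block after block, give
uniform convergence on [0,L] (`UnfoldedControl.tendsto_regStack`).

Conclusion. The approximating measures are images, under clocks that converge uniformly, of
densities that are fixed or converge boundedly and pointwise; weak-* convergence is then dominated
convergence (`UnfoldedControl.tendsto_integral_push`). Pointwise convergence holds at every time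
whose position r in its block is shown by the limit clock only once, hence off a countable set; at 0
the values agree, and at T the parameter is always L. -/

theorem withDensityᵥ_restrict {κ : Measure ℝ} {g : ℝ → ℝ} (hg : Integrable g κ) {s : Set ℝ}
    (hs : MeasurableSet s) :
    (κ.withDensityᵥ g).restrict s = (κ.restrict s).withDensityᵥ g := by
  ext i hi
  rw [VectorMeasure.restrict_apply _ hs hi, withDensityᵥ_apply hg (hi.inter hs),
    withDensityᵥ_apply hg.restrict hi, Measure.restrict_restrict hi]

/-- The density is split into positive and negative parts, which reduces the vector integral to two
integrals against positive measures. -/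
theorem integral_withDensityᵥ {κ : Measure ℝ} {g : ℝ → ℝ} (hg : Integrable g κ)
    {f : ℝ → E} (hf : AEStronglyMeasurable f κ) (hgf : Integrable (fun t => g t • f t) κ) :
    ∫ᵛ t, f t ∂<•(κ.withDensityᵥ g) = ∫ t, g t • f t ∂κ := by
  have h1 : IsFiniteMeasure (κ.withDensity fun x => ENNReal.ofReal (g x)) :=
    isFiniteMeasure_withDensity_ofReal hg.2
  have h2 : IsFiniteMeasure (κ.withDensity fun x => ENNReal.ofReal (-g x)) :=
    isFiniteMeasure_withDensity_ofReal hg.neg.2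
  have hgm : AEMeasurable g κ := hg.aestronglyMeasurable.aemeasurable
  have key : ∀ g' : ℝ → ℝ, AEMeasurable g' κ → (∀ t, ‖max (g' t) 0‖ ≤ ‖g t‖) →
      Integrable f (κ.withDensity fun x => ENNReal.ofReal (g' x)) ∧
      ∫ t, f t ∂(κ.withDensity fun x => ENNReal.ofReal (g' x)) = ∫ t, max (g' t) 0 • f t ∂κ ∧
      Integrable (fun t => max (g' t) 0 • f t) κ := by
    intro g' hg' hle
    have e : (fun x => ENNReal.ofReal (g' x)) = fun x => ((g' x).toNNReal : ENNReal) := rfl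
    have hi : Integrable (fun t => max (g' t) 0 • f t) κ := by
      refine hgf.mono ((hg'.max aemeasurable_const).aestronglyMeasurable.smul hf)
        (ae_of_all _ fun t => ?_)
      rw [norm_smul, norm_smul]
      exact mul_le_mul_of_nonneg_right (hle t) (norm_nonneg _)
    refine ⟨?_, ?_, hi⟩
    · rw [e, integrable_withDensity_iff_integrable_smul₀ hg'.real_toNNReal]
      exact hi
    · rw [e, integral_withDensity_eq_integral_smul₀ hg'.real_toNNReal]
      rfl
  obtain ⟨a1, a2, a3⟩ := key g hgm fun t => by
    simp only [Real.norm_eq_abs]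
    rw [abs_of_nonneg (le_max_right _ _)]
    exact max_le (le_abs_self _) (abs_nonneg _)
  obtain ⟨b1, b2, b3⟩ := key (fun t => -g t) hgm.neg fun t => by
    simp only [Real.norm_eq_abs]
    rw [abs_of_nonneg (le_max_right _ _)]
    exact max_le (neg_le_abs _) (abs_nonneg _)
  rw [withDensityᵥ_eq_withDensity_pos_part_sub_withDensity_neg_part hg,
    VectorMeasure.integral_sub_vectorMeasure, VectorMeasure.integral_toSignedMeasure,
    VectorMeasure.integral_toSignedMeasure, a2, b2, ← integral_sub a3 b3]
  · congr 1
    ext t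
    rw [← sub_smul]
    congr 1
    rcases le_total 0 (g t) with h | h
    · simp [h]
    · simp [h]
  · simpa [VectorMeasure.Integrable] using a1
  · simpa [VectorMeasure.Integrable] using b1

theorem setIntegral_withDensityᵥ {κ : Measure ℝ} {g : ℝ → ℝ} (hg : Integrable g κ) {s : Set ℝ}
    (hs : MeasurableSet s) {f : ℝ → E} (hf : AEStronglyMeasurable f (κ.restrict s))
    (hgf : IntegrableOn (fun t => g t • f t) s κ) :
    ∫ᵛ t in s, f t ∂<•(κ.withDensityᵥ g) = ∫ t in s, g t • f t ∂κ := by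
  rw [withDensityᵥ_restrict hg hs]
  exact integral_withDensityᵥ hg.restrict hf hgf

end SignedMeasureTools

variable {m : ℕ}

theorem norm1_nonneg (w : Fin m → ℝ) : 0 ≤ norm1 w := Finset.sum_nonneg fun _ _ => abs_nonneg _

theorem abs_le_norm1 (w : Fin m → ℝ) (j : Fin m) : |w j| ≤ norm1 w :=
  Finset.single_le_sum (f := fun j => |w j|) (fun _ _ => abs_nonneg _) (Finset.mem_univ j)

theorem norm1_smul (c : ℝ) (w : Fin m → ℝ) : norm1 (c • w) = |c| * norm1 w := by
  simp [norm1, abs_mul, Finset.mul_sum]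

@[simp] theorem norm1_zero : norm1 (0 : Fin m → ℝ) = 0 := by simp [norm1]

theorem continuous_norm1 : Continuous (norm1 : (Fin m → ℝ) → ℝ) := by
  unfold norm1; fun_prop

theorem measurable_norm1 : Measurable (norm1 : (Fin m → ℝ) → ℝ) := continuous_norm1.measurable

theorem norm1_eq_zero {w : Fin m → ℝ} : norm1 w = 0 ↔ w = 0 := by
  refine ⟨fun h => funext fun j => ?_, fun h => h ▸ norm1_zero⟩
  have := abs_le_norm1 w j
  rw [h] at this
  exact abs_nonpos_iff.1 this

instance isFiniteMeasure_totalVar (μ : Fin m → SignedMeasure ℝ) : IsFiniteMeasure (totalVar μ) := by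
  unfold totalVar; infer_instance

theorem totalVariation_le_totalVar (μ : Fin m → SignedMeasure ℝ) (j : Fin m) :
    (μ j).totalVariation ≤ totalVar μ := by
  intro s
  rw [totalVar, Measure.finsetSum_apply]
  exact Finset.single_le_sum (f := fun j => (μ j).totalVariation s) (fun _ _ => zero_le)
    (Finset.mem_univ j)

/-- Each component has variation of density |g j|, and the norm on ℝᵐ is the sum of the absolute
values; this choice of norm makes the identity exact. -/
theorem totalVar_withDensityᵥ {κ : Measure ℝ} {g : Fin m → ℝ → ℝ} (hg : ∀ j, Integrable (g j) κ) :
    totalVar (fun j => κ.withDensityᵥ (g j)) =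
      κ.withDensity fun t => ENNReal.ofReal (norm1 fun j => g j t) := by
  unfold totalVar
  ext s hs
  rw [Measure.finsetSum_apply, withDensity_apply _ hs]
  simp_rw [SignedMeasure.totalVariation_eq_variation, Measure.variation_withDensityᵥ (hg _),
    withDensity_apply _ hs]
  rw [← lintegral_finsetSum' _ fun j _ => (hg j).aestronglyMeasurable.enorm.restrict]
  refine lintegral_congr fun t => ?_
  rw [norm1, ENNReal.ofReal_sum_of_nonneg fun _ _ => abs_nonneg _]
  exact Finset.sum_congr rfl fun j _ => by rw [← Real.norm_eq_abs, ofReal_norm]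

theorem withDensityᵥ_rnDeriv_totalVar (μ : Fin m → SignedMeasure ℝ) (j : Fin m) :
    (totalVar μ).withDensityᵥ ((μ j).rnDeriv (totalVar μ)) = μ j := by
  apply SignedMeasure.withDensityᵥ_rnDeriv_eq
  rw [SignedMeasure.absolutelyContinuous_ennreal_iff,
    show (totalVar μ).toENNRealVectorMeasure.ennrealToMeasure = totalVar μ from
      VectorMeasure.equivMeasure.right_inv _]
  exact Measure.absolutelyContinuous_of_le (totalVariation_le_totalVar μ j)

/-- Applying `totalVar_withDensityᵥ` to μ as a density of its own total variation exhibits |μ| as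
‖dμ/d|μ|‖·|μ|; uniqueness of densities gives the value 1. -/
theorem norm1_rnDeriv_totalVar (μ : Fin m → SignedMeasure ℝ) :
    ∀ᵐ t ∂(totalVar μ), norm1 (fun j => (μ j).rnDeriv (totalVar μ) t) = 1 := by
  have h := totalVar_withDensityᵥ (κ := totalVar μ)
    (g := fun j => (μ j).rnDeriv (totalVar μ)) fun j => SignedMeasure.integrable_rnDeriv _ _
  simp_rw [withDensityᵥ_rnDeriv_totalVar] at h
  have hm : Measurable fun t => ENNReal.ofReal (norm1 fun j => (μ j).rnDeriv (totalVar μ) t) :=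
    (measurable_norm1.comp (measurable_pi_lambda _ fun j =>
      SignedMeasure.measurable_rnDeriv _ _)).ennreal_ofReal
  have h2 : (fun t => ENNReal.ofReal (norm1 fun j => (μ j).rnDeriv (totalVar μ) t))
      =ᵐ[totalVar μ] 1 := by
    refine (withDensity_eq_iff_of_sigmaFinite hm.aemeasurable
      (measurable_one (α := ENNReal) (β := ℝ)).aemeasurable).1 ?_
    rw [← h, withDensity_one]
  filter_upwards [h2] with t ht
  exact ENNReal.ofReal_eq_one.1 ht

theorem countable_atoms (ν : Measure ℝ) [IsFiniteMeasure ν] : {t | ν {t} ≠ 0}.Countable := by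
  have := Measure.countable_meas_pos_of_disjoint_iUnion (μ := ν) (As := fun t : ℝ => {t})
    (fun t => measurableSet_singleton t) (fun a b hab => by simpa [Function.onFun] using hab)
  simpa [pos_iff_ne_zero] using this

theorem contPart_singleton (ν : Measure ℝ) [IsFiniteMeasure ν] (t : ℝ) : contPart ν {t} = 0 := by
  have hA : MeasurableSet {t | ν {t} = 0} := by
    have := (countable_atoms ν).measurableSet.compl
    simpa [Set.compl_ofPred] using this
  rw [contPart, Measure.restrict_apply (measurableSet_singleton t)]
  by_cases h : ν {t} = 0
  · exact measure_mono_null inter_subset_left h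
  · rw [show ({t} : Set ℝ) ∩ {t | ν {t} = 0} = ∅ by ext u; simp; rintro rfl; exact h]
    simp

theorem signedMeasure_congr_countable {s s' : SignedMeasure ℝ} {B : Set ℝ} (hB : B.Countable)
    (h : ∀ t ∈ B, s {t} = s' {t}) : s B = s' B := by
  have := hB.to_subtype
  have e : (⋃ t : B, ({(t : ℝ)} : Set ℝ)) = B := by simp
  have hd : Pairwise (Function.onFun Disjoint fun t : B => ({(t : ℝ)} : Set ℝ)) := fun a b hab => by
    simpa [Function.onFun] using fun h => hab (Subtype.ext h)
  have e1 := VectorMeasure.of_disjoint_iUnion (v := s) (f := fun t : B => ({(t : ℝ)} : Set ℝ))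
    (fun _ => measurableSet_singleton _) hd
  have e2 := VectorMeasure.of_disjoint_iUnion (v := s') (f := fun t : B => ({(t : ℝ)} : Set ℝ))
    (fun _ => measurableSet_singleton _) hd
  rw [e] at e1 e2
  rw [e1, e2]
  exact tsum_congr fun t => h t t.2

/-- Polar decomposition of the continuous component of a vector measure ranging over a cone. -/
theorem exists_polar_contPart {T : ℝ} {K : Set (Fin m → ℝ)} (hKc : IsClosed K)
    (hKn : K.Nonempty) (hK : ∀ c : ℝ, 0 ≤ c → ∀ w ∈ K, c • w ∈ K)
    {μ : Fin m → SignedMeasure ℝ} (hμ : RangesOver T K μ) :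
    ∃ k : ℝ → Fin m → ℝ, Measurable k ∧ (∀ t, k t ∈ K) ∧ (∀ t, norm1 (k t) ≤ 1) ∧
      (∀ᵐ t ∂(totalVar fun j => contPartSigned (μ j)), norm1 (k t) = 1) ∧
      ∀ j, contPartSigned (μ j) =
        (totalVar fun j => contPartSigned (μ j)).withDensityᵥ fun t => k t j := by
  have h0 : (0 : Fin m → ℝ) ∈ K := by
    obtain ⟨w, hw⟩ := hKn
    simpa using hK 0 le_rfl w hw
  set κ := totalVar μ with hκ
  set k0 : ℝ → Fin m → ℝ := fun t j => (μ j).rnDeriv κ t with hk0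
  have hk0m : Measurable k0 := measurable_pi_lambda _ fun j => SignedMeasure.measurable_rnDeriv _ _
  -- The Radon–Nikodym density is good only almost everywhere. Setting it to 0 ∈ K off G makes the
  -- cone condition and the norm bound hold at every point.
  set G : Set ℝ := {t | k0 t ∈ K ∧ norm1 (k0 t) = 1} with hG
  have hGm : MeasurableSet G := (hk0m hKc.measurableSet).inter
    ((measurable_norm1.comp hk0m) (measurableSet_singleton 1))
  have hGae : ∀ᵐ t ∂κ, t ∈ G := by
    filter_upwards [hμ.2, norm1_rnDeriv_totalVar μ] with t h1 h2 using ⟨h1, h2⟩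
  set A : Set ℝ := {t | κ {t} ≠ 0} with hA
  have hAc : A.Countable := countable_atoms κ
  have hcont : ∀ j, contPartSigned (μ j) = (κ.restrict Aᶜ).withDensityᵥ fun t => k0 t j := by
    intro j
    have hCc : {t | μ j {t} = 0}ᶜ.Countable := by
      refine hAc.mono fun t ht => ?_
      intro h
      apply ht
      exact SignedMeasure.null_of_totalVariation_zero _
        (le_antisymm ((totalVariation_le_totalVar μ j _).trans h.le) zero_le)
    have hCm : MeasurableSet {t | μ j {t} = 0} := by simpa using hCc.measurableSet.compl
    rw [← withDensityᵥ_restrict (SignedMeasure.integrable_rnDeriv _ _) hAc.measurableSet.compl]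
    rw [withDensityᵥ_rnDeriv_totalVar μ j]
    ext B hB
    rw [contPartSigned, VectorMeasure.restrict_apply _ hCm hB,
      VectorMeasure.restrict_apply _ hAc.measurableSet.compl hB]
    have hsub : B ∩ Aᶜ ⊆ B ∩ {t | μ j {t} = 0} := by
      rintro t ⟨h1, h2⟩
      refine ⟨h1, SignedMeasure.null_of_totalVariation_zero _
        (le_antisymm ((totalVariation_le_totalVar μ j _).trans ?_) zero_le)⟩
      simpa [hA] using le_of_eq (not_not.1 h2)
    -- An atom of the total variation need not be an atom of this component, so `contPartSigned` may
    -- keep it; but there are only countably many such points and the component gives each of them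
    -- mass zero.
    have hdiff : (μ j) ((B ∩ {t | μ j {t} = 0}) \ (B ∩ Aᶜ)) = 0 := by
      have hc : ((B ∩ {t | μ j {t} = 0}) \ (B ∩ Aᶜ)).Countable := by
        refine hAc.mono ?_
        rintro t ⟨⟨h1, h2⟩, h3⟩
        by_contra h4
        exact h3 ⟨h1, h4⟩
      exact signedMeasure_congr_countable (s' := 0) hc fun t ht => ht.1.2
    have := VectorMeasure.of_add_of_sdiff (v := μ j) (hB.inter hAc.measurableSet.compl)
      (hB.inter hCm) hsub
    rw [hdiff, add_zero] at this
    exact this.symm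
  have htv : totalVar (fun j => contPartSigned (μ j)) = κ.restrict Aᶜ := by
    simp_rw [hcont]
    rw [totalVar_withDensityᵥ fun j => (SignedMeasure.integrable_rnDeriv _ _).restrict]
    have : (fun t => ENNReal.ofReal (norm1 fun j => k0 t j)) =ᵐ[κ.restrict Aᶜ] 1 := by
      filter_upwards [ae_restrict_of_ae hGae] with t ht
      have := ht.2
      simp only [Pi.one_apply]
      rw [show (fun j => k0 t j) = k0 t from rfl, this]
      simp
    rw [withDensity_congr_ae this, withDensity_one]
  refine ⟨G.indicator k0, hk0m.indicator hGm, fun t => ?_, fun t => ?_, ?_, fun j => ?_⟩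
  · by_cases ht : t ∈ G
    · rw [indicator_of_mem ht]; exact ht.1
    · rw [indicator_of_notMem ht]; exact h0
  · by_cases ht : t ∈ G
    · rw [indicator_of_mem ht]; exact ht.2.le
    · rw [indicator_of_notMem ht]; simp
  · rw [htv]
    filter_upwards [ae_restrict_of_ae hGae] with t ht
    rw [indicator_of_mem ht]; exact ht.2
  · rw [htv, hcont j]
    have hae : (fun t => k0 t j) =ᵐ[κ.restrict Aᶜ] fun t => G.indicator k0 t j := by
      filter_upwards [ae_restrict_of_ae hGae] with t ht
      rw [indicator_of_mem ht]
    exact ((SignedMeasure.integrable_rnDeriv (μ j) κ).restrict.withDensityᵥ_eq_iff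
      ((SignedMeasure.integrable_rnDeriv (μ j) κ).restrict.congr hae)).2 hae

/-- Domination, not just absolute continuity, bounds the Radon–Nikodym derivative by 1 almost
everywhere; truncating at 1 makes the bound pointwise. These bounds become the bounds on the clock
rate and on the unfolded controls. -/
theorem exists_density_le_one {α β : Measure ℝ} [IsFiniteMeasure α] [IsFiniteMeasure β]
    (h : α ≤ β) : ∃ D : ℝ → ℝ, Measurable D ∧ (∀ t, 0 ≤ D t) ∧ (∀ t, D t ≤ 1) ∧
      α = β.withDensity fun t => ENNReal.ofReal (D t) := by
  refine ⟨fun t => min (α.rnDeriv β t).toReal 1, by fun_prop,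
    fun t => le_min ENNReal.toReal_nonneg zero_le_one, fun t => min_le_right _ _, ?_⟩
  nth_rw 1 [← Measure.withDensity_rnDeriv_eq α β (Measure.absolutelyContinuous_of_le h)]
  refine withDensity_congr_ae ?_
  filter_upwards [Measure.rnDeriv_le_one_of_le h] with t ht
  have h1 : α.rnDeriv β t ≠ ⊤ := ne_top_of_le_ne_top ENNReal.one_ne_top ht
  have h2 : (α.rnDeriv β t).toReal ≤ 1 := by
    simpa using (ENNReal.toReal_le_toReal h1 ENNReal.one_ne_top).2 ht
  rw [min_eq_left h2, ENNReal.ofReal_toReal h1]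

/-- Signed measures which agree on the points of a countable set and off that set are equal. -/
theorem signedMeasure_ext_countable {s s' : SignedMeasure ℝ} {C : Set ℝ} (hC : C.Countable)
    (h1 : ∀ t ∈ C, s {t} = s' {t})
    (h2 : ∀ B, MeasurableSet B → Disjoint B C → s B = s' B) : s = s' := by
  have key : ∀ B ⊆ C, s B = s' B := fun B hB =>
    signedMeasure_congr_countable (hC.mono hB) fun t ht => h1 t (hB ht)
  ext B hB
  have hCm := hC.measurableSet
  rw [← VectorMeasure.of_add_of_sdiff (v := s) (hB.inter hCm) hB inter_subset_left,
    ← VectorMeasure.of_add_of_sdiff (v := s') (hB.inter hCm) hB inter_subset_left,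
    key _ inter_subset_right, h2 _ (hB.diff (hB.inter hCm))]
  rw [Set.disjoint_left]
  rintro t ⟨h3, h4⟩ h5
  exact h4 ⟨h3, h5⟩

end ImpulseDelay

end

noncomputable section

namespace ImpulseDelay

/-! ### The clock of a finite measure on `[0,h]` -/

/-- The distribution function of `p`. -/
def cumul (p : Measure ℝ) (r : ℝ) : ℝ := p.real (Iic r)

/-- The left limit of the distribution function of `p`. -/
def cumulLeft (p : Measure ℝ) (r : ℝ) : ℝ := p.real (Iio r)

/-- The generalized inverse of the distribution function of `p`. -/
def clock (p : Measure ℝ) (s : ℝ) : ℝ := sInf {r | 0 ≤ r ∧ min s (p.real univ) ≤ cumul p r}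

/-- A finite measure on `[0,h]` dominating Lebesgue measure. -/
structure IsClockMeasure (p : Measure ℝ) (h : ℝ) : Prop where
  finite : IsFiniteMeasure p
  pos : 0 < h
  supp : p (Icc 0 h)ᶜ = 0
  volume_le : volume.restrict (Ioo 0 h) ≤ p

section

variable {p : Measure ℝ}

theorem cumul_mono [IsFiniteMeasure p] : Monotone (cumul p) := fun _ _ h =>
  measureReal_mono (Iic_subset_Iic.2 h)

theorem cumulLeft_le_cumul [IsFiniteMeasure p] (r : ℝ) : cumulLeft p r ≤ cumul p r :=
  measureReal_mono Iio_subset_Iic_self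

theorem cumul_le_cumulLeft [IsFiniteMeasure p] {r r' : ℝ} (h : r < r') :
    cumul p r ≤ cumulLeft p r' :=
  measureReal_mono (Iic_subset_Iio.2 h)

theorem cumulLeft_add_atom [IsFiniteMeasure p] (r : ℝ) :
    cumulLeft p r + p.real {r} = cumul p r := by
  rw [cumul, cumulLeft, ← measureReal_union (by simp) (measurableSet_singleton r)]
  congr 1
  ext x
  simp [le_iff_lt_or_eq]

theorem cumul_nonneg (r : ℝ) : 0 ≤ cumul p r := measureReal_nonneg

theorem cumulLeft_nonneg (r : ℝ) : 0 ≤ cumulLeft p r := measureReal_nonneg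

theorem cumul_le_total [IsFiniteMeasure p] (r : ℝ) : cumul p r ≤ p.real univ :=
  measureReal_mono (subset_univ _)

/-- Right continuity of the distribution function, from continuity of the measure along decreasing
half-lines. -/
theorem le_cumul_of_forall_gt [IsFiniteMeasure p] {r y : ℝ} (h : ∀ r' > r, y ≤ cumul p r') :
    y ≤ cumul p r := by
  have h1 : Tendsto (fun n : ℕ => p (Iic (r + 1 / ((n : ℝ) + 1)))) atTop
      (𝓝 (p (⋂ n : ℕ, Iic (r + 1 / ((n : ℝ) + 1))))) := by
    refine tendsto_measure_iInter_atTop (fun n => measurableSet_Iic.nullMeasurableSet) ?_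
      ⟨0, measure_ne_top _ _⟩
    intro a b hab
    refine Iic_subset_Iic.2 ?_
    have := Nat.one_div_le_one_div (α := ℝ) hab
    linarith
  have h2 : (⋂ n : ℕ, Iic (r + 1 / ((n : ℝ) + 1))) = Iic r := by
    ext x
    simp only [mem_iInter, mem_Iic]
    refine ⟨fun hx => ?_, fun hx n => hx.trans (by linarith [Nat.one_div_pos_of_nat (α := ℝ) (n := n)])⟩
    have := (tendsto_const_nhds (x := r)).add (tendsto_one_div_add_atTop_nhds_zero_nat (𝕜 := ℝ))
    rw [add_zero] at this
    exact ge_of_tendsto' this hx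
  rw [h2] at h1
  have h3 := (ENNReal.tendsto_toReal (measure_ne_top p (Iic r))).comp h1
  exact ge_of_tendsto' h3 fun n => h _ (by
    have := Nat.one_div_pos_of_nat (α := ℝ) (n := n)
    linarith)

theorem exists_lt_cumul_of_lt_cumulLeft [IsFiniteMeasure p] {r y : ℝ} (h : y < cumulLeft p r) :
    ∃ r' < r, y < cumul p r' := by
  by_contra hcon
  push Not at hcon
  have h1 : Tendsto (fun n : ℕ => p (Iic (r - 1 / ((n : ℝ) + 1)))) atTop
      (𝓝 (p (⋃ n : ℕ, Iic (r - 1 / ((n : ℝ) + 1))))) := by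
    refine tendsto_measure_iUnion_atTop ?_
    intro a b hab
    refine Iic_subset_Iic.2 ?_
    have := Nat.one_div_le_one_div (α := ℝ) hab
    linarith
  have h2 : (⋃ n : ℕ, Iic (r - 1 / ((n : ℝ) + 1))) = Iio r := by
    ext x
    simp only [mem_iUnion, mem_Iic, mem_Iio]
    constructor
    · rintro ⟨n, hn⟩
      have := Nat.one_div_pos_of_nat (α := ℝ) (n := n)
      linarith
    · intro hx
      obtain ⟨n, hn⟩ := exists_nat_one_div_lt (sub_pos.2 hx)
      exact ⟨n, by linarith⟩
  rw [h2] at h1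
  have h3 := (ENNReal.tendsto_toReal (measure_ne_top p (Iio r))).comp h1
  have : cumulLeft p r ≤ y := le_of_tendsto' h3 fun n => hcon _ (by
    have := Nat.one_div_pos_of_nat (α := ℝ) (n := n)
    linarith)
  linarith

theorem tendsto_cumul_left [IsFiniteMeasure p] (r : ℝ) :
    Tendsto (cumul p) (𝓝[<] r) (𝓝 (cumulLeft p r)) := by
  rw [tendsto_order]
  refine ⟨fun y hy => ?_, fun y hy => ?_⟩
  · obtain ⟨r', hr', h⟩ := exists_lt_cumul_of_lt_cumulLeft hy
    filter_upwards [Ioo_mem_nhdsLT hr'] with x hx using h.trans_le (cumul_mono hx.1.le)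
  · filter_upwards [self_mem_nhdsWithin] with x hx using (cumul_le_cumulLeft hx).trans_lt hy

end

namespace IsClockMeasure

variable {p : Measure ℝ} {h : ℝ} (hp : IsClockMeasure p h)

include hp

theorem cumul_h : cumul p h = p.real univ := by
  have := hp.finite
  rw [cumul, measureReal_def, measureReal_def]
  congr 1
  refine le_antisymm (measure_mono (subset_univ _)) ?_
  rw [← union_compl_self (Iic h)]
  refine (measure_union_le _ _).trans ?_
  rw [measure_mono_null (t := (Icc 0 h)ᶜ) (fun x (hx : x ∈ (Iic h)ᶜ) h2 => hx h2.2) hp.supp, add_zero]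

theorem cumulLeft_zero : cumulLeft p 0 = 0 := by
  rw [cumulLeft, measureReal_def,
    measure_mono_null (s := Iio 0) (t := (Icc 0 h)ᶜ) (fun x hx h2 => not_lt.2 h2.1 hx) hp.supp]
  rfl

/-- The open interval between the two points has mass at least its length. Coinciding points are a
separate alternative, because the right-hand difference is then minus the mass of the atom. -/
theorem sub_le {r r' : ℝ} (h0 : 0 ≤ r) (hr : r ≤ r') (hh : r' ≤ h) :
    r' - r ≤ cumulLeft p r' - cumul p r ∨ r = r' := by
  have := hp.finite
  rcases hr.eq_or_lt with h1 | h1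
  · exact Or.inr h1
  left
  have h2 : p.real (Iio r') = p.real (Iic r) + p.real (Ioo r r') := by
    rw [← measureReal_union (by
      rw [Set.disjoint_left]; intro x hx hx'; exact not_lt.2 hx hx'.1) measurableSet_Ioo]
    rw [Iic_union_Ioo_eq_Iio h1]
  have h3 : r' - r ≤ p.real (Ioo r r') := by
    have h4 := hp.volume_le (Ioo r r')
    rw [Measure.restrict_apply measurableSet_Ioo, inter_eq_left.2 (Ioo_subset_Ioo h0 hh),
      Real.volume_Ioo] at h4
    rw [measureReal_def]
    exact (ENNReal.ofReal_le_iff_le_toReal (measure_ne_top _ _)).1 h4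
  unfold cumul cumulLeft
  linarith

theorem total_pos : 0 < p.real univ := by
  have := hp.finite
  rcases hp.sub_le le_rfl hp.pos.le le_rfl with h1 | h1
  · have h2 := cumulLeft_le_cumul (p := p) h
    rw [hp.cumul_h] at h2
    have := cumul_nonneg (p := p) 0
    linarith [hp.pos]
  · exact absurd h1 hp.pos.ne

/-- The Galois connection between the distribution function and its inverse: by right continuity the
infimum defining the clock is attained. -/
theorem clock_le_iff {s r : ℝ} (hr : 0 ≤ r) :
    clock p s ≤ r ↔ min s (p.real univ) ≤ cumul p r := by
  have := hp.finite
  have hbdd : BddBelow {r | 0 ≤ r ∧ min s (p.real univ) ≤ cumul p r} := ⟨0, fun x hx => hx.1⟩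
  have hne : {r | 0 ≤ r ∧ min s (p.real univ) ≤ cumul p r}.Nonempty :=
    ⟨h, hp.pos.le, by rw [hp.cumul_h]; exact min_le_right _ _⟩
  refine ⟨fun hle => le_cumul_of_forall_gt fun r' hr' => ?_, fun hle => csInf_le hbdd ⟨hr, hle⟩⟩
  obtain ⟨x, hx, hxr⟩ := exists_lt_of_csInf_lt hne (lt_of_le_of_lt hle hr')
  exact hx.2.trans (cumul_mono hxr.le)

omit hp in
theorem clock_nonneg (s : ℝ) : 0 ≤ clock p s := Real.sInf_nonneg fun _ hx => hx.1

theorem clock_le (s : ℝ) : clock p s ≤ h := by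
  rw [hp.clock_le_iff hp.pos.le, hp.cumul_h]; exact min_le_right _ _

theorem clock_mem (s : ℝ) : clock p s ∈ Icc 0 h := ⟨clock_nonneg s, hp.clock_le s⟩

theorem clock_mono : Monotone (clock p) := fun s s' hs => by
  rw [hp.clock_le_iff (clock_nonneg _)]
  exact (min_le_min_right _ hs).trans ((hp.clock_le_iff (clock_nonneg _)).1 le_rfl)

theorem clock_lt_of_lt {s r : ℝ} (hs : s ≤ p.real univ) (h0 : 0 ≤ r) (hlt : s < cumulLeft p r) :
    clock p s < r ∨ r = 0 := by
  have := hp.finite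
  rcases h0.eq_or_lt with h1 | h1
  · exact Or.inr h1.symm
  left
  obtain ⟨r', hr', h2⟩ := exists_lt_cumul_of_lt_cumulLeft hlt
  rcases le_total 0 r' with h3 | h3
  · refine lt_of_le_of_lt ((hp.clock_le_iff h3).2 ?_) hr'
    rw [min_eq_left hs]; exact h2.le
  · refine lt_of_le_of_lt ((hp.clock_le_iff le_rfl).2 ?_) h1
    rw [min_eq_left hs]; exact h2.le.trans (cumul_mono h3)

theorem cumulLeft_le_of_le_clock {s r : ℝ} (hs : s ∈ Icc 0 (p.real univ)) (h0 : 0 ≤ r)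
    (hle : r ≤ clock p s) : cumulLeft p r ≤ s := by
  by_contra hlt
  push Not at hlt
  rcases hp.clock_lt_of_lt hs.2 h0 hlt with h1 | h1
  · linarith
  · rw [h1, hp.cumulLeft_zero] at hlt
    linarith [hs.1]

/-- Since Lebesgue measure is dominated, the distribution function has no flat piece in [0,h], so
the clock cannot lag behind r. -/
theorem le_clock_of_cumulLeft_le {s r : ℝ} (hs : s ∈ Icc 0 (p.real univ)) (hh : r ≤ h)
    (hle : cumulLeft p r ≤ s) : r ≤ clock p s := by
  by_contra hlt
  push Not at hlt
  have h1 := (hp.clock_le_iff (clock_nonneg s)).1 le_rfl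
  rw [min_eq_left hs.2] at h1
  rcases hp.sub_le (clock_nonneg s) hlt.le hh with h2 | h2
  · linarith
  · exact hlt.ne h2

/-- The fibre of the clock over r is the interval swept by the jump of the distribution function at
r; this is where the jump arc at r will be run. -/
theorem clock_eq_iff {s r : ℝ} (hs : s ∈ Icc 0 (p.real univ)) (hr : r ∈ Icc 0 h) :
    clock p s = r ↔ cumulLeft p r ≤ s ∧ s ≤ cumul p r := by
  constructor
  · rintro rfl
    refine ⟨hp.cumulLeft_le_of_le_clock hs hr.1 le_rfl, ?_⟩
    have h1 := (hp.clock_le_iff (clock_nonneg s)).1 le_rfl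
    rwa [min_eq_left hs.2] at h1
  · rintro ⟨h1, h2⟩
    refine le_antisymm ((hp.clock_le_iff hr.1).2 ?_) (hp.le_clock_of_cumulLeft_le hs hr.2 h1)
    rwa [min_eq_left hs.2]

theorem cumul_mem (r : ℝ) : cumul p r ∈ Icc 0 (p.real univ) := by
  have := hp.finite
  exact ⟨cumul_nonneg _, cumul_le_total _⟩

theorem cumulLeft_mem (r : ℝ) : cumulLeft p r ∈ Icc 0 (p.real univ) := by
  have := hp.finite
  exact ⟨cumulLeft_nonneg _, (cumulLeft_le_cumul r).trans (cumul_le_total r)⟩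

theorem clock_cumul {r : ℝ} (hr : r ∈ Icc 0 h) : clock p (cumul p r) = r := by
  have := hp.finite
  exact (hp.clock_eq_iff (hp.cumul_mem r) hr).2 ⟨cumulLeft_le_cumul r, le_rfl⟩

theorem clock_total : clock p (p.real univ) = h := by
  rw [← hp.cumul_h]; exact hp.clock_cumul ⟨hp.pos.le, le_rfl⟩

theorem clock_preimage {r : ℝ} (hr : r ∈ Icc 0 h) :
    Icc 0 (p.real univ) ∩ clock p ⁻¹' {r} = Icc (cumulLeft p r) (cumul p r) := by
  ext s
  constructor
  · rintro ⟨h1, h2⟩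
    exact (hp.clock_eq_iff h1 hr).1 h2
  · intro h1
    have h2 : s ∈ Icc 0 (p.real univ) :=
      ⟨(hp.cumulLeft_mem r).1.trans h1.1, h1.2.trans (hp.cumul_mem r).2⟩
    exact ⟨h2, (hp.clock_eq_iff h2 hr).2 h1⟩

/-- Between two clock readings the distribution function gains at least their distance, by `sub_le`,
and at most the elapsed new time. -/
theorem clock_sub_le {s s' : ℝ} (hs : 0 ≤ s) (hss : s ≤ s') (hs' : s' ≤ p.real univ) :
    clock p s' - clock p s ≤ s' - s := by
  have h1 := ((hp.clock_eq_iff ⟨hs, hss.trans hs'⟩ (hp.clock_mem s)).1 rfl).2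
  have h2 := ((hp.clock_eq_iff ⟨hs.trans hss, hs'⟩ (hp.clock_mem s')).1 rfl).1
  rcases hp.sub_le (clock_nonneg s) (hp.clock_mono hss) (hp.clock_le s') with h3 | h3
  · linarith
  · linarith

theorem clock_clamp (s : ℝ) : clock p s = clock p (max 0 (min s (p.real univ))) := by
  refine le_antisymm ?_ ?_
  · rw [hp.clock_le_iff (clock_nonneg _)]
    exact (le_max_right _ _).trans ((min_eq_left (max_le hp.total_pos.le (min_le_right _ _))).ge.trans
      ((hp.clock_le_iff (clock_nonneg _)).1 le_rfl))
  · rw [hp.clock_le_iff (clock_nonneg _)]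
    exact (min_le_left _ _).trans (max_le (cumul_nonneg _)
      ((hp.clock_le_iff (clock_nonneg _)).1 le_rfl))

theorem continuous_clock : Continuous (clock p) := by
  have h1 : LipschitzOnWith 1 (clock p) (Icc 0 (p.real univ)) := by
    refine LipschitzOnWith.of_dist_le_mul fun x hx y hy => ?_
    rw [NNReal.coe_one, one_mul, Real.dist_eq, Real.dist_eq]
    rcases le_total x y with hxy | hxy
    · rw [abs_sub_comm, abs_of_nonneg (sub_nonneg.2 (hp.clock_mono hxy)), abs_sub_comm x,
        abs_of_nonneg (sub_nonneg.2 hxy)]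
      exact hp.clock_sub_le hx.1 hxy hy.2
    · rw [abs_of_nonneg (sub_nonneg.2 (hp.clock_mono hxy)), abs_of_nonneg (sub_nonneg.2 hxy)]
      exact hp.clock_sub_le hy.1 hxy hx.2
  have h2 : clock p = clock p ∘ fun s => max 0 (min s (p.real univ)) := funext hp.clock_clamp
  rw [h2]
  refine h1.continuousOn.comp_continuous (by fun_prop) fun s => ?_
  exact ⟨le_max_left _ _, max_le hp.total_pos.le (min_le_right _ _)⟩

theorem measurable_clock : Measurable (clock p) := hp.continuous_clock.measurable

/-- Inverse transform sampling: the preimage of ]-∞,r] is [0, `cumul p r`], whose length is the mass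
of ]-∞,r], and half-lines determine a finite measure. -/
theorem map_clock : Measure.map (clock p) (volume.restrict (Icc 0 (p.real univ))) = p := by
  have := hp.finite
  refine Measure.ext_of_Iic _ _ fun r => ?_
  rw [Measure.map_apply hp.measurable_clock measurableSet_Iic,
    Measure.restrict_apply (hp.measurable_clock measurableSet_Iic)]
  rcases lt_or_ge r 0 with hr | hr
  · rw [measure_mono_null (s := Iic r) (t := (Icc 0 h)ᶜ)
      (fun x (hx : x ≤ r) h2 => by linarith [h2.1]) hp.supp]
    rw [show clock p ⁻¹' Iic r ∩ Icc 0 (p.real univ) = ∅ by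
      ext s
      simp only [mem_inter_iff, mem_preimage, mem_Iic, mem_Icc, mem_empty_iff_false, iff_false]
      intro h1
      linarith [h1.1, clock_nonneg (p := p) s]]
    simp
  · rw [show clock p ⁻¹' Iic r ∩ Icc 0 (p.real univ) = Icc 0 (cumul p r) by
      ext s
      simp only [mem_inter_iff, mem_preimage, mem_Iic, mem_Icc, hp.clock_le_iff hr]
      constructor
      · rintro ⟨h1, h2, h3⟩
        rw [min_eq_left h3] at h1
        exact ⟨h2, h1⟩
      · rintro ⟨h1, h2⟩
        have h3 := h2.trans (hp.cumul_mem r).2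
        rw [min_eq_left h3]
        exact ⟨h2, h1, h3⟩]
    rw [Real.volume_Icc, sub_zero, cumul, measureReal_def, ENNReal.ofReal_toReal (measure_ne_top _ _)]

/-- Change of variables along the clock, away from a set carrying the atoms. -/
theorem setIntegral_clock {E : Type*} [NormedAddCommGroup E] [NormedSpace ℝ E]
    {α : Measure ℝ} {d : ℝ → ℝ} (hd : Measurable d) (hd0 : ∀ t, 0 ≤ d t)
    (hα : α = p.withDensity fun t => ENNReal.ofReal (d t)) {B : Set ℝ} (hB : MeasurableSet B)
    {H : ℝ → E} (hH : AEStronglyMeasurable H (p.restrict B)) :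
    ∫ s in Icc 0 (p.real univ) ∩ clock p ⁻¹' B, d (clock p s) • H (clock p s) = ∫ t in B, H t ∂α := by
  have h1 : ∫ t in B, d t • H t ∂p =
      ∫ s in Icc 0 (p.real univ) ∩ clock p ⁻¹' B, d (clock p s) • H (clock p s) := by
    have hm := hp.map_clock
    have : AEStronglyMeasurable (fun t => d t • H t)
        ((Measure.map (clock p) (volume.restrict (Icc 0 (p.real univ)))).restrict B) := by
      rw [hm]; exact hd.aestronglyMeasurable.smul hH
    nth_rw 1 [← hm]
    rw [Measure.restrict_map hp.measurable_clock hB] at this ⊢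
    rw [integral_map hp.measurable_clock.aemeasurable this,
      Measure.restrict_restrict (hp.measurable_clock hB), inter_comm]
  rw [← h1, hα]
  have e : (fun x => ENNReal.ofReal (d x)) = fun x => ((d x).toNNReal : ENNReal) := rfl
  rw [e, setIntegral_withDensity_eq_setIntegral_smul hd.real_toNNReal _ hB]
  refine integral_congr_ae (ae_of_all _ fun t => ?_)
  simp only [NNReal.smul_def, Real.coe_toNNReal _ (hd0 t)]

/-- Transporting the clock measure back shows that the integral of the rate over the preimage of B
is the Lebesgue measure of B ∩ ]0,h[. Suppressing the rate on a countable set changes nothing, since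
Lebesgue measure ignores that set; this allows the clock to be declared at rest on the jumps. -/
theorem clock_eq_integral {D : ℝ → ℝ} (hD : Measurable D) (hD0 : ∀ t, 0 ≤ D t)
    (hD1 : ∀ t, D t ≤ 1)
    (hα : volume.restrict (Ioo 0 h) = p.withDensity fun t => ENNReal.ofReal (D t))
    {C : Set ℝ} (hC : C.Countable) {s : ℝ} (hs : s ∈ Icc 0 (p.real univ)) :
    clock p s = ∫ s' in (0 : ℝ)..s, Cᶜ.indicator D (clock p s') := by
  set a : ℝ → ℝ := fun s' => Cᶜ.indicator D (clock p s') with ha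
  have ham : Measurable a :=
    (hD.indicator hC.measurableSet.compl).comp hp.measurable_clock
  have ha0 : ∀ s, 0 ≤ a s := fun s => indicator_nonneg (fun _ _ => hD0 _) _
  have ha1 : ∀ s, ‖a s‖ ≤ 1 := fun s => by
    rw [Real.norm_of_nonneg (ha0 s)]
    exact indicator_apply_le' (fun _ => hD1 _) fun _ => zero_le_one
  have hint : ∀ A : Set ℝ, A ⊆ Icc 0 (p.real univ) → IntegrableOn a A := fun A hA =>
    (Measure.integrableOn_of_bounded (by simp) ham.aestronglyMeasurable
      (ae_of_all _ ha1) : IntegrableOn a (Icc 0 (p.real univ))).mono_set hA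
  have key : ∀ B : Set ℝ, MeasurableSet B →
      ∫ s' in Icc 0 (p.real univ) ∩ clock p ⁻¹' B, a s' = (volume (B ∩ Ioo 0 h)).toReal := by
    intro B hB
    have hBC : MeasurableSet (B \ C) := hB.diff hC.measurableSet
    have h1 := hp.setIntegral_clock hD hD0 hα hBC (H := fun _ => (1 : ℝ))
      aestronglyMeasurable_const
    have h2 : ∫ s' in Icc 0 (p.real univ) ∩ clock p ⁻¹' B, a s' =
        ∫ s in Icc 0 (p.real univ) ∩ clock p ⁻¹' (B \ C), D (clock p s) • (1 : ℝ) := by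
      rw [setIntegral_eq_of_subset_of_forall_sdiff_eq_zero
        (s := Icc 0 (p.real univ) ∩ clock p ⁻¹' (B \ C))
        (measurableSet_Icc.inter (hp.measurable_clock hB))
        (inter_subset_inter_right _ (preimage_mono sdiff_subset))]
      · refine setIntegral_congr_fun (measurableSet_Icc.inter (hp.measurable_clock hBC)) ?_
        intro s hs
        have h5 : clock p s ∈ Cᶜ := hs.2.2
        simp only [ha, smul_eq_mul, mul_one, indicator_of_mem h5]
      · rintro s ⟨⟨h1, h2⟩, h3⟩
        have : clock p s ∈ C := by
          by_contra h4
          exact h3 ⟨h1, h2, h4⟩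
        simp [ha, this]
    rw [h2, h1]
    rw [setIntegral_const, smul_eq_mul, mul_one, measureReal_def, Measure.restrict_apply hBC]
    congr 1
    refine measure_congr ?_
    have : (B \ C : Set ℝ) =ᵐ[volume] B := sdiff_null_ae_eq_self (hC.measure_zero _)
    exact this.inter (ae_eq_refl _)
  let r := clock p s
  have hrm := hp.clock_mem s
  rw [intervalIntegral.integral_of_le hs.1]
  -- With r the reading at s, the interval [0,s] contains the preimage of ]-∞,r[ and lies in that of
  -- ]-∞,r]. The integral of the rate over the first is r, and over the second at most r.
  refine le_antisymm ?_ ?_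
  · have h1 := key (Iio r) measurableSet_Iio
    rw [show Iio r ∩ Ioo 0 h = Ioo 0 r by
      ext x; simp only [mem_inter_iff, mem_Iio, mem_Ioo]
      exact ⟨fun h => ⟨h.2.1, h.1⟩, fun h => ⟨h.2, h.1, h.2.trans_le hrm.2⟩⟩, Real.volume_Ioo,
      sub_zero, ENNReal.toReal_ofReal hrm.1] at h1
    change clock p s ≤ _
    rw [← h1]
    rw [← integral_Icc_eq_integral_Ioc]
    refine setIntegral_mono_set (hint _ (Icc_subset_Icc_right hs.2)) (ae_of_all _ ha0) ?_
    refine LE.le.eventuallyLE ?_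
    rintro x ⟨h2, h3⟩
    refine ⟨h2.1, ?_⟩
    by_contra h4
    exact absurd (hp.clock_mono (not_le.1 h4).le) (not_le.2 h3)
  · have h1 := key (Iic r) measurableSet_Iic
    have h5 : (volume (Iic r ∩ Ioo 0 h)).toReal ≤ r := by
      refine ENNReal.toReal_le_of_le_ofReal hrm.1 ?_
      refine (measure_mono (t := Ioc 0 r) fun x hx => ⟨hx.2.1, hx.1⟩).trans ?_
      simp
    refine le_trans ?_ (h1.le.trans h5)
    refine setIntegral_mono_set (hint _ inter_subset_left) (ae_of_all _ ha0) ?_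
    refine LE.le.eventuallyLE ?_
    intro x hx
    exact ⟨⟨hx.1.le, hx.2.trans hs.2⟩, hp.clock_mono hx.2⟩

end IsClockMeasure

end ImpulseDelay

end

noncomputable section

namespace ImpulseDelay

/-! ### Existence for delay equations of Carathéodory type -/

theorem intervalIntegrable_of_bounded {E : Type*} [NormedAddCommGroup E] {F : ℝ → E}
    (hF : AEStronglyMeasurable F volume) {C : ℝ} (hC : ∀ t, ‖F t‖ ≤ C) (a b : ℝ) :
    IntervalIntegrable F volume a b := by
  rw [intervalIntegrable_iff]
  exact Measure.integrableOn_of_bounded (by simp) hF (ae_of_all _ hC)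

theorem exp_mul_integral_exp_le {lam t : ℝ} (hl : 0 < lam) :
    Real.exp (-(lam * t)) * ∫ s in (0 : ℝ)..t, Real.exp (lam * s) ≤ 1 / lam := by
  have h1 : ∫ s in (0 : ℝ)..t, Real.exp (lam * s) = (Real.exp (lam * t) - 1) / lam := by
    rw [intervalIntegral.integral_comp_mul_left (fun s => Real.exp s) hl.ne', integral_exp]
    simp [div_eq_inv_mul]
  rw [h1, ← mul_div_assoc]
  refine div_le_div_of_nonneg_right ?_ hl.le
  rw [mul_sub, ← Real.exp_add]
  have := Real.exp_pos (-(lam * t))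
  simp
  exact this.le

/-- Picard iteration in an exponentially weighted supremum norm: the contraction holds on all of
[0,T] at once, with no subdivision by delay intervals. The unknown z is the solution multiplied by
exp(-λt). -/
theorem exists_delay_solution {n M : ℕ} {T h : ℝ} (hT : 0 ≤ T) (hh : 0 ≤ h)
    {ξ : ℝ → Fin n → ℝ} (hξ : Measurable ξ) (x₀ : Fin n → ℝ)
    {Q : ℝ → (Fin (M + 1) → Fin n → ℝ) → Fin n → ℝ} (hQ : Measurable (Function.uncurry Q))
    {L : ℝ} (hL : 0 ≤ L) (hQL : ∀ t z z', ‖Q t z - Q t z'‖ ≤ L * ‖z - z'‖)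
    {C : ℝ} (hC : ∀ t z, ‖Q t z‖ ≤ C) :
    ∃ x : ℝ → Fin n → ℝ, Measurable x ∧ (∀ t < 0, x t = ξ t) ∧
      ∀ t ∈ Icc 0 T, x t = x₀ + ∫ s in (0 : ℝ)..t, Q s fun k => x (s - (k : ℕ) * h) := by
  -- With λ = 2L+1 the contraction constant L/λ is at most 1/2.
  set lam : ℝ := 2 * L + 1 with hlam
  have hl : 0 < lam := by positivity
  let ext : C(Icc 0 T, Fin n → ℝ) → ℝ → Fin n → ℝ := fun z t =>
    if t < 0 then ξ t else Real.exp (lam * (projIcc 0 T hT t : ℝ)) • z (projIcc 0 T hT t)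
  have hextm : ∀ z, Measurable (ext z) := fun z => by
    refine Measurable.ite measurableSet_Iio hξ ?_
    have : Continuous fun t => Real.exp (lam * (projIcc 0 T hT t : ℝ)) • z (projIcc 0 T hT t) := by
      have := continuous_projIcc (h := hT)
      fun_prop
    exact this.measurable
  let G : C(Icc 0 T, Fin n → ℝ) → ℝ → Fin n → ℝ := fun z s =>
    Q s fun k => ext z (s - (k : ℕ) * h)
  have hGm : ∀ z, Measurable (G z) := fun z =>
    hQ.comp (measurable_id.prodMk (measurable_pi_lambda _ fun k =>
      (hextm z).comp (measurable_id.sub_const _)))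
  have hGi : ∀ z a b, IntervalIntegrable (G z) volume a b := fun z a b =>
    intervalIntegrable_of_bounded (hGm z).aestronglyMeasurable (fun t => hC _ _) a b
  let Φ : C(Icc 0 T, Fin n → ℝ) → C(Icc 0 T, Fin n → ℝ) := fun z =>
    ⟨fun t => Real.exp (-(lam * (t : ℝ))) • (x₀ + ∫ s in (0 : ℝ)..(t : ℝ), G z s), by
      have h1 := intervalIntegral.continuous_primitive (hGi z) 0
      have h2 : Continuous fun t : Icc 0 T => ∫ s in (0 : ℝ)..(t : ℝ), G z s :=
        h1.comp continuous_subtype_val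
      fun_prop⟩
  have hcontr : ContractingWith (1 / 2) Φ := by
    refine ⟨by rw [← NNReal.coe_lt_coe]; norm_num, LipschitzWith.of_dist_le_mul fun z z' => ?_⟩
    rw [ContinuousMap.dist_le (by positivity)]
    intro t
    have ht := t.2
    rw [dist_eq_norm]
    change ‖Real.exp (-(lam * (t : ℝ))) • (x₀ + ∫ s in (0 : ℝ)..(t : ℝ), G z s) -
      Real.exp (-(lam * (t : ℝ))) • (x₀ + ∫ s in (0 : ℝ)..(t : ℝ), G z' s)‖ ≤ _
    rw [← smul_sub, add_sub_add_left_eq_sub, ← intervalIntegral.integral_sub (hGi z _ _) (hGi z' _ _),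
      norm_smul, Real.norm_of_nonneg (Real.exp_pos _).le]
    have hb : ‖∫ s in (0 : ℝ)..(t : ℝ), (G z s - G z' s)‖ ≤
        ∫ s in (0 : ℝ)..(t : ℝ), (L * dist z z') * Real.exp (lam * s) := by
      refine intervalIntegral.norm_integral_le_of_norm_le ht.1 (ae_of_all _ fun s hs => ?_)
        (Continuous.intervalIntegrable (by fun_prop) _ _)
      refine (hQL _ _ _).trans ?_
      rw [mul_assoc]
      refine mul_le_mul_of_nonneg_left ?_ hL
      refine (pi_norm_le_iff_of_nonneg (by positivity)).2 fun k => ?_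
      simp only [Pi.sub_apply, ext]
      split_ifs with h1
      · rw [sub_self, norm_zero]; positivity
      · rw [← smul_sub, norm_smul, Real.norm_of_nonneg (Real.exp_pos _).le, mul_comm]
        refine mul_le_mul ?_ (Real.exp_le_exp.2 (mul_le_mul_of_nonneg_left ?_ hl.le))
          (Real.exp_pos _).le dist_nonneg
        · rw [← dist_eq_norm]; exact ContinuousMap.dist_apply_le_dist _
        -- A delayed time never exceeds the current one, so its exponential weight is dominated by
        -- the weight at s.
        · rw [coe_projIcc]
          have : 0 ≤ ((k : ℕ) : ℝ) * h := by positivity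
          exact max_le hs.1.le ((min_le_right _ _).trans (by linarith))
    refine (mul_le_mul_of_nonneg_left hb (Real.exp_pos _).le).trans ?_
    rw [intervalIntegral.integral_const_mul, mul_left_comm]
    refine (mul_le_mul_of_nonneg_left (exp_mul_integral_exp_le hl) (by positivity)).trans ?_
    have h2 : L * (1 / lam) ≤ 1 / 2 := by
      rw [mul_one_div, div_le_div_iff₀ hl two_pos]; linarith
    calc L * dist z z' * (1 / lam) = L * (1 / lam) * dist z z' := by ring
      _ ≤ 1 / 2 * dist z z' := mul_le_mul_of_nonneg_right h2 dist_nonneg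
      _ = _ := by norm_num
  obtain ⟨z, hz⟩ : ∃ z, Φ z = z := ⟨_, hcontr.fixedPoint_isFixedPt⟩
  refine ⟨ext z, hextm z, fun t ht => if_pos ht, fun t ht => ?_⟩
  have h1 : ext z t = Real.exp (lam * t) • z ⟨t, ht⟩ := by
    simp only [ext]
    rw [if_neg (not_lt.2 ht.1), projIcc_of_mem hT ht]
  rw [h1]
  nth_rw 1 [← hz]
  change Real.exp (lam * t) • Real.exp (-(lam * t)) • (x₀ + ∫ s in (0 : ℝ)..t, G z s) = _
  rw [smul_smul, ← Real.exp_add]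
  simp [G]

end ImpulseDelay

end

noncomputable section

namespace ImpulseDelay

/-! ### Strict sense processes generated by bounded controls -/

variable {n m : ℕ}

theorem norm_sum_smul_le {E : Type*} [NormedAddCommGroup E] [NormedSpace ℝ E] (w : Fin m → ℝ)
    {v : Fin m → E} {C : ℝ} (hv : ∀ j, ‖v j‖ ≤ C) : ‖∑ j, w j • v j‖ ≤ norm1 w * C := by
  refine (norm_sum_le _ _).trans ?_
  rw [norm1, Finset.sum_mul]
  refine Finset.sum_le_sum fun j _ => ?_
  rw [norm_smul, Real.norm_eq_abs]
  exact mul_le_mul_of_nonneg_left (hv j) (abs_nonneg _)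

namespace DelaySystem

variable (S : DelaySystem n m)

theorem T_nonneg : 0 ≤ S.T := mul_nonneg (Nat.cast_nonneg _) S.h_pos.le

theorem zero_mem_K : (0 : Fin m → ℝ) ∈ S.K := by
  obtain ⟨w, hw⟩ := S.K_nonempty
  simpa using S.K_cone 0 le_rfl w hw

theorem exists_bound : ∃ C, 0 ≤ C ∧ (∀ p, ‖S.f p‖ ≤ C) ∧ ∀ j p, ‖S.g j p‖ ≤ C := by
  obtain ⟨C, hC⟩ := S.f_bounded
  choose D hD using S.g_bounded
  refine ⟨|C| + ∑ j, |D j|, by positivity, fun p => ?_, fun j p => ?_⟩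
  · exact (hC p).trans ((le_abs_self _).trans (le_add_of_nonneg_right (by positivity)))
  · refine (hD j p).trans ((le_abs_self _).trans ?_)
    refine le_trans ?_ (le_add_of_nonneg_left (abs_nonneg C))
    exact Finset.single_le_sum (f := fun j => |D j|) (fun _ _ => abs_nonneg _) (Finset.mem_univ j)

/-- A C¹ map is Lipschitz on compact convex sets. The dependence on time is included because
different clocks will be compared. -/
theorem exists_lipschitz (R : ℝ) : ∃ L, 0 ≤ L ∧ ∀ t ∈ Icc 0 S.T, ∀ t' ∈ Icc 0 S.T,
    ∀ z z' : Fin (S.M + 1) → Fin n → ℝ, ‖z‖ ≤ R → ‖z'‖ ≤ R →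
      ‖S.f (t, z) - S.f (t', z')‖ ≤ L * max |t - t'| ‖z - z'‖ ∧
      ∀ j, ‖S.g j (t, z) - S.g j (t', z')‖ ≤ L * max |t - t'| ‖z - z'‖ := by
  let s : Set (ℝ × (Fin (S.M + 1) → Fin n → ℝ)) := Icc 0 S.T ×ˢ Metric.closedBall 0 R
  have hs : Convex ℝ s := (convex_Icc _ _).prod (convex_closedBall _ _)
  have hs' : IsCompact s := isCompact_Icc.prod (isCompact_closedBall _ _)
  obtain ⟨L0, h0⟩ := S.f_contDiff.contDiffOn.exists_lipschitzOnWith one_ne_zero hs hs'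
  choose L1 h1 using fun j => (S.g_contDiff j).contDiffOn.exists_lipschitzOnWith one_ne_zero hs hs'
  refine ⟨L0 + ∑ j, L1 j, by positivity, fun t ht t' ht' z z' hz hz' => ?_⟩
  have e1 : ((t, z) : ℝ × (Fin (S.M + 1) → Fin n → ℝ)) ∈ s := ⟨ht, by simpa using hz⟩
  have e2 : ((t', z') : ℝ × (Fin (S.M + 1) → Fin n → ℝ)) ∈ s := ⟨ht', by simpa using hz'⟩
  have e3 : dist (t, z) (t', z') = max |t - t'| ‖z - z'‖ := by
    rw [Prod.dist_eq, Real.dist_eq, dist_eq_norm]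
  have e4 : 0 ≤ max |t - t'| ‖z - z'‖ := le_max_of_le_left (abs_nonneg _)
  constructor
  · have := h0.dist_le_mul _ e1 _ e2
    rw [e3, dist_eq_norm] at this
    exact this.trans (mul_le_mul_of_nonneg_right (le_add_of_nonneg_right (by positivity)) e4)
  · intro j
    have := (h1 j).dist_le_mul _ e1 _ e2
    rw [e3, dist_eq_norm] at this
    refine this.trans (mul_le_mul_of_nonneg_right ?_ e4)
    refine le_trans ?_ (le_add_of_nonneg_left L0.2)
    rw [NNReal.coe_sum]
    exact Finset.single_le_sum (f := fun j => (L1 j : ℝ)) (fun j _ => (L1 j).2) (Finset.mem_univ j)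

/-- The controlled vector field along a trajectory. -/
def field (U : ℝ → Fin m → ℝ) (x : ℝ → Fin n → ℝ) (t : ℝ) : Fin n → ℝ :=
  S.f (t, S.delayed x t) + ∑ j, U t j • S.g j (t, S.delayed x t)

/-- A bounded measurable control with values in the cone. -/
structure IsBoundedControl (U : ℝ → Fin m → ℝ) : Prop where
  measurable : Measurable U
  mem_K : ∀ t, U t ∈ S.K
  bounded : ∃ B, ∀ t, norm1 (U t) ≤ B

/-- `x` is the trajectory generated by the control `U`. -/
structure IsTrajectory (U : ℝ → Fin m → ℝ) (x : ℝ → Fin n → ℝ) : Prop where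
  measurable : Measurable x
  past : ∀ t ∈ Ico (-(S.M * S.h)) 0, x t = S.ξ₀ t
  eq : ∀ t ∈ Icc 0 S.T, x t = S.x₀ + ∫ s in (0 : ℝ)..t, S.field U x s

variable {S}

theorem measurable_delayed {x : ℝ → Fin n → ℝ} (hx : Measurable x) : Measurable (S.delayed x) :=
  measurable_pi_lambda _ fun _ => hx.comp (measurable_id.sub_const _)

theorem measurable_field {U : ℝ → Fin m → ℝ} (hU : Measurable U) {x : ℝ → Fin n → ℝ}
    (hx : Measurable x) : Measurable (S.field U x) := by
  have h1 : Measurable fun t => (t, S.delayed x t) := measurable_id.prodMk (measurable_delayed hx)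
  refine (S.f_contDiff.continuous.measurable.comp h1).add ?_
  refine Finset.measurable_fun_sum _ fun j _ => ?_
  exact ((measurable_pi_apply j).comp hU).smul ((S.g_contDiff j).continuous.measurable.comp h1)

theorem IsBoundedControl.exists_field_bound {U : ℝ → Fin m → ℝ} (hU : S.IsBoundedControl U) :
    ∃ C, 0 ≤ C ∧ ∀ x t, ‖S.field U x t‖ ≤ C := by
  obtain ⟨C, hC0, hf, hg⟩ := S.exists_bound
  obtain ⟨B, hB⟩ := hU.bounded
  have hB0 : 0 ≤ B := (norm1_nonneg _).trans (hB 0)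
  refine ⟨C + B * C, by positivity, fun x t => ?_⟩
  refine (norm_add_le _ _).trans (add_le_add (hf _) ?_)
  exact (norm_sum_smul_le _ fun j => hg j _).trans (mul_le_mul_of_nonneg_right (hB t) hC0)

theorem IsBoundedControl.intervalIntegrable_field {U : ℝ → Fin m → ℝ} (hU : S.IsBoundedControl U)
    {x : ℝ → Fin n → ℝ} (hx : Measurable x) (a b : ℝ) :
    IntervalIntegrable (S.field U x) volume a b := by
  obtain ⟨C, _, hC⟩ := hU.exists_field_bound
  exact intervalIntegrable_of_bounded (measurable_field hU.measurable hx).aestronglyMeasurable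
    (hC x) a b

/-- The coefficients are only locally Lipschitz, but they are bounded, so any trajectory stays in an
a priori ball of radius R. The truncated, globally Lipschitz system is solved, and its solution
never meets the truncation. -/
theorem IsBoundedControl.exists_trajectory {U : ℝ → Fin m → ℝ} (hU : S.IsBoundedControl U) :
    ∃ x, S.IsTrajectory U x := by
  obtain ⟨C, hC0, hf, hg⟩ := S.exists_bound
  obtain ⟨B, hB⟩ := hU.bounded
  have hB0 : 0 ≤ B := (norm1_nonneg _).trans (hB 0)
  have hMh : -(S.M * S.h) ≤ 0 := neg_nonpos.2 (mul_nonneg (Nat.cast_nonneg _) S.h_pos.le)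
  obtain ⟨R0, hR0⟩ := isCompact_Icc.exists_bound_of_continuousOn S.ξ₀_continuous
  set D : ℝ := C + B * C with hD
  have hD0 : 0 ≤ D := by positivity
  set R : ℝ := |R0| + ‖S.x₀‖ + D * S.T with hR
  have hRn : 0 ≤ R := by have := S.T_nonneg; positivity
  obtain ⟨L, hL0, hL⟩ := S.exists_lipschitz R
  -- Coordinatewise truncation is nonexpansive for the supremum norm and is the identity on the ball
  -- of radius R.
  let cl : (Fin (S.M + 1) → Fin n → ℝ) → Fin (S.M + 1) → Fin n → ℝ := fun z k i =>
    max (-R) (min R (z k i))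
  have hclR : ∀ z, ‖cl z‖ ≤ R := fun z => by
    refine (pi_norm_le_iff_of_nonneg hRn).2 fun k => (pi_norm_le_iff_of_nonneg hRn).2 fun i => ?_
    rw [Real.norm_eq_abs, abs_le]
    exact ⟨le_max_left _ _, max_le (by linarith) (min_le_left _ _)⟩
  have hclL : ∀ z z', ‖cl z - cl z'‖ ≤ ‖z - z'‖ := fun z z' => by
    refine (pi_norm_le_iff_of_nonneg (norm_nonneg _)).2 fun k =>
      (pi_norm_le_iff_of_nonneg (norm_nonneg _)).2 fun i => ?_
    refine le_trans ?_ ((norm_le_pi_norm ((z - z') k) i).trans (norm_le_pi_norm (z - z') k))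
    simp only [Pi.sub_apply, cl, Real.norm_eq_abs]
    refine (abs_max_sub_max_le_max _ _ _ _).trans (max_le (by simp) ?_)
    exact (abs_min_sub_min_le_max _ _ _ _).trans (max_le (by simp) le_rfl)
  have hcleq : ∀ z, ‖z‖ ≤ R → cl z = z := fun z hz => by
    ext k i
    have h1 := ((norm_le_pi_norm (z k) i).trans (norm_le_pi_norm z k)).trans hz
    rw [Real.norm_eq_abs, abs_le] at h1
    simp only [cl]
    rw [min_eq_right h1.2, max_eq_right h1.1]
  have hclc : Continuous cl := by fun_prop
  let pr : ℝ → ℝ := fun t => (projIcc 0 S.T S.T_nonneg t : ℝ)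
  have hprc : Continuous pr := continuous_subtype_val.comp continuous_projIcc
  let Q : ℝ → (Fin (S.M + 1) → Fin n → ℝ) → Fin n → ℝ := fun t z =>
    S.f (pr t, cl z) + ∑ j, U t j • S.g j (pr t, cl z)
  have hQ : Measurable (Function.uncurry Q) := by
    have h1 : Measurable fun p : ℝ × (Fin (S.M + 1) → Fin n → ℝ) => (pr p.1, cl p.2) := by
      have : Continuous fun p : ℝ × (Fin (S.M + 1) → Fin n → ℝ) => (pr p.1, cl p.2) := by fun_prop
      exact this.measurable
    refine (S.f_contDiff.continuous.measurable.comp h1).add ?_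
    refine Finset.measurable_fun_sum _ fun j _ => ?_
    exact ((measurable_pi_apply j).comp (hU.measurable.comp measurable_fst)).smul
      ((S.g_contDiff j).continuous.measurable.comp h1)
  have hQL : ∀ t z z', ‖Q t z - Q t z'‖ ≤ (L + B * L) * ‖z - z'‖ := fun t z z' => by
    have h1 := hL (pr t) (projIcc 0 S.T S.T_nonneg t).2 (pr t) (projIcc 0 S.T S.T_nonneg t).2
      (cl z) (cl z') (hclR z) (hclR z')
    rw [sub_self, abs_zero, max_eq_right (norm_nonneg _)] at h1
    simp only [Q]
    rw [add_sub_add_comm, ← Finset.sum_sub_distrib]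
    simp_rw [← smul_sub]
    refine (norm_add_le _ _).trans ?_
    rw [add_mul]
    have h2 : L * ‖cl z - cl z'‖ ≤ L * ‖z - z'‖ := mul_le_mul_of_nonneg_left (hclL z z') hL0
    refine add_le_add (h1.1.trans h2) ?_
    refine (norm_sum_smul_le _ fun j => (h1.2 j).trans h2).trans ?_
    rw [mul_assoc]
    exact mul_le_mul_of_nonneg_right (hB t) (by positivity)
  have hQC : ∀ t z, ‖Q t z‖ ≤ D := fun t z =>
    (norm_add_le _ _).trans (add_le_add (hf _) ((norm_sum_smul_le _ fun j => hg j _).trans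
      (mul_le_mul_of_nonneg_right (hB t) hC0)))
  let ξ : ℝ → Fin n → ℝ := IccExtend hMh ((Icc (-(S.M * S.h)) 0).domRestrict S.ξ₀)
  have hξc : Continuous ξ := (continuousOn_iff_continuous_domRestrict.1 S.ξ₀_continuous).Icc_extend'
  obtain ⟨x, hxm, hx0, hxe⟩ := exists_delay_solution S.T_nonneg S.h_pos.le hξc.measurable S.x₀ hQ
    (by positivity : 0 ≤ L + B * L) hQL hQC
  have hpast : ∀ t ∈ Ico (-(S.M * S.h)) 0, x t = S.ξ₀ t := fun t ht => by
    rw [hx0 t ht.2]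
    exact IccExtend_of_mem hMh _ ⟨ht.1, ht.2.le⟩
  -- The radius R adds the bounds of the past history, of the initial state and of the total
  -- displacement D·T, which covers all times from -Mh to T.
  have hbd : ∀ t ∈ Icc (-(S.M * S.h)) S.T, ‖x t‖ ≤ R := fun t ht => by
    rcases lt_or_ge t 0 with h1 | h1
    · rw [hpast t ⟨ht.1, h1⟩]
      refine (hR0 t ⟨ht.1, h1.le⟩).trans ((le_abs_self _).trans ?_)
      have := S.T_nonneg
      rw [hR, add_assoc]
      exact le_add_of_nonneg_right (by positivity)
    · rw [hxe t ⟨h1, ht.2⟩]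
      refine (norm_add_le _ _).trans ?_
      have h2 := intervalIntegral.norm_integral_le_of_norm_le_const (a := 0) (b := t) (C := D)
        (f := fun s => Q s fun k => x (s - (k : ℕ) * S.h)) fun s _ => hQC _ _
      rw [sub_zero, abs_of_nonneg h1] at h2
      have h3 : D * t ≤ D * S.T := mul_le_mul_of_nonneg_left ht.2 hD0
      have := abs_nonneg R0
      linarith
  refine ⟨x, hxm, hpast, fun t ht => ?_⟩
  rw [hxe t ht]
  congr 1
  refine intervalIntegral.integral_congr fun s hs => ?_
  rw [uIcc_of_le ht.1] at hs
  have hsT : s ∈ Icc 0 S.T := ⟨hs.1, hs.2.trans ht.2⟩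
  have h1 : cl (fun k => x (s - (k : ℕ) * S.h)) = S.delayed x s := by
    refine hcleq _ ((pi_norm_le_iff_of_nonneg hRn).2 fun k => hbd _ ⟨?_, ?_⟩)
    · have h2 : ((k : ℕ) : ℝ) ≤ S.M := by exact_mod_cast Nat.lt_succ_iff.1 k.2
      have := mul_le_mul_of_nonneg_right h2 S.h_pos.le
      linarith [hs.1]
    · have : 0 ≤ ((k : ℕ) : ℝ) * S.h := mul_nonneg (Nat.cast_nonneg _) S.h_pos.le
      linarith [hsT.2]
  have h2 : pr s = s := by simp only [pr, projIcc_of_mem S.T_nonneg hsT]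
  simp only [Q, h1, h2]
  rfl

end DelaySystem

end ImpulseDelay

end

noncomputable section

namespace ImpulseDelay

variable {n m : ℕ}

theorem contPart_eq_self {ν : Measure ℝ} (h : ∀ t, ν {t} = 0) : contPart ν = ν := by
  simp [contPart, h]

theorem contPartSigned_eq_self {s : SignedMeasure ℝ} (h : ∀ t, s {t} = 0) :
    contPartSigned s = s := by
  simp [contPartSigned, h]

theorem supportedOn_iff {T : ℝ} {s : SignedMeasure ℝ} :
    SupportedOn T s ↔ ∀ B, MeasurableSet B → Disjoint B (Icc 0 T) → s B = 0 := by
  rw [SupportedOn, SignedMeasure.totalVariation_eq_variation,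
    VectorMeasure.variation_apply_eq_zero measurableSet_Icc.compl]
  exact ⟨fun h B hB hd => h B (fun x hx h2 => Set.disjoint_left.1 hd hx h2) hB,
    fun h B hB hd => h B hd (Set.disjoint_left.2 fun x hx h2 => hB hx h2)⟩

/-- Comparing densities with respect to Lebesgue measure, the polar density equals U/‖U‖ almost
everywhere for the total variation, which does not charge {U = 0}; it is thus a nonnegative multiple
of an element of the cone. -/
theorem rangesOver_withDensityᵥ {T : ℝ} {K : Set (Fin m → ℝ)}
    (hK : ∀ c : ℝ, 0 ≤ c → ∀ w ∈ K, c • w ∈ K) {U : ℝ → Fin m → ℝ} (hUm : Measurable U)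
    (hUK : ∀ t, U t ∈ K) (hUi : ∀ j, IntegrableOn (fun t => U t j) (Icc 0 T)) :
    RangesOver T K fun j => (volume.restrict (Icc 0 T)).withDensityᵥ fun t => U t j := by
  refine ⟨fun j => supportedOn_iff.2 fun B hB hd => ?_, ?_⟩
  · rw [withDensityᵥ_apply (hUi j) hB, Measure.restrict_restrict hB, hd.inter_eq]
    simp
  set μ : Fin m → SignedMeasure ℝ := fun j =>
    (volume.restrict (Icc 0 T)).withDensityᵥ fun t => U t j with hμ
  have htv : totalVar μ = (volume.restrict (Icc 0 T)).withDensity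
      fun t => ENNReal.ofReal (norm1 (U t)) := totalVar_withDensityᵥ hUi
  have hn : Measurable fun t => norm1 (U t) := measurable_norm1.comp hUm
  have hk : ∀ j, ∀ᵐ t ∂(volume.restrict (Icc 0 T)),
      norm1 (U t) * (μ j).rnDeriv (totalVar μ) t = U t j := by
    intro j
    have h1 := withDensityᵥ_rnDeriv_totalVar μ j
    have h2 := SignedMeasure.integrable_rnDeriv (μ j) (totalVar μ)
    set k := (μ j).rnDeriv (totalVar μ) with hkdef
    have e : (fun t => ENNReal.ofReal (norm1 (U t))) =
      fun t => ((Real.toNNReal (norm1 (U t)) : NNReal) : ENNReal) := rfl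
    rw [htv] at h1 h2
    rw [e] at h1 h2
    have h3 : Integrable ((fun t => Real.toNNReal (norm1 (U t))) • k)
        (volume.restrict (Icc 0 T)) :=
      (integrable_withDensity_iff_integrable_smul₀ hn.real_toNNReal.aemeasurable).1 h2
    rw [← withDensityᵥ_smul_eq_withDensityᵥ_withDensity hn.real_toNNReal.aemeasurable h3] at h1
    have h4 := (h3.withDensityᵥ_eq_iff (hUi j)).1 h1
    filter_upwards [h4] with t ht
    rw [← ht]
    simp [NNReal.smul_def, Real.coe_toNNReal _ (norm1_nonneg (U t))]
  have h5 : ∀ᵐ t ∂(totalVar μ), ∀ j, norm1 (U t) * (μ j).rnDeriv (totalVar μ) t = U t j := by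
    rw [ae_all_iff]
    intro j
    refine Measure.AbsolutelyContinuous.ae_le ?_ (hk j)
    rw [htv]
    exact withDensity_absolutelyContinuous _ _
  have h6 : ∀ᵐ t ∂(totalVar μ), norm1 (U t) ≠ 0 := by
    rw [htv, ae_withDensity_iff hn.ennreal_ofReal]
    refine ae_of_all _ fun t ht h0 => ht ?_
    rw [h0, ENNReal.ofReal_zero]
  filter_upwards [h5, h6] with t h7 h8
  have : (fun j => (μ j).rnDeriv (totalVar μ) t) = (norm1 (U t))⁻¹ • U t := by
    ext j
    rw [Pi.smul_apply, smul_eq_mul, ← h7 j, inv_mul_cancel_left₀ h8]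
  rw [this]
  exact hK _ (inv_nonneg.2 (norm1_nonneg _)) _ (hUK t)

/-- The absolutely continuous function with derivative `U` which vanishes at `0`. -/
def primitive (U : ℝ → Fin m → ℝ) (t : ℝ) : Fin m → ℝ := ∫ s in (0 : ℝ)..t, U s

theorem norm_le_norm1 (w : Fin m → ℝ) : ‖w‖ ≤ norm1 w :=
  (pi_norm_le_iff_of_nonneg (norm1_nonneg w)).2 fun j => abs_le_norm1 w j

theorem lipschitzWith_integral {E : Type*} [NormedAddCommGroup E] [NormedSpace ℝ E] {F : ℝ → E}
    (hF : AEStronglyMeasurable F volume) {C : ℝ} (hC : ∀ t, ‖F t‖ ≤ C) :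
    LipschitzWith C.toNNReal fun t => ∫ s in (0 : ℝ)..t, F s := by
  have hC0 : 0 ≤ C := (norm_nonneg _).trans (hC 0)
  refine LipschitzWith.of_dist_le_mul fun a b => ?_
  have hi := intervalIntegrable_of_bounded hF hC
  rw [dist_eq_norm, intervalIntegral.integral_interval_sub_left (hi _ _) (hi _ _),
    Real.coe_toNNReal _ hC0, Real.dist_eq]
  exact intervalIntegral.norm_integral_le_of_norm_le_const fun s _ => hC s

namespace DelaySystem

variable {S : DelaySystem n m}

namespace IsBoundedControl

variable {U : ℝ → Fin m → ℝ} (hU : S.IsBoundedControl U)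

include hU

theorem measurable_norm1 : Measurable fun t => norm1 (U t) :=
  ImpulseDelay.measurable_norm1.comp hU.measurable

theorem intervalIntegrable_norm1 (a b : ℝ) :
    IntervalIntegrable (fun t => norm1 (U t)) volume a b := by
  obtain ⟨B, hB⟩ := hU.bounded
  refine intervalIntegrable_of_bounded hU.measurable_norm1.aestronglyMeasurable (C := B)
    (fun t => ?_) a b
  rw [Real.norm_of_nonneg (norm1_nonneg _)]
  exact hB t

theorem integrableOn_apply (j : Fin m) (a b : ℝ) : IntegrableOn (fun t => U t j) (Icc a b) := by
  obtain ⟨B, hB⟩ := hU.bounded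
  exact Measure.integrableOn_of_bounded (M := B) (by simp)
    ((measurable_pi_apply j).comp hU.measurable).aestronglyMeasurable
    (ae_of_all _ fun t => (abs_le_norm1 _ j).trans (hB t))

theorem deriv_primitive : ∀ᵐ t, deriv (primitive U) t = U t := by
  have h1 : LocallyIntegrable U volume := by
    rw [locallyIntegrable_iff]
    intro k hk
    obtain ⟨B, hB⟩ := hU.bounded
    exact Measure.integrableOn_of_bounded (M := B) hk.measure_lt_top.ne
      hU.measurable.aestronglyMeasurable
      (ae_of_all _ fun t => (norm_le_norm1 _).trans (hB t))
  filter_upwards [LocallyIntegrable.ae_hasDerivAt_integral h1] with t ht using (ht 0).deriv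

theorem controlMeasure_primitive (T : ℝ) : controlMeasure T (primitive U) =
    fun j => (volume.restrict (Icc 0 T)).withDensityᵥ fun t => U t j := by
  ext1 j
  have hae : (fun t => U t j) =ᵐ[volume.restrict (Icc 0 T)] fun t => deriv (primitive U) t j := by
    filter_upwards [ae_restrict_of_ae hU.deriv_primitive] with t ht
    rw [ht]
  have hi := hU.integrableOn_apply j 0 T
  exact ((hi.withDensityᵥ_eq_iff (hi.congr hae)).2 hae).symm

theorem totalVar_controlMeasure (T : ℝ) : totalVar (controlMeasure T (primitive U)) =
    (volume.restrict (Icc 0 T)).withDensity fun t => ENNReal.ofReal (norm1 (U t)) := by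
  rw [hU.controlMeasure_primitive T]
  exact totalVar_withDensityᵥ fun j => hU.integrableOn_apply j 0 T

theorem totalVar_controlMeasure_real {T a b : ℝ} (ha : 0 ≤ a) (hab : a ≤ b) (hb : b ≤ T) :
    (totalVar (controlMeasure T (primitive U))).real (Icc a b) =
      ∫ t in a..b, norm1 (U t) := by
  rw [hU.totalVar_controlMeasure T, measureReal_def, withDensity_apply _ measurableSet_Icc,
    Measure.restrict_restrict measurableSet_Icc, inter_eq_left.2 (Icc_subset_Icc ha hb),
    intervalIntegral.integral_of_le hab, ← integral_Icc_eq_integral_Ioc,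
    integral_eq_lintegral_of_nonneg_ae (ae_of_all _ fun t => norm1_nonneg _)
      hU.measurable_norm1.aestronglyMeasurable]

theorem isStrictSenseControl_primitive : IsStrictSenseControl S (primitive U) := by
  obtain ⟨B, hB⟩ := hU.bounded
  refine ⟨?_, by simp [primitive], ?_⟩
  · have := lipschitzWith_integral hU.measurable.aestronglyMeasurable
      (C := B) fun t => (norm_le_norm1 _).trans (hB t)
    exact (this.lipschitzOnWith).absolutelyContinuousOnInterval
  · filter_upwards [ae_restrict_of_ae hU.deriv_primitive] with t ht
    rw [ht]
    exact hU.mem_K t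

end IsBoundedControl

theorem IsTrajectory.init {U : ℝ → Fin m → ℝ} {x : ℝ → Fin n → ℝ} (hx : S.IsTrajectory U x) :
    x 0 = S.x₀ := by
  rw [hx.eq 0 ⟨le_rfl, S.T_nonneg⟩]; simp

theorem IsTrajectory.lipschitzOn {U : ℝ → Fin m → ℝ} {x : ℝ → Fin n → ℝ}
    (hx : S.IsTrajectory U x) (hU : S.IsBoundedControl U) :
    ∃ C, LipschitzOnWith C x (Icc 0 S.T) := by
  obtain ⟨C, hC0, hC⟩ := hU.exists_field_bound
  have h1 := lipschitzWith_integral (measurable_field hU.measurable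
    hx.measurable).aestronglyMeasurable (hC x)
  refine ⟨C.toNNReal, LipschitzOnWith.of_dist_le_mul fun a ha b hb => ?_⟩
  rw [hx.eq a ha, hx.eq b hb, dist_add_left]
  exact h1.dist_le_mul a b

theorem IsTrajectory.sub_eq {U : ℝ → Fin m → ℝ} {x : ℝ → Fin n → ℝ}
    (hx : S.IsTrajectory U x) (hU : S.IsBoundedControl U) {a b : ℝ} (ha : a ∈ Icc 0 S.T)
    (hb : b ∈ Icc 0 S.T) : x b = x a + ∫ s in a..b, S.field U x s := by
  have hi := hU.intervalIntegrable_field hx.measurable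
  rw [hx.eq a ha, hx.eq b hb, add_assoc, intervalIntegral.integral_add_adjacent_intervals
    (hi _ _) (hi _ _)]

theorem leftLim_eq_of_continuousOn {E : Type*} [TopologicalSpace E] [T2Space E] {y : ℝ → E} {T t : ℝ}
    (hy : ContinuousOn y (Icc 0 T)) (ht : t ∈ Ioc 0 T) : Function.leftLim y t = y t := by
  refine ContinuousWithinAt.leftLim_eq ?_
  refine (hy t ⟨ht.1.le, ht.2⟩).mono_of_mem_nhdsWithin ?_
  exact mem_of_superset (Icc_mem_nhdsLE ht.1) (Icc_subset_Icc_right ht.2)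

theorem block_mem {l : ℤ} (h1 : 1 ≤ l) (hN : l ≤ S.N) {r : ℝ} (hr : r ∈ Icc 0 S.h) :
    r + ((l : ℝ) - 1) * S.h ∈ Icc 0 S.T := by
  have h2 : (1 : ℝ) ≤ l := by exact_mod_cast h1
  have h3 : (l : ℝ) ≤ S.N := by exact_mod_cast hN
  have h4 := S.h_pos
  refine ⟨add_nonneg hr.1 (mul_nonneg (by linarith) h4.le), ?_⟩
  have := mul_le_mul_of_nonneg_right h3 h4.le
  have := hr.2
  unfold T
  nlinarith

/-- Bounded controls generate strict sense processes. -/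
theorem IsTrajectory.isStrictSenseProcess_primitive {U : ℝ → Fin m → ℝ} {x : ℝ → Fin n → ℝ}
    (hx : S.IsTrajectory U x) (hU : S.IsBoundedControl U) :
    IsStrictSenseProcess S (primitive U) x fun t => ∫ s in (0 : ℝ)..t, norm1 (U s) := by
  obtain ⟨B, hB⟩ := hU.bounded
  obtain ⟨C, hC⟩ := hx.lipschitzOn hU
  have hvL : LipschitzWith B.toNNReal fun t => ∫ s in (0 : ℝ)..t, norm1 (U s) :=
    lipschitzWith_integral hU.measurable_norm1.aestronglyMeasurable fun t => by
      rw [Real.norm_of_nonneg (norm1_nonneg _)]; exact hB t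
  set v : ℝ → ℝ := fun t => ∫ s in (0 : ℝ)..t, norm1 (U s) with hv
  have hμ := hU.controlMeasure_primitive S.T
  have hν := hU.totalVar_controlMeasure S.T
  have hμi := fun j => hU.integrableOn_apply j 0 S.T
  have hμ0 : ∀ j t, controlMeasure S.T (primitive U) j {t} = 0 := fun j t => by
    rw [hμ, withDensityᵥ_apply (hμi j) (measurableSet_singleton t),
      Measure.restrict_restrict (measurableSet_singleton t),
      setIntegral_measure_zero _ (measure_mono_null inter_subset_left (by simp))]
  have hν0 : ∀ t, totalVar (controlMeasure S.T (primitive U)) {t} = 0 := fun t => by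
    rw [hν]
    refine withDensity_absolutelyContinuous _ _ ?_
    rw [Measure.restrict_apply (measurableSet_singleton t)]
    exact measure_mono_null inter_subset_left (by simp)
  have hranges : RangesOver S.T S.K (controlMeasure S.T (primitive U)) := by
    rw [hμ]
    exact rangesOver_withDensityᵥ S.K_cone hU.measurable hU.mem_K hμi
  have hnode : ∀ l : ℤ, 1 ≤ l → l ≤ S.N + 1 → ((l : ℝ) - 1) * S.h ∈ Icc 0 S.T := fun l h1 h2 => by
    have h3 : (1 : ℝ) ≤ l := by exact_mod_cast h1
    have h4 : (l : ℝ) ≤ S.N + 1 := by exact_mod_cast h2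
    have h5 := S.h_pos
    exact ⟨mul_nonneg (by linarith) h5.le, mul_le_mul_of_nonneg_right (by linarith) h5.le⟩
  refine ⟨hU.isStrictSenseControl_primitive, ⟨hranges, ?_, ?_, ?_, ?_, ?_, ?_, ?_, ?_, ?_⟩,
    ?_, ?_, hx.past, hx.init, by simp [hv], ?_⟩
  -- The constant sequence equal to du shows that |du| is an admissible variation, both measures
  -- being free of atoms.
  · refine ⟨inferInstance, ?_, ?_, fun _ => controlMeasure S.T (primitive U), fun _ => hranges,
      fun ψ _ j => tendsto_const_nhds, fun ψ _ => tendsto_const_nhds⟩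
    · rw [hν]
      refine withDensity_absolutelyContinuous _ _ ?_
      rw [Measure.restrict_apply measurableSet_Icc.compl]
      simp
    · rw [contPart_eq_self hν0]
      simp_rw [contPartSigned_eq_self (hμ0 _)]
  · intro l r _ _ _
    exact MemLp.zero
  · intro l r _ _ _ s _
    exact S.zero_mem_K
  · intro l r s _; rfl
  · intro r _; simp
  · intro r _ l _ _
    simp [measureReal_def, hν0]
  · intro l _ _
    simp [measureReal_def, hν0]
  · intro r _ l _ _ j
    simp [hμ0]
  · intro l _ _ j
    simp [hμ0]
  · simpa using hC.locallyBoundedVariationOn 0 S.T ⟨le_rfl, S.T_nonneg⟩ ⟨S.T_nonneg, le_rfl⟩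
  · simpa using hvL.locallyBoundedVariationOn (Icc 0 S.T) 0 S.T ⟨le_rfl, S.T_nonneg⟩
      ⟨S.T_nonneg, le_rfl⟩
  -- Without jumps every arc is constant in s, equal to the trajectory at the corresponding time.
  -- The exceptional value at l = 0, s = 1, r = h is the convention that the past ends at the
  -- initial state and not at ξ₀(0).
  set ζ : ℤ → ℝ → ℝ → Fin n → ℝ := fun l r s => if 1 ≤ l then x (r + ((l : ℝ) - 1) * S.h)
    else if l = 0 ∧ s = 1 ∧ r = S.h then S.x₀ else S.ξ₀ (r + ((l : ℝ) - 1) * S.h) with hζ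
  set θ : ℤ → ℝ → ℝ → ℝ := fun l r _ => if 1 ≤ l then v (r + ((l : ℝ) - 1) * S.h) else 0 with hθ
  have hleft : ∀ (l : ℤ) (r : ℝ), 1 ≤ l → l ≤ S.N → r ∈ Ioc 0 S.h →
      r + ((l : ℝ) - 1) * S.h ∈ Ioc 0 S.T := fun l r h1 hN hr => by
    have h2 : (1 : ℝ) ≤ l := by exact_mod_cast h1
    exact ⟨add_pos_of_pos_of_nonneg hr.1 (mul_nonneg (by linarith) S.h_pos.le),
      (block_mem h1 hN ⟨hr.1.le, hr.2⟩).2⟩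
  have hxl : ∀ (l : ℤ) (r : ℝ), 1 ≤ l → l ≤ S.N → r ∈ Ioc 0 S.h →
      Function.leftLim x (r + ((l : ℝ) - 1) * S.h) = x (r + ((l : ℝ) - 1) * S.h) :=
    fun l r h1 hN hr => leftLim_eq_of_continuousOn hC.continuousOn (hleft l r h1 hN hr)
  have hvl : ∀ (l : ℤ) (r : ℝ), 1 ≤ l → l ≤ S.N → r ∈ Ioc 0 S.h →
      Function.leftLim v (r + ((l : ℝ) - 1) * S.h) = v (r + ((l : ℝ) - 1) * S.h) :=
    fun l r h1 hN hr => leftLim_eq_of_continuousOn hvL.continuous.continuousOn (hleft l r h1 hN hr)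
  refine ⟨ζ, θ, ⟨?_, ?_, ?_, ?_, ?_, ?_, ?_, ?_, ?_, ?_⟩, ?_, ?_⟩
  · intro r _ s _
    simp only [hζ]
    refine ⟨fun h1 => ?_, fun h1 h2 => ?_⟩
    · rw [if_neg (by norm_num), if_neg]
      · congr 1; push_cast; ring
      · rintro ⟨-, h2, h3⟩
        rcases h1 with h1 | h1 <;> linarith
    · rw [if_neg (by norm_num), if_pos ⟨trivial, h1, h2⟩]
  · intro a ha haM r _ s _
    simp only [hζ]
    rw [if_neg (by omega), if_neg (by omega)]
    congr 1; push_cast; ring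
  · intro r _ s _
    simp [hθ]
  · intro l r h1 _ _ _
    simp only [hζ, if_pos h1]
    exact continuousOn_const
  · intro l r h1 _ _ _ s _
    simp [hζ, if_pos h1]
  · intro l r h1 hN hr
    simp only [hζ, if_pos h1]
    exact (hxl l r h1 hN hr).symm
  · intro l h1 hN
    simp only [hζ, if_pos h1]
    by_cases h2 : 1 ≤ l - 1
    · rw [if_pos h2]
      congr 1; push_cast; ring
    · have h3 : l = 1 := by omega
      subst h3
      norm_num [hx.init]
  · intro l r h1 _ _ _ s _
    simp [hθ]
  · intro l r h1 hN hr
    simp only [hθ, if_pos h1]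
    exact (hvl l r h1 hN hr).symm
  · intro l h1 hN
    simp only [hθ, if_pos h1]
    by_cases h2 : 1 ≤ l - 1
    · rw [if_pos h2]
      congr 1; push_cast; ring
    · have h3 : l = 1 := by omega
      subst h3
      norm_num [hv]
  · intro l h2 hN
    simp [hζ, hθ, if_pos (show (1 : ℤ) ≤ l by omega)]
  · intro l h1 hN t ht
    have ha := hnode l h1 (by omega)
    have hrr : ∀ r : Ioc (0 : ℝ) (t - ((l : ℝ) - 1) * S.h), (r : ℝ) ∈ Ioc 0 S.h := fun r => by
      refine ⟨r.2.1, r.2.2.trans ?_⟩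
      have := ht.2
      linarith
    have hz : ∀ r : Ioc (0 : ℝ) (t - ((l : ℝ) - 1) * S.h),
        ζ l r 1 - Function.leftLim x (r + ((l : ℝ) - 1) * S.h) = 0 := fun r => by
      rw [hxl l r h1 hN (hrr r)]
      simp only [hζ, if_pos h1, sub_self]
    have ht' : ∀ r : Ioc (0 : ℝ) (t - ((l : ℝ) - 1) * S.h),
        θ l r 1 - Function.leftLim v (r + ((l : ℝ) - 1) * S.h) = 0 := fun r => by
      rw [hvl l r h1 hN (hrr r)]
      simp only [hθ, if_pos h1, sub_self]
    simp_rw [hz, ht', tsum_zero, add_zero]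
    refine ⟨summable_zero, summable_zero, ?_, ?_⟩
    · have hb : t ∈ Icc 0 S.T := by
        refine ⟨ha.1.trans ht.1.le, ht.2.le.trans ?_⟩
        exact mul_le_mul_of_nonneg_right (by exact_mod_cast hN) S.h_pos.le
      have hm1 : Measurable fun s => (s, S.delayed x s) :=
        measurable_id.prodMk (measurable_delayed hx.measurable)
      obtain ⟨D, hD0, hDf, hDg⟩ := S.exists_bound
      have hB0 : 0 ≤ B := (norm1_nonneg _).trans (hB 0)
      have hfi : IntervalIntegrable (fun s => S.f (s, S.delayed x s)) volume
          (((l : ℝ) - 1) * S.h) t := intervalIntegrable_of_bounded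
        (S.f_contDiff.continuous.measurable.comp hm1).aestronglyMeasurable (fun _ => hDf _) _ _
      have hgm : ∀ j, Measurable fun s => S.g j (s, S.delayed x s) := fun j =>
        (S.g_contDiff j).continuous.measurable.comp hm1
      have hUm : ∀ j, Measurable fun s => U s j := fun j =>
        (measurable_pi_apply j).comp hU.measurable
      have hgb : ∀ j s, ‖U s j • S.g j (s, S.delayed x s)‖ ≤ B * D := fun j s => by
        rw [norm_smul, Real.norm_eq_abs]
        exact mul_le_mul ((abs_le_norm1 _ j).trans (hB s)) (hDg j _) (norm_nonneg _) hB0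
      have hgi : ∀ j, IntervalIntegrable (fun s => U s j • S.g j (s, S.delayed x s)) volume
          (((l : ℝ) - 1) * S.h) t := fun j => intervalIntegrable_of_bounded
        ((hUm j).smul (hgm j)).aestronglyMeasurable (hgb j) _ _
      rw [hx.sub_eq hU ha hb]
      unfold field
      have hsi : IntervalIntegrable (fun s => ∑ j, U s j • S.g j (s, S.delayed x s)) volume
          (((l : ℝ) - 1) * S.h) t := intervalIntegrable_of_bounded
        (Finset.measurable_fun_sum _ fun j _ => (hUm j).smul (hgm j)).aestronglyMeasurable
        (fun s => (norm_sum_smul_le _ fun j => hDg j _).trans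
          (mul_le_mul_of_nonneg_right (hB s) hD0)) _ _
      rw [intervalIntegral.integral_add hfi hsi,
        intervalIntegral.integral_finsetSum fun j _ => hgi j, add_assoc]
      congr 1
      · simp [hζ, if_pos h1]
      congr 1
      refine Finset.sum_congr rfl fun j _ => ?_
      have hr : (volume.restrict (Icc 0 S.T)).restrict (Icc (((l : ℝ) - 1) * S.h) t) =
          volume.restrict (Icc (((l : ℝ) - 1) * S.h) t) := by
        rw [Measure.restrict_restrict measurableSet_Icc,
          inter_eq_left.2 (Icc_subset_Icc ha.1 hb.2)]
      rw [contPartSigned_eq_self (hμ0 j), hμ, setIntegral_withDensityᵥ (hμi j) measurableSet_Icc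
        (hgm j).aestronglyMeasurable, hr, intervalIntegral.integral_of_le ht.1.le,
        integral_Icc_eq_integral_Ioc]
      rw [IntegrableOn, hr]
      exact Measure.integrableOn_of_bounded (by simp)
        ((hUm j).smul (hgm j)).aestronglyMeasurable (ae_of_all _ (hgb j))
    · have hb : t ≤ S.T := ht.2.le.trans
        (mul_le_mul_of_nonneg_right (by exact_mod_cast hN) S.h_pos.le)
      rw [contPart_eq_self hν0, hU.totalVar_controlMeasure_real ha.1 ht.1.le hb]
      simp only [hθ, if_pos h1, zero_add, hv]
      rw [intervalIntegral.integral_add_adjacent_intervals (hU.intervalIntegrable_norm1 _ _)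
        (hU.intervalIntegrable_norm1 _ _)]

end DelaySystem

end ImpulseDelay

end

noncomputable section

namespace ImpulseDelay

/-! ### Gluing along the clock -/

open scoped Classical in
/-- The function equal to `G r` on the preimage of `r ∈ C` and to `g` elsewhere. -/
def glue {E : Type*} (φ : ℝ → ℝ) (C : Set ℝ) (G : ℝ → ℝ → E) (g : ℝ → E) (s : ℝ) : E :=
  if φ s ∈ C then G (φ s) s else g s

section glue

variable {E : Type*} {φ : ℝ → ℝ} {C : Set ℝ} {G : ℝ → ℝ → E} {g : ℝ → E} {s : ℝ}

theorem glue_of_mem (h : φ s ∈ C) : glue φ C G g s = G (φ s) s := if_pos h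

theorem glue_of_notMem (h : φ s ∉ C) : glue φ C G g s = g s := if_neg h

/-- Countability of C matters: the preimage of a measurable set is a countable union over the fibres
of C together with one piece off them, with no joint measurability required of G. -/
theorem measurable_glue [MeasurableSpace E] (hφ : Measurable φ) (hC : C.Countable)
    (hG : ∀ r ∈ C, Measurable (G r)) (hg : Measurable g) : Measurable (glue φ C G g) := by
  intro A hA
  have : glue φ C G g ⁻¹' A =
      (⋃ r ∈ C, φ ⁻¹' {r} ∩ G r ⁻¹' A) ∪ (φ ⁻¹' Cᶜ ∩ g ⁻¹' A) := by
    ext s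
    by_cases h : φ s ∈ C
    · simp [glue_of_mem h, h]
    · simp only [mem_preimage, glue_of_notMem h, mem_union, mem_iUnion, mem_inter_iff,
        mem_singleton_iff, mem_compl_iff, h, not_false_eq_true, true_and]
      refine ⟨Or.inr, ?_⟩
      rintro (⟨r, hr, h1, -⟩ | h1)
      · exact absurd (h1 ▸ hr) h
      · exact h1
  rw [this]
  exact (MeasurableSet.biUnion hC fun r hr => (hφ (measurableSet_singleton r)).inter (hG r hr hA)).union
    ((hφ hC.measurableSet.compl).inter (hg hA))

end glue

/-- By the Jordan decomposition the function is a difference of monotone functions on the interval;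
clamping the argument makes both monotone on the whole line. -/
theorem measurable_comp_projIcc_of_boundedVariationOn {f : ℝ → ℝ} {a b : ℝ} (hab : a ≤ b)
    (hf : BoundedVariationOn f (Icc a b)) : Measurable fun t => f (projIcc a b hab t) := by
  obtain ⟨u, w, hu, hw, he⟩ := hf.locallyBoundedVariationOn.exists_monotoneOn_sub_monotoneOn
  have key : ∀ {u : ℝ → ℝ}, MonotoneOn u (Icc a b) → Measurable fun t => u (projIcc a b hab t) :=
    fun hu => Monotone.measurable fun s t hst =>
      hu (projIcc a b hab s).2 (projIcc a b hab t).2 (monotone_projIcc hab hst)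
  rw [he]
  exact (key hu).sub (key hw)

theorem measurable_comp_projIcc_of_boundedVariationOn_pi {f : ℝ → Fin n → ℝ} {a b : ℝ} (hab : a ≤ b)
    (hf : BoundedVariationOn f (Icc a b)) : Measurable fun t => f (projIcc a b hab t) := by
  refine measurable_pi_lambda _ fun k => ?_
  refine measurable_comp_projIcc_of_boundedVariationOn (f := fun t => f t k) hab ?_
  refine ne_top_of_le_ne_top hf ?_
  refine iSup_mono fun P => Finset.sum_le_sum fun i _ => ?_
  exact edist_le_pi_edist _ _ k

/-- Rescaling of an arc to an interval of length `P`. -/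
theorem integral_rescale {E : Type*} [NormedAddCommGroup E] [NormedSpace ℝ E] {F G : ℝ → E}
    {b P : ℝ} (hP : 0 ≤ P) (hF : ∀ s ∈ Ioo b (b + P), F s = P⁻¹ • G ((s - b) / P))
    {τ : ℝ} (hτ : τ ∈ Icc (0 : ℝ) 1) (hG : P = 0 → ∫ s in (0 : ℝ)..τ, G s = 0) :
    ∫ s in b..(b + τ * P), F s = ∫ s in (0 : ℝ)..τ, G s := by
  -- For P = 0 there is nothing to rescale: the left interval is degenerate and the right-hand side
  -- vanishes by assumption.
  rcases hP.eq_or_lt with h0 | h0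
  · simp [← h0, hG h0.symm]
  have h1 : ∫ s in b..(b + τ * P), F s = ∫ s in b..(b + τ * P), P⁻¹ • G (s / P - b / P) := by
    have h2 : b ≤ b + τ * P := by have := mul_nonneg hτ.1 hP; linarith
    rw [intervalIntegral.integral_of_le h2, intervalIntegral.integral_of_le h2,
      integral_Ioc_eq_integral_Ioo, integral_Ioc_eq_integral_Ioo]
    refine setIntegral_congr_fun measurableSet_Ioo fun s hs => ?_
    have : s ∈ Ioo b (b + P) := ⟨hs.1, hs.2.trans_le (by nlinarith [hτ.2])⟩
    simp only [hF s this, sub_div]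
  rw [h1, intervalIntegral.integral_smul, intervalIntegral.inv_smul_integral_comp_div_sub]
  congr 1
  · ring
  · field_simp; ring

namespace IsClockMeasure

variable {p : Measure ℝ} {h : ℝ} (hp : IsClockMeasure p h)
include hp

/-- Integration over the unfolded time of a path with jumps, each jump being resolved by an arc. -/
theorem unfold_eq {E : Type*} [NormedAddCommGroup E] [NormedSpace ℝ E]
    {C : Set ℝ} (hC : C.Countable) (h0 : (0 : ℝ) ∈ C) (hCp : ∀ r, p.real {r} ≠ 0 → r ∈ C)
    {F : ℝ → E} (hF : IntegrableOn F (Icc 0 (p.real univ))) {X : ℝ → E} {z : ℝ → ℝ → E}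
    (hjump : ∀ r ∈ Icc 0 h, ∀ τ ∈ Icc (0 : ℝ) 1,
      z r τ = z r 0 + ∫ s in cumulLeft p r..(cumulLeft p r + τ * p.real {r}), F s)
    (hinit : ∀ r ∈ Ioc 0 h, ∀ y, Tendsto X (𝓝[<] r) (𝓝 y) → z r 0 = y)
    (hX : ∀ r ∈ Ioo 0 h, X r = z 0 1 +
      (∫ s in Icc 0 (p.real univ) ∩ clock p ⁻¹' (Ioc 0 r \ C), F s) +
        ∑' r' : Ioc 0 r, (z r' 1 - z r' 0)) :
    (∀ r ∈ Ioo 0 h, X r = z 0 0 + ∫ s in (0 : ℝ)..cumul p r, F s) ∧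
    ∀ r ∈ Icc 0 h, ∀ τ ∈ Icc (0 : ℝ) 1,
      z r τ = z 0 0 + ∫ s in (0 : ℝ)..(cumulLeft p r + τ * p.real {r}), F s := by
  have := hp.finite
  have hfull : ∀ r ∈ Icc 0 h, z r 1 - z r 0 =
      ∫ s in Icc 0 (p.real univ) ∩ clock p ⁻¹' {r}, F s := by
    intro r hr
    rw [hjump r hr 1 (by simp), add_sub_cancel_left, one_mul, cumulLeft_add_atom,
      hp.clock_preimage hr, intervalIntegral.integral_of_le (cumulLeft_le_cumul r),
      integral_Icc_eq_integral_Ioc]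
  have hii : ∀ a ∈ Icc 0 (p.real univ), ∀ b ∈ Icc 0 (p.real univ), IntervalIntegrable F volume a b := by
    intro a ha b hb
    rw [intervalIntegrable_iff]
    exact hF.mono_set (uIoc_subset_uIcc.trans (uIcc_subset_Icc ha hb))
  have hmem0 : (0 : ℝ) ∈ Icc 0 (p.real univ) := ⟨le_rfl, hp.total_pos.le⟩
  have hm := hp.measurable_clock
  have hXr : ∀ r ∈ Ioo 0 h, X r = z 0 0 + ∫ s in (0 : ℝ)..cumul p r, F s := by
    intro r hr
    have hCm := hC.measurableSet
    -- Arcs over points outside C have zero increment because their atom is zero, so the uncountably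
    -- indexed sum reduces to C, and the remaining increments are the integrals of F over disjoint
    -- fibres of the clock.
    have h1 : ∑' r' : Ioc 0 r, (z r' 1 - z r' 0) =
        ∫ s in Icc 0 (p.real univ) ∩ clock p ⁻¹' (Ioc 0 r ∩ C), F s := by
      have hD : (Ioc 0 r ∩ C).Countable := hC.mono inter_subset_right
      have := hD.to_subtype
      have e1 : Icc 0 (p.real univ) ∩ clock p ⁻¹' (Ioc 0 r ∩ C) =
          ⋃ r' : (Ioc 0 r ∩ C : Set ℝ), Icc 0 (p.real univ) ∩ clock p ⁻¹' {(r' : ℝ)} := by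
        ext s; simp
      have e2 := integral_iUnion (μ := volume) (f := F)
        (s := fun r' : (Ioc 0 r ∩ C : Set ℝ) => Icc 0 (p.real univ) ∩ clock p ⁻¹' {(r' : ℝ)})
        (fun r' => measurableSet_Icc.inter (hm (measurableSet_singleton _)))
        (fun a b hab => by
          refine Set.disjoint_left.2 fun s hs hs' => hab (Subtype.ext ?_)
          exact (show clock p s = a from hs.2).symm.trans hs'.2)
        (hF.mono_set (iUnion_subset fun _ => inter_subset_left))
      rw [e1, e2, tsum_subtype (Ioc 0 r) fun r' => z r' 1 - z r' 0,
        tsum_subtype (Ioc 0 r ∩ C) fun r' => ∫ s in Icc 0 (p.real univ) ∩ clock p ⁻¹' {r'}, F s]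
      refine tsum_congr fun r' => ?_
      by_cases h2 : r' ∈ Ioc 0 r
      · have h3 : r' ∈ Icc 0 h := ⟨h2.1.le, h2.2.trans hr.2.le⟩
        rw [indicator_of_mem h2]
        by_cases h4 : r' ∈ C
        · rw [indicator_of_mem (show r' ∈ Ioc 0 r ∩ C from ⟨h2, h4⟩), hfull r' h3]
        · rw [indicator_of_notMem (fun h => h4 h.2), hjump r' h3 1 (by simp)]
          have : p.real {r'} = 0 := by
            by_contra h5
            exact h4 (hCp _ h5)
          simp [this]
      · rw [indicator_of_notMem h2, indicator_of_notMem (fun h => h2 h.1)]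
    have h0r : (0 : ℝ) ≤ r := hr.1.le
    have h2 : z 0 1 = z 0 0 + ∫ s in Icc 0 (p.real univ) ∩ clock p ⁻¹' {0}, F s := by
      rw [← hfull 0 ⟨le_rfl, hp.pos.le⟩]; abel
    have hint : ∀ A : Set ℝ, IntegrableOn F (Icc 0 (p.real univ) ∩ clock p ⁻¹' A) :=
      fun A => hF.mono_set inter_subset_left
    -- The fibre over 0, the fibres over the other jumps and the part away from the jumps partition
    -- [0, `cumul p r`].
    rw [hX r hr, h1, h2, add_assoc, add_assoc, ← setIntegral_union, ← setIntegral_union]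
    · congr 1
      rw [intervalIntegral.integral_of_le (cumul_nonneg r), ← integral_Icc_eq_integral_Ioc]
      congr 2
      ext s
      simp only [mem_union, mem_inter_iff, mem_preimage, mem_singleton_iff, mem_Ioc, Set.mem_sdiff]
      have hc := hp.clock_le_iff (s := s) h0r
      have hn := clock_nonneg (p := p) s
      constructor
      · intro hs
        have hs1 : s ∈ Icc 0 (p.real univ) := by tauto
        rw [min_eq_left hs1.2] at hc
        refine ⟨hs1.1, hc.1 ?_⟩
        rcases hs with h3 | h3 | h3
        · rw [h3.2]; exact h0r
        · exact h3.2.1.2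
        · exact h3.2.1.2
      · intro hs
        have hs1 : s ∈ Icc 0 (p.real univ) := ⟨hs.1, hs.2.trans (hp.cumul_mem r).2⟩
        rw [min_eq_left hs1.2] at hc
        have h3 := hc.2 hs.2
        rcases hn.eq_or_lt with h4 | h4
        · exact Or.inl ⟨hs1, h4.symm⟩
        · by_cases h5 : clock p s ∈ C <;> tauto
    · refine Set.disjoint_left.2 ?_
      rintro s ⟨-, hs⟩ (⟨-, hs'⟩ | ⟨-, hs'⟩)
      · exact hs'.2 ((show clock p s = 0 from hs) ▸ h0)
      · exact absurd (show clock p s = 0 from hs) hs'.1.1.ne'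
    · exact (measurableSet_Icc.inter (hm (measurableSet_Ioc.diff hCm))).union
        (measurableSet_Icc.inter (hm (measurableSet_Ioc.inter hCm)))
    · exact hint _
    · exact (hint _).union (hint _)
    · refine Set.disjoint_left.2 ?_
      rintro s ⟨-, hs⟩ ⟨-, hs'⟩
      exact hs.2 hs'.2
    · exact measurableSet_Icc.inter (hm (measurableSet_Ioc.inter hCm))
    · exact hint _
    · exact hint _
  refine ⟨hXr, fun r hr τ hτ => ?_⟩
  have hmem : cumulLeft p r + τ * p.real {r} ∈ Icc 0 (p.real univ) := by
    have h1 := cumulLeft_add_atom (p := p) r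
    have h2 := (hp.cumul_mem r).2
    have h3 : (0 : ℝ) ≤ p.real {r} := measureReal_nonneg
    have h4 := cumulLeft_nonneg (p := p) r
    constructor <;> nlinarith [hτ.1, hτ.2]
  -- Only the start of the arc is missing. For r > 0 it is the left limit of X, along which the
  -- upper limit of integration tends to `cumulLeft p r`; for r = 0 that quantity is zero.
  suffices h1 : z r 0 = z 0 0 + ∫ s in (0 : ℝ)..cumulLeft p r, F s by
    rw [hjump r hr τ hτ, h1, add_assoc, intervalIntegral.integral_add_adjacent_intervals
      (hii _ hmem0 _ (hp.cumulLeft_mem r)) (hii _ (hp.cumulLeft_mem r) _ hmem)]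
  rcases hr.1.eq_or_lt with h1 | h1
  · rw [← h1, hp.cumulLeft_zero]; simp
  refine hinit r ⟨h1, hr.2⟩ _ ?_
  have hcont : ContinuousOn (fun u => ∫ s in (0 : ℝ)..u, F s) (Icc 0 (p.real univ)) :=
    intervalIntegral.continuousOn_primitive_interval (by rwa [uIcc_of_le hp.total_pos.le])
      |>.mono (by rw [uIcc_of_le hp.total_pos.le])
  have h2 := (hcont _ (hp.cumulLeft_mem r)).tendsto.comp
    (tendsto_nhdsWithin_iff.2 ⟨tendsto_cumul_left r, Eventually.of_forall hp.cumul_mem⟩)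
  refine (h2.const_add (z 0 0)).congr' ?_
  filter_upwards [Ioo_mem_nhdsLT h1] with r' hr'
  exact (hXr r' ⟨hr'.1, hr'.2.trans_le hr.2⟩).symm

end IsClockMeasure

end ImpulseDelay

end

noncomputable section

namespace ImpulseDelay

theorem sum_Icc_int {E : Type*} [AddCommMonoid E] (N : ℕ) (G : ℤ → E) :
    ∑ l ∈ Finset.Icc (1 : ℤ) N, G l = ∑ i ∈ Finset.range N, G (i + 1) := by
  symm
  refine Finset.sum_bij (fun i _ => (i : ℤ) + 1) ?_ ?_ ?_ fun _ _ => rfl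
  · intro i hi
    simp only [Finset.mem_range, Finset.mem_Icc] at *
    omega
  · intro i _ j _ hij
    omega
  · intro l hl
    simp only [Finset.mem_Icc] at hl
    exact ⟨(l - 1).toNat, by simp only [Finset.mem_range]; omega, by omega⟩

/-! ### The clock measure of an impulse control -/

/-- The total mass of the controls attached to `r`. -/
def jumpMass (S : DelaySystem n m) (ω : ℤ → ℝ → ℝ → Fin m → ℝ) (r : ℝ) : ℝ :=
  ∑ i ∈ Finset.range S.N, ∫ s in (0 : ℝ)..1, norm1 (ω (i + 1) r s)

/-- The `i`-th block of a measure, translated to `]0,h[`. -/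
def block (h : ℝ) (κ : Measure ℝ) (i : ℕ) : Measure ℝ :=
  (κ.map fun t => t - i * h).restrict (Ioo 0 h)

/-- The measure on `[0,h]` whose distribution function is used as a new time. -/
def clockMeasure (S : DelaySystem n m) (ν : Measure ℝ) (ω : ℤ → ℝ → ℝ → Fin m → ℝ) : Measure ℝ :=
  volume.restrict (Ioo 0 S.h) + ∑ i ∈ Finset.range S.N, block S.h ν i +
    (ENNReal.ofReal (jumpMass S ω 0) • Measure.dirac 0 +
      ENNReal.ofReal (jumpMass S ω S.h) • Measure.dirac S.h)

theorem block_apply {h : ℝ} {κ : Measure ℝ} {i : ℕ} {B : Set ℝ} (hB : MeasurableSet B)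
    (hBh : B ⊆ Ioo 0 h) : block h κ i B = κ ((fun r => r + i * h) '' B) := by
  rw [block, Measure.restrict_apply hB, inter_eq_left.2 hBh, Measure.map_apply (by fun_prop) hB]
  congr 1
  ext t
  simp only [mem_preimage, mem_image]
  exact ⟨fun ht => ⟨_, ht, by ring⟩, by rintro ⟨r, hr, rfl⟩; simpa using hr⟩

instance {h : ℝ} {κ : Measure ℝ} [IsFiniteMeasure κ] {i : ℕ} : IsFiniteMeasure (block h κ i) := by
  unfold block; infer_instance

theorem block_mono {h : ℝ} {κ κ' : Measure ℝ} (hκ : κ ≤ κ') (i : ℕ) : block h κ i ≤ block h κ' i :=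
  Measure.restrict_mono le_rfl (Measure.map_mono hκ (by fun_prop))

theorem setIntegral_block {E : Type*} [NormedAddCommGroup E] [NormedSpace ℝ E] {h : ℝ}
    {κ : Measure ℝ} {i : ℕ} {B : Set ℝ} (hBm : MeasurableSet B) (H : ℝ → E) :
    ∫ r in B, H (r + i * h) ∂(block h κ i) =
      ∫ t in (fun r => r + i * h) '' (B ∩ Ioo 0 h), H t ∂κ := by
  have hme : MeasurableEmbedding fun t : ℝ => t - i * h :=
    (Homeomorph.subRight ((i : ℝ) * h)).measurableEmbedding
  rw [block, Measure.restrict_restrict hBm, hme.setIntegral_map]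
  simp only [sub_add_cancel]
  congr 2
  ext t
  simp only [mem_preimage, mem_image]
  exact ⟨fun ht => ⟨_, ht, by ring⟩, by rintro ⟨r, hr, rfl⟩; simpa using hr⟩

namespace IsImpulseControl

variable {S : DelaySystem n m} {μ : Fin m → SignedMeasure ℝ} {ν : Measure ℝ}
  {ω : ℤ → ℝ → ℝ → Fin m → ℝ}

theorem jumpMass_nonneg (r : ℝ) : 0 ≤ jumpMass S ω r :=
  Finset.sum_nonneg fun _ _ => intervalIntegral.integral_nonneg zero_le_one fun _ _ => norm1_nonneg _

theorem isClockMeasure [IsFiniteMeasure ν] : IsClockMeasure (clockMeasure S ν ω) S.h where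
  finite := by
    have : IsFiniteMeasure (volume.restrict (Ioo 0 S.h)) := ⟨by simp⟩
    have h1 : ∀ c : ℝ, ∀ r : ℝ, IsFiniteMeasure (ENNReal.ofReal c • Measure.dirac r) := fun c r =>
      ⟨by simp⟩
    have := h1 (jumpMass S ω 0) 0
    have := h1 (jumpMass S ω S.h) S.h
    unfold clockMeasure
    infer_instance
  pos := S.h_pos
  supp := by
    have h1 : Ioo 0 S.h ∩ (Icc 0 S.h)ᶜ = ∅ := by
      ext t
      simp only [mem_inter_iff, mem_Ioo, mem_compl_iff, mem_Icc, mem_empty_iff_false, iff_false]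
      rintro ⟨h1, h2⟩
      exact h2 ⟨h1.1.le, h1.2.le⟩
    have h2 := S.h_pos.le
    simp [clockMeasure, block, Measure.restrict_apply, measurableSet_Icc.compl, inter_comm _ (Ioo 0 S.h),
      h1, h2]
  volume_le := by
    rw [clockMeasure, add_assoc]
    exact Measure.le_add_right le_rfl

theorem block_le {i : ℕ} (hi : i < S.N) : block S.h ν i ≤ clockMeasure S ν ω := by
  rw [clockMeasure]
  refine Measure.le_add_right (Measure.le_add_left ?_)
  intro B
  rw [Measure.finsetSum_apply]
  exact Finset.single_le_sum (f := fun i => block S.h ν i B) (fun _ _ => zero_le) (Finset.mem_range.2 hi)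

variable (hc : IsImpulseControl S μ ν ω)
include hc

theorem isFiniteMeasure : IsFiniteMeasure ν := hc.variation.1

/-- At interior points the atoms come from the translates of ν and match the attached controls by
`atom_variation`. At 0 and h they were prescribed: there ν alone does not determine how a node atom
is divided between two blocks. -/
theorem clockMeasure_singleton {r : ℝ} (hr : r ∈ Icc 0 S.h) :
    (clockMeasure S ν ω).real {r} = jumpMass S ω r := by
  have := hc.isFiniteMeasure
  have hpos := S.h_pos
  rw [measureReal_def, ← ENNReal.toReal_ofReal (jumpMass_nonneg (ω := ω) r)]
  congr 1
  rw [clockMeasure]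
  simp only [Measure.add_apply, Measure.finsetSum_apply, Measure.smul_apply, smul_eq_mul,
    Measure.dirac_apply' _ (measurableSet_singleton r)]
  have h1 : (volume.restrict (Ioo 0 S.h)) {r} = 0 := 
    le_antisymm ((Measure.restrict_le_self _).trans (by simp)) zero_le
  rw [h1, zero_add]
  have h2 : r ∉ Ioo 0 S.h → ∀ i : ℕ, block S.h ν i {r} = 0 := by
    intro h i
    rw [block, Measure.restrict_apply (measurableSet_singleton r), singleton_inter_eq_empty.2 h,
      measure_empty]
  rcases hr.1.eq_or_lt with h3 | h3
  · subst h3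
    simp [h2, hpos.ne']
  rcases hr.2.eq_or_lt with h4 | h4
  · subst h4
    simp [h2, hpos.ne]
  have h5 : r ∈ Ioo 0 S.h := ⟨h3, h4⟩
  rw [indicator_of_notMem (by simpa using h3.ne), indicator_of_notMem (by simpa using h4.ne'),
    mul_zero, mul_zero, add_zero, add_zero, jumpMass, ENNReal.ofReal_sum_of_nonneg]
  · refine Finset.sum_congr rfl fun i hi => ?_
    rw [block_apply (measurableSet_singleton r) (singleton_subset_iff.2 h5), image_singleton]
    have h6 := hc.atom_variation r h5 (i + 1) (by omega) (by have := Finset.mem_range.1 hi; omega)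
    push_cast at h6
    rw [add_sub_cancel_right] at h6
    rw [h6, measureReal_def, ENNReal.ofReal_toReal (measure_ne_top _ _)]
  · exact fun i _ => intervalIntegral.integral_nonneg zero_le_one fun _ _ => norm1_nonneg _

/-- Measurable, bounded, everywhere cone-valued representatives of the attached controls. -/
theorem exists_representative : ∃ ω' : ℤ → ℝ → ℝ → Fin m → ℝ, ∀ l r, Measurable (ω' l r) ∧
    (∀ s, ω' l r s ∈ S.K) ∧ (∀ s, norm1 (ω' l r s) ≤ jumpMass S ω r) ∧
    (0 ≤ l → r ∈ Icc 0 S.h → ω' l r =ᵐ[volume.restrict (Icc 0 1)] ω l r) := by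
  have key : ∀ l r, ∃ g : ℝ → Fin m → ℝ, Measurable g ∧ (∀ s, g s ∈ S.K) ∧
      (∀ s, norm1 (g s) ≤ jumpMass S ω r) ∧
      (0 ≤ l → r ∈ Icc 0 S.h → g =ᵐ[volume.restrict (Icc 0 1)] ω l r) := by
    intro l r
    by_cases hlr : (1 ≤ l ∧ l ≤ S.N) ∧ r ∈ Icc 0 S.h
    · obtain ⟨⟨h1, h2⟩, hr⟩ := hlr
      lift l to ℕ using by omega
      have h1 : 1 ≤ l := by exact_mod_cast h1
      have h2 : l ≤ S.N := by exact_mod_cast h2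
      have hae := (hc.memLp l r h1 h2 hr).aestronglyMeasurable
      set g := hae.mk _ with hg
      have hgm : Measurable g := hae.stronglyMeasurable_mk.measurable
      -- The norm bound holds almost everywhere because each summand of the constant total speed is
      -- at most the sum, which equals `jumpMass S ω r`.
      set A : Set ℝ := {s | g s ∈ S.K ∧ norm1 (g s) ≤ jumpMass S ω r} with hA
      have hAm : MeasurableSet A := (hgm S.K_closed.measurableSet).inter
        (measurableSet_le (ImpulseDelay.measurable_norm1.comp hgm) measurable_const)
      refine ⟨A.indicator g, hgm.indicator hAm, fun s => ?_, fun s => ?_, fun _ _ => ?_⟩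
      · by_cases hs : s ∈ A
        · rw [indicator_of_mem hs]; exact hs.1
        · rw [indicator_of_notMem hs]; exact S.zero_mem_K
      · by_cases hs : s ∈ A
        · rw [indicator_of_mem hs]; exact hs.2
        · rw [indicator_of_notMem hs, norm1_zero]; exact jumpMass_nonneg r
      · filter_upwards [hae.ae_eq_mk, hc.sum_norm r hr, ae_restrict_mem measurableSet_Icc]
          with s hs1 hs2 hs3
        have : s ∈ A := by
          refine ⟨?_, ?_⟩
          · rw [hg, ← hs1]; exact hc.mem_K l r h1 h2 hr s hs3
          · rw [hg, ← hs1, jumpMass]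
            rw [sum_Icc_int S.N fun l => ∫ s' in (0 : ℝ)..1, norm1 (ω l r s')] at hs2
            rw [← hs2]
            exact Finset.single_le_sum (f := fun l => norm1 (ω l r s)) (fun _ _ => norm1_nonneg _)
              (Finset.mem_Icc.2 ⟨Nat.cast_le.2 h1, Nat.cast_le.2 h2⟩)
        rw [indicator_of_mem this, hg, hs1]
    · refine ⟨0, measurable_const, fun _ => S.zero_mem_K, fun _ => ?_, fun hl hr => ?_⟩
      · rw [Pi.zero_apply, norm1_zero]; exact jumpMass_nonneg r
      · refine Eventually.of_forall fun s => ?_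
        lift l to ℕ using hl
        rw [hc.eq_zero l r s (by
          by_contra h
          push Not at h
          exact hlr ⟨⟨by exact_mod_cast h.1, by exact_mod_cast h.2⟩, hr⟩)]
        rfl
  choose ω' h using key
  exact ⟨ω', h⟩

end IsImpulseControl

/-! ### Controls and trajectories in unfolded time -/

/-- A control in unfolded time: the `N` blocks of length `h` run in parallel during `[0,L]`, with
common clock rate `a` and controls `w`. -/
structure UnfoldedControl (S : DelaySystem n m) where
  L : ℝ
  L_pos : 0 < L
  a : ℝ → ℝ
  a_measurable : Measurable a
  a_nonneg : ∀ s, 0 ≤ a s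
  a_le_one : ∀ s, a s ≤ 1
  integral_a : ∫ s in (0 : ℝ)..L, a s = S.h
  w : ℤ → ℝ → Fin m → ℝ
  w_measurable : ∀ l, Measurable (w l)
  w_mem : ∀ l s, w l s ∈ S.K
  norm1_w_le : ∀ l s, norm1 (w l s) ≤ 1

namespace UnfoldedControl

variable {S : DelaySystem n m} (R : UnfoldedControl S)

/-- The time `∫ a` reached by the clock. -/
def time (s : ℝ) : ℝ := ∫ s' in (0 : ℝ)..s, R.a s'

/-- The right-hand side of the system in unfolded time. -/
def field (Y : ℤ → ℝ → Fin n → ℝ) (l : ℤ) (s : ℝ) : Fin n → ℝ :=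
  R.a s • S.f (R.time s + (l - 1) * S.h, fun k => Y (l - (k : ℕ)) s) +
    ∑ j, R.w l s j • S.g j (R.time s + (l - 1) * S.h, fun k => Y (l - (k : ℕ)) s)

/-- The stack `Y` of the blocks of a trajectory solves the system in unfolded time. -/
structure IsTrajectory (Y : ℤ → ℝ → Fin n → ℝ) : Prop where
  measurable : ∀ l, Measurable (Y l)
  past : ∀ l : ℤ, l ≤ 0 → 1 - S.M ≤ l → ∀ s ∈ Ico 0 R.L, Y l s = S.ξ₀ (R.time s + (l - 1) * S.h)
  -- The final instant of block 0 carries the initial state, not ξ₀(0); for this reason the past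
  -- condition excludes s = L.
  init : Y 0 R.L = S.x₀
  eq : ∀ l : ℤ, 1 ≤ l → l ≤ S.N → ∀ s ∈ Icc 0 R.L,
    Y l s = Y (l - 1) R.L + ∫ s' in (0 : ℝ)..s, R.field Y l s'

end UnfoldedControl

end ImpulseDelay

end

/-! ### Densities with respect to the clock measure and the unfolded control -/

noncomputable section

namespace ImpulseDelay

/-- The densities with respect to a common clock measure from which the unfolded control of an
impulse control is built. -/
structure ClockData (S : DelaySystem n m) (μ : Fin m → SignedMeasure ℝ) (ν : Measure ℝ)
    (ω : ℤ → ℝ → ℝ → Fin m → ℝ) where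
  p : Measure ℝ
  isClock : IsClockMeasure p S.h
  atom : ∀ r ∈ Icc 0 S.h, p.real {r} = jumpMass S ω r
  ω' : ℤ → ℝ → ℝ → Fin m → ℝ
  ω'_measurable : ∀ l r, Measurable (ω' l r)
  ω'_mem : ∀ l r s, ω' l r s ∈ S.K
  norm1_ω'_le : ∀ l r s, norm1 (ω' l r s) ≤ jumpMass S ω r
  ω'_ae : ∀ l r, 0 ≤ l → r ∈ Icc 0 S.h → ω' l r =ᵐ[volume.restrict (Icc 0 1)] ω l r
  D : ℝ → ℝ
  D_measurable : Measurable D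
  D_nonneg : ∀ r, 0 ≤ D r
  D_le_one : ∀ r, D r ≤ 1
  volume_eq : volume.restrict (Ioo 0 S.h) = p.withDensity fun r => ENNReal.ofReal (D r)
  ρ : ℤ → ℝ → ℝ
  ρ_measurable : ∀ l, Measurable (ρ l)
  ρ_nonneg : ∀ l r, 0 ≤ ρ l r
  ρ_le_one : ∀ l r, ρ l r ≤ 1
  block_eq : ∀ i : ℕ, i < S.N →
    block S.h (contPart ν) i = p.withDensity fun r => ENNReal.ofReal (ρ (i + 1) r)
  k : ℝ → Fin m → ℝ
  k_measurable : Measurable k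
  k_mem : ∀ t, k t ∈ S.K
  norm1_k_le : ∀ t, norm1 (k t) ≤ 1
  norm1_k_ae : ∀ᵐ t ∂(contPart ν), norm1 (k t) = 1
  contPartSigned_eq : ∀ j, contPartSigned (μ j) = (contPart ν).withDensityᵥ fun t => k t j

/-- Lebesgue measure and every block of the continuous part of ν are dominated by the clock measure,
so all of them have densities at most 1 with respect to it. -/
theorem IsImpulseControl.nonempty_clockData {S : DelaySystem n m} {μ : Fin m → SignedMeasure ℝ}
    {ν : Measure ℝ} {ω : ℤ → ℝ → ℝ → Fin m → ℝ} (hc : IsImpulseControl S μ ν ω) :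
    Nonempty (ClockData S μ ν ω) := by
  have := hc.isFiniteMeasure
  have hp : IsClockMeasure (clockMeasure S ν ω) S.h := IsImpulseControl.isClockMeasure
  have := hp.finite
  have : IsFiniteMeasure (contPart ν) := by unfold contPart; infer_instance
  have : IsFiniteMeasure (volume.restrict (Ioo 0 S.h)) := ⟨by simp⟩
  obtain ⟨ω', hω⟩ := hc.exists_representative
  obtain ⟨D, h1, h2, h3, h4⟩ := exists_density_le_one hp.volume_le
  obtain ⟨k, k1, k2, k3, k4, k5⟩ := exists_polar_contPart S.K_closed S.K_nonempty S.K_cone hc.ranges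
  rw [← hc.variation.2.2.1] at k4 k5
  have hρ : ∀ l : ℤ, ∃ ρ : ℝ → ℝ, Measurable ρ ∧ (∀ r, 0 ≤ ρ r) ∧ (∀ r, ρ r ≤ 1) ∧
      ∀ i : ℕ, l = i + 1 → i < S.N → block S.h (contPart ν) i =
        (clockMeasure S ν ω).withDensity fun r => ENNReal.ofReal (ρ r) := by
    intro l
    by_cases hl : ∃ i : ℕ, l = i + 1 ∧ i < S.N
    · obtain ⟨i, rfl, hi⟩ := hl
      have hle : block S.h (contPart ν) i ≤ clockMeasure S ν ω :=
        (block_mono Measure.restrict_le_self i).trans (IsImpulseControl.block_le hi)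
      obtain ⟨ρ, r1, r2, r3, r4⟩ := exists_density_le_one hle
      refine ⟨ρ, r1, r2, r3, fun i' hi' _ => ?_⟩
      obtain rfl : i = i' := by omega
      exact r4
    · exact ⟨0, measurable_const, fun _ => le_rfl, fun _ => zero_le_one,
        fun i h1 h2 => absurd ⟨i, h1, h2⟩ hl⟩
  choose ρ r1 r2 r3 r4 using hρ
  exact ⟨{
    p := clockMeasure S ν ω
    isClock := hp
    atom := fun r hr => hc.clockMeasure_singleton hr
    ω' := ω'
    ω'_measurable := fun l r => (hω l r).1
    ω'_mem := fun l r => (hω l r).2.1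
    norm1_ω'_le := fun l r => (hω l r).2.2.1
    ω'_ae := fun l r => (hω l r).2.2.2
    D := D
    D_measurable := h1
    D_nonneg := h2
    D_le_one := h3
    volume_eq := h4
    ρ := ρ
    ρ_measurable := r1
    ρ_nonneg := r2
    ρ_le_one := r3
    block_eq := fun i hi => r4 _ i rfl hi
    k := k
    k_measurable := k1
    k_mem := k2
    norm1_k_le := k3
    norm1_k_ae := k4
    contPartSigned_eq := k5 }⟩

namespace ClockData

variable {S : DelaySystem n m} {μ : Fin m → SignedMeasure ℝ} {ν : Measure ℝ}
  {ω : ℤ → ℝ → ℝ → Fin m → ℝ} (Q : ClockData S μ ν ω)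

/-- The times of `[0,h]` which are resolved by arcs. -/
def jumps : Set ℝ := {r | Q.p.real {r} ≠ 0} ∪ {0, S.h}

theorem countable_jumps : Q.jumps.Countable := by
  have := Q.isClock.finite
  have h1 : {r | Q.p.real {r} ≠ 0} ⊆ {r | Q.p {r} ≠ 0} := fun r hr h => hr (by
    rw [measureReal_def, show Q.p {r} = 0 from h, ENNReal.toReal_zero])
  exact ((countable_atoms Q.p).mono h1).union (by simp)

/-- The control in unfolded time. -/
def control (l : ℤ) : ℝ → Fin m → ℝ :=
  glue (clock Q.p) Q.jumps
    (fun r s => (Q.p.real {r})⁻¹ • Q.ω' l r ((s - cumulLeft Q.p r) / Q.p.real {r}))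
    fun s => Q.ρ l (clock Q.p s) • Q.k (clock Q.p s + (l - 1) * S.h)

theorem measurable_control (l : ℤ) : Measurable (Q.control l) := by
  have hm := Q.isClock.measurable_clock
  refine measurable_glue hm Q.countable_jumps (fun r _ => ?_) ?_
  · have h1 : Measurable fun s => (s - cumulLeft Q.p r) / Q.p.real {r} := by fun_prop
    exact ((Q.ω'_measurable l r).comp h1).const_smul (Q.p.real {r})⁻¹
  · exact ((Q.ρ_measurable l).comp hm).smul (Q.k_measurable.comp (hm.add_const _))

theorem control_mem (l : ℤ) (s : ℝ) : Q.control l s ∈ S.K := by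
  by_cases h : clock Q.p s ∈ Q.jumps
  · rw [control, glue_of_mem h]
    exact S.K_cone _ (inv_nonneg.2 measureReal_nonneg) _ (Q.ω'_mem _ _ _)
  · rw [control, glue_of_notMem h]
    exact S.K_cone _ (Q.ρ_nonneg _ _) _ (Q.k_mem _)

/-- An arc parametrized by [0,1] is stretched over an interval of length p{r}, so its control is
divided by p{r}, which is also the bound of the attached control. Off the jumps both factors are at
most 1. -/
theorem norm1_control_le (l : ℤ) (s : ℝ) : norm1 (Q.control l s) ≤ 1 := by
  by_cases h : clock Q.p s ∈ Q.jumps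
  · rw [control, glue_of_mem h, norm1_smul, abs_of_nonneg (inv_nonneg.2 measureReal_nonneg)]
    refine (mul_le_mul_of_nonneg_left (Q.norm1_ω'_le _ _ _) (inv_nonneg.2 measureReal_nonneg)).trans ?_
    rw [← Q.atom _ (Q.isClock.clock_mem s)]
    exact inv_mul_le_one
  · rw [control, glue_of_notMem h, norm1_smul, abs_of_nonneg (Q.ρ_nonneg _ _)]
    exact mul_le_one₀ (Q.ρ_le_one _ _) (norm1_nonneg _) (Q.norm1_k_le _)

/-- The unfolded control of an impulse control. -/
def unfolded : UnfoldedControl S where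
  L := Q.p.real univ
  L_pos := Q.isClock.total_pos
  a s := Q.jumpsᶜ.indicator Q.D (clock Q.p s)
  a_measurable := (Q.D_measurable.indicator Q.countable_jumps.measurableSet.compl).comp
    Q.isClock.measurable_clock
  a_nonneg s := indicator_nonneg (fun _ _ => Q.D_nonneg _) _
  a_le_one s := indicator_apply_le' (fun _ => Q.D_le_one _) fun _ => zero_le_one
  integral_a := by
    rw [← Q.isClock.clock_eq_integral Q.D_measurable Q.D_nonneg Q.D_le_one Q.volume_eq
      Q.countable_jumps ⟨Q.isClock.total_pos.le, le_rfl⟩, Q.isClock.clock_total]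
  w := Q.control
  w_measurable := Q.measurable_control
  w_mem := Q.control_mem
  norm1_w_le := Q.norm1_control_le

theorem time_eq {s : ℝ} (hs : s ∈ Icc 0 (Q.p.real univ)) : Q.unfolded.time s = clock Q.p s :=
  (Q.isClock.clock_eq_integral Q.D_measurable Q.D_nonneg Q.D_le_one Q.volume_eq
      Q.countable_jumps hs).symm

theorem clock_eq_of_mem {r : ℝ} (hr : r ∈ Icc 0 S.h) {s : ℝ}
    (hs : s ∈ Ioo (cumulLeft Q.p r) (cumulLeft Q.p r + Q.p.real {r})) :
    s ∈ Icc 0 (Q.p.real univ) ∧ clock Q.p s = r ∧ r ∈ Q.jumps := by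
  have := Q.isClock.finite
  have h1 : Q.p.real {r} ≠ 0 := fun h => by
    rw [h, add_zero] at hs; exact absurd (hs.1.trans hs.2) (lt_irrefl _)
  rw [cumulLeft_add_atom] at hs
  have h2 : s ∈ Icc 0 (Q.p.real univ) :=
    ⟨(cumulLeft_nonneg r).trans hs.1.le, hs.2.le.trans (Q.isClock.cumul_mem r).2⟩
  exact ⟨h2, (Q.isClock.clock_eq_iff h2 hr).2 ⟨hs.1.le, hs.2.le⟩, Or.inl h1⟩

theorem control_of_mem {r : ℝ} (hr : r ∈ Icc 0 S.h) (l : ℤ) {s : ℝ}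
    (hs : s ∈ Ioo (cumulLeft Q.p r) (cumulLeft Q.p r + Q.p.real {r})) :
    Q.control l s = (Q.p.real {r})⁻¹ • Q.ω' l r ((s - cumulLeft Q.p r) / Q.p.real {r}) := by
  obtain ⟨-, h1, h2⟩ := Q.clock_eq_of_mem hr hs
  rw [control, glue_of_mem (by rwa [h1]), h1]

/-- Needed at 0 and h, which are always counted as jumps although they may carry no mass. -/
theorem ω'_eq_zero {r : ℝ} (hr : r ∈ Icc 0 S.h) (h : Q.p.real {r} = 0) (l : ℤ) (s : ℝ) :
    Q.ω' l r s = 0 := by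
  have h1 := Q.norm1_ω'_le l r s
  rw [← Q.atom r hr, h] at h1
  exact norm1_eq_zero.1 (le_antisymm h1 (norm1_nonneg _))

theorem ae_ω' {r : ℝ} (hr : r ∈ Icc 0 S.h) {l : ℤ} (hl : 0 ≤ l) {τ : ℝ} (hτ : τ ∈ Icc (0 : ℝ) 1) :
    ∀ᵐ s ∂volume, s ∈ Ioc 0 τ → Q.ω' l r s = ω l r s := by
  have := (ae_restrict_iff' measurableSet_Icc).1 (Q.ω'_ae l r hl hr)
  filter_upwards [this] with s hs hs'
  exact hs ⟨hs'.1.le, hs'.2.trans hτ.2⟩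

/-- The integral over a jump of a positively homogeneous function of the control. -/
theorem integral_jump {q : (Fin m → ℝ) → ℝ} (hq : ∀ c : ℝ, 0 ≤ c → ∀ w, q (c • w) = c * q w)
    {r : ℝ} (hr : r ∈ Icc 0 S.h) {l : ℤ} (hl : 0 ≤ l) {τ : ℝ} (hτ : τ ∈ Icc (0 : ℝ) 1) :
    ∫ s in cumulLeft Q.p r..(cumulLeft Q.p r + τ * Q.p.real {r}), q (Q.control l s) =
      ∫ s in (0 : ℝ)..τ, q (ω l r s) := by
  have h0 : q 0 = 0 := by simpa using hq 0 le_rfl 0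
  rw [integral_rescale (G := fun s => q (Q.ω' l r s)) measureReal_nonneg (fun s hs => ?_) hτ
    fun h => ?_]
  · refine intervalIntegral.integral_congr_ae ?_
    rw [uIoc_of_le hτ.1]
    filter_upwards [Q.ae_ω' hr hl hτ] with s hs hs'
    rw [hs hs']
  · rw [Q.control_of_mem hr l hs, hq _ (inv_nonneg.2 measureReal_nonneg), smul_eq_mul]
  · simp [Q.ω'_eq_zero hr h, h0]

/-- The integral away from the jumps of a positively homogeneous function of the control. -/
theorem integral_cont {E : Type*} [NormedAddCommGroup E] [NormedSpace ℝ E]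
    {q : (Fin m → ℝ) → ℝ} (hq : ∀ c : ℝ, 0 ≤ c → ∀ w, q (c • w) = c * q w) (hqm : Measurable q)
    {i : ℕ} (hi : i < S.N) {B : Set ℝ} (hB : MeasurableSet B) (hBC : Disjoint B Q.jumps)
    {H : ℝ → E} (hH : AEStronglyMeasurable (fun r => H (r + i * S.h)) (Q.p.restrict B)) :
    ∫ s in Icc 0 (Q.p.real univ) ∩ clock Q.p ⁻¹' B,
        q (Q.control (i + 1) s) • H (clock Q.p s + i * S.h) =
      ∫ t in (fun r => r + i * S.h) '' (B ∩ Ioo 0 S.h), q (Q.k t) • H t ∂(contPart ν) := by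
  have hm := Q.isClock.measurable_clock
  rw [← setIntegral_block hB fun t => q (Q.k t) • H t]
  rw [← Q.isClock.setIntegral_clock (Q.ρ_measurable (i + 1)) (Q.ρ_nonneg (i + 1)) (Q.block_eq i hi) hB]
  · refine setIntegral_congr_fun (measurableSet_Icc.inter (hm hB)) fun s hs => ?_
    have h1 : clock Q.p s ∉ Q.jumps := Set.disjoint_left.1 hBC hs.2
    simp only [control, glue_of_notMem h1, hq _ (Q.ρ_nonneg _ _), smul_smul]
    push_cast
    rw [add_sub_cancel_right]
  · exact (hqm.comp (Q.k_measurable.comp (measurable_add_const _))).aestronglyMeasurable.smul hH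

end ClockData

end ImpulseDelay

end

/-! ### Transport of measures from unfolded time -/

noncomputable section

namespace ImpulseDelay

namespace DelaySystem

variable {S : DelaySystem n m}

theorem exists_block {t : ℝ} (ht : t ∈ Ico 0 S.T) :
    ∃ i : ℕ, i < S.N ∧ ∃ r ∈ Ico 0 S.h, t = r + i * S.h := by
  have hh := S.h_pos
  have h0 : 0 ≤ t / S.h := div_nonneg ht.1 hh.le
  have h1 := Nat.floor_le h0
  have h2 := Nat.lt_floor_add_one (t / S.h)
  rw [le_div_iff₀ hh] at h1
  rw [div_lt_iff₀ hh] at h2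
  refine ⟨⌊t / S.h⌋₊, ?_, t - ⌊t / S.h⌋₊ * S.h, ⟨by linarith, by linarith⟩, by ring⟩
  rw [Nat.floor_lt h0, div_lt_iff₀ hh]
  exact ht.2

theorem add_block_mem {i : ℕ} (hi : i < S.N) {r : ℝ} (hr : r ∈ Icc 0 S.h) :
    r + i * S.h ∈ Icc 0 S.T := by
  have h1 : (i : ℝ) + 1 ≤ S.N := by exact_mod_cast hi
  have h2 := S.h_pos
  have h3 := hr.1
  have h4 : (0 : ℝ) ≤ i * S.h := by positivity
  refine ⟨by linarith, ?_⟩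
  rw [T]
  nlinarith [hr.2]

theorem add_block_inj {i i' : ℕ} {r r' : ℝ} (hr : r ∈ Icc 0 S.h) (hr' : r' ∈ Ioo 0 S.h)
    (h : r + i * S.h = r' + i' * S.h) : i = i' := by
  have h2 := S.h_pos
  rcases lt_trichotomy i i' with h3 | h3 | h3
  · have : (i : ℝ) + 1 ≤ i' := by exact_mod_cast h3
    nlinarith [hr.2, hr'.1]
  · exact h3
  · have : (i' : ℝ) + 1 ≤ i := by exact_mod_cast h3
    nlinarith [hr.1, hr'.2]

end DelaySystem

namespace UnfoldedControl

variable {S : DelaySystem n m} (R : UnfoldedControl S)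

theorem intervalIntegrable_a (s t : ℝ) : IntervalIntegrable R.a volume s t :=
  intervalIntegrable_of_bounded (C := 1) R.a_measurable.aestronglyMeasurable
    (fun s => by rw [Real.norm_of_nonneg (R.a_nonneg s)]; exact R.a_le_one s) s t

theorem continuous_time : Continuous R.time :=
  intervalIntegral.continuous_primitive R.intervalIntegrable_a 0

theorem time_zero : R.time 0 = 0 := intervalIntegral.integral_same

theorem time_L : R.time R.L = S.h := R.integral_a

theorem time_mono : Monotone R.time := fun s t hst => by
  have h1 := intervalIntegral.integral_add_adjacent_intervals (R.intervalIntegrable_a 0 s)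
    (R.intervalIntegrable_a s t)
  have h2 := intervalIntegral.integral_nonneg (μ := volume) hst fun u _ => R.a_nonneg u
  rw [time, time, ← h1]
  linarith

theorem time_mem {s : ℝ} (hs : s ∈ Icc 0 R.L) : R.time s ∈ Icc 0 S.h :=
  ⟨R.time_zero ▸ R.time_mono hs.1, R.time_L ▸ R.time_mono hs.2⟩

/-- The measure on `[0,T]` transported by the clock from the densities `G (i+1)` on the blocks. -/
def push (G : ℤ → ℝ → ℝ) : SignedMeasure ℝ :=
  ∑ i ∈ Finset.range S.N, ((volume.restrict (Icc 0 R.L)).withDensityᵥ (G (i + 1))).map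
    fun s => R.time s + i * S.h

theorem push_apply {G : ℤ → ℝ → ℝ} (hG : ∀ i : ℕ, i < S.N → IntegrableOn (G (i + 1)) (Icc 0 R.L))
    {B : Set ℝ} (hB : MeasurableSet B) : R.push G B =
      ∑ i ∈ Finset.range S.N,
        ∫ s in Icc 0 R.L ∩ R.time ⁻¹' {r | r + i * S.h ∈ B}, G (i + 1) s := by
  rw [push, FunLike.coe_sum, Finset.sum_apply]
  refine Finset.sum_congr rfl fun i hi => ?_
  have hm : Measurable fun s => R.time s + i * S.h := R.continuous_time.measurable.add_const _
  rw [VectorMeasure.map_apply _ hm hB,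
    withDensityᵥ_apply (hG i (Finset.mem_range.1 hi)) (hm hB), Measure.restrict_restrict (hm hB),
    inter_comm]
  rfl

theorem supportedOn_push {G : ℤ → ℝ → ℝ}
    (hG : ∀ i : ℕ, i < S.N → IntegrableOn (G (i + 1)) (Icc 0 R.L)) : SupportedOn S.T (R.push G) := by
  rw [supportedOn_iff]
  intro B hB hd
  rw [R.push_apply hG hB]
  refine Finset.sum_eq_zero fun i hi => ?_
  rw [show Icc 0 R.L ∩ R.time ⁻¹' {r | r + i * S.h ∈ B} = ∅ from ?_, setIntegral_empty]
  refine eq_empty_of_forall_notMem fun s hs => ?_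
  exact Set.disjoint_left.1 hd hs.2 (S.add_block_mem (Finset.mem_range.1 hi) (R.time_mem hs.1))

end UnfoldedControl

namespace ClockData

variable {S : DelaySystem n m} {μ : Fin m → SignedMeasure ℝ} {ν : Measure ℝ}
  {ω : ℤ → ℝ → ℝ → Fin m → ℝ} (Q : ClockData S μ ν ω)

theorem jumps_subset : Q.jumps ⊆ Icc 0 S.h := by
  rintro r (hr | rfl | rfl)
  · by_contra h
    refine hr ?_
    rw [measureReal_def, measure_mono_null (singleton_subset_iff.2 h) Q.isClock.supp,
      ENNReal.toReal_zero]
  · exact ⟨le_rfl, S.h_pos.le⟩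
  · exact ⟨S.h_pos.le, le_rfl⟩

theorem preimage_time (A : Set ℝ) :
    Icc 0 Q.unfolded.L ∩ Q.unfolded.time ⁻¹' A = Icc 0 (Q.p.real univ) ∩ clock Q.p ⁻¹' A := by
  ext s
  refine and_congr_right fun hs => ?_
  rw [mem_preimage, Q.time_eq hs, mem_preimage]

theorem setIntegral_jump {q : (Fin m → ℝ) → ℝ} (hq : ∀ c : ℝ, 0 ≤ c → ∀ w, q (c • w) = c * q w)
    {r : ℝ} (hr : r ∈ Icc 0 S.h) {l : ℤ} (hl : 0 ≤ l) :
    ∫ s in Icc 0 (Q.p.real univ) ∩ clock Q.p ⁻¹' {r}, q (Q.control l s) =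
      ∫ s in (0 : ℝ)..1, q (ω l r s) := by
  have := Q.isClock.finite
  rw [← Q.integral_jump hq hr hl ⟨zero_le_one, le_rfl⟩, one_mul, cumulLeft_add_atom,
    Q.isClock.clock_preimage hr, intervalIntegral.integral_of_le (cumulLeft_le_cumul r),
    integral_Icc_eq_integral_Ioc]

/-- Identification of a measure transported from unfolded time. -/
theorem eq_push {s : SignedMeasure ℝ} {q : (Fin m → ℝ) → ℝ}
    (hν : IsFiniteMeasure ν) (hνs : ν (Icc 0 S.T)ᶜ = 0)
    (hω0 : ∀ r, ω 0 r = 0) (hωN : ∀ r, ω (S.N + 1) r = 0)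
    (hq : ∀ c : ℝ, 0 ≤ c → ∀ w, q (c • w) = c * q w) (hqm : Measurable q)
    (hq1 : ∀ w, |q w| ≤ norm1 w)
    (hsupp : ∀ B, MeasurableSet B → Disjoint B (Icc 0 S.T) → s B = 0)
    (hatom : ∀ r ∈ Ioo 0 S.h, ∀ i : ℕ, i < S.N →
      s {r + i * S.h} = ∫ τ in (0 : ℝ)..1, q (ω (i + 1) r τ))
    (hnode : ∀ i : ℕ, i ≤ S.N → s {i * S.h} =
      (∫ τ in (0 : ℝ)..1, q (ω i S.h τ)) + ∫ τ in (0 : ℝ)..1, q (ω (i + 1) 0 τ))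
    (hcont : ∀ B, MeasurableSet B → (∀ t ∈ B, s {t} = 0) → s B = ∫ t in B, q (Q.k t) ∂(contPart ν)) :
    s = Q.unfolded.push fun l t => q (Q.control l t) := by
  have hh := S.h_pos
  have hp := Q.isClock
  have := hp.finite
  have hq0 : q 0 = 0 := by simpa using hq 0 le_rfl 0
  have hGi : ∀ l : ℤ, IntegrableOn (fun t => q (Q.control l t)) (Icc 0 Q.unfolded.L) := fun l =>
    Measure.integrableOn_of_bounded (M := 1) (by simp)
      (hqm.comp (Q.measurable_control l)).aestronglyMeasurable
      (ae_of_all _ fun t => (hq1 _).trans (Q.norm1_control_le l t))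
  -- All jump times of all blocks; since 0 and h count as jumps, this includes every node. The two
  -- measures are compared point by point here and by densities elsewhere.
  set Cs : Set ℝ := ⋃ i ∈ Finset.range S.N, (fun r => r + i * S.h) '' Q.jumps with hCs
  have hCsc : Cs.Countable := (Finset.range S.N).countable_toSet.biUnion fun i _ =>
    Q.countable_jumps.image _
  have hmemCs : ∀ i : ℕ, i < S.N → ∀ r ∈ Q.jumps, r + i * S.h ∈ Cs := fun i hi r hr =>
    mem_biUnion (Finset.mem_coe.2 (Finset.mem_range.2 hi)) ⟨r, hr, rfl⟩
  have hj0 : (0 : ℝ) ∈ Q.jumps := Or.inr (Or.inl rfl)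
  have hjh : S.h ∈ Q.jumps := Or.inr (Or.inr rfl)
  have hpush := fun B (hB : MeasurableSet B) => Q.unfolded.push_apply
    (G := fun l t => q (Q.control l t)) (fun i _ => hGi (i + 1)) hB
  simp only [Q.preimage_time] at hpush
  have hclk := fun s => hp.clock_mem s
  have hNodeCs : ∀ t ∈ Icc 0 S.T, t ∉ Cs → ∃ i : ℕ, i < S.N ∧ ∃ r ∈ Ioo 0 S.h, r ∉ Q.jumps ∧
      t = r + i * S.h := by
    intro t ht htC
    rcases ht.2.eq_or_lt with h1 | h1
    · refine absurd ?_ htC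
      have h2 : ((S.N - 1 : ℕ) : ℝ) = S.N - 1 := by rw [Nat.cast_sub S.one_le_N, Nat.cast_one]
      have h3 := hmemCs (S.N - 1) (by have := S.one_le_N; omega) S.h hjh
      rwa [h2, show S.h + ((S.N : ℝ) - 1) * S.h = t by rw [h1, DelaySystem.T]; ring] at h3
    · obtain ⟨i, hi, r, hr, rfl⟩ := S.exists_block ⟨ht.1, h1⟩
      have hrj : r ∉ Q.jumps := fun h => htC (hmemCs i hi r h)
      exact ⟨i, hi, r, ⟨hr.1.lt_of_ne fun h => hrj (h ▸ hj0), hr.2⟩, hrj, rfl⟩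
  refine signedMeasure_ext_countable hCsc ?_ ?_
  · intro t ht
    simp only [hCs, mem_iUnion, Finset.mem_range] at ht
    obtain ⟨i, hi, r, hr, rfl⟩ := ht
    have hrI := Q.jumps_subset hr
    rw [hpush _ (measurableSet_singleton _)]
    beta_reduce
    have key : ∀ j : ℕ, j ≤ S.N → s {j * S.h} = ∑ i ∈ Finset.range S.N,
        ∫ u in Icc 0 (Q.p.real univ) ∩ clock Q.p ⁻¹' {r | r + i * S.h ∈ ({j * S.h} : Set ℝ)},
          q (Q.control (i + 1) u) := by
      intro j hj
      rw [hnode j hj]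
      -- A node jh is seen by two blocks: as the right end r = h of the one with i+1 = j and as the
      -- left end r = 0 of the one with i = j.
      have e1 : ∀ i ∈ Finset.range S.N,
          ∫ u in Icc 0 (Q.p.real univ) ∩ clock Q.p ⁻¹' {r | r + i * S.h ∈ ({j * S.h} : Set ℝ)},
            q (Q.control (i + 1) u) =
          (if i + 1 = j then ∫ τ in (0 : ℝ)..1, q (ω j S.h τ) else 0) +
            (if i = j then ∫ τ in (0 : ℝ)..1, q (ω (j + 1) 0 τ) else 0) := by
        intro i hi
        by_cases h1 : i = j
        · subst h1
          rw [if_neg (by omega), if_pos rfl, zero_add,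
            ← Q.setIntegral_jump hq ⟨le_rfl, hh.le⟩ (by omega)]
          congr 3
          ext r; simp
        by_cases h2 : i + 1 = j
        · subst h2
          rw [if_pos rfl, if_neg h1, add_zero,
            ← Q.setIntegral_jump hq ⟨hh.le, le_rfl⟩ (by omega)]
          push_cast
          congr 4
          ext r
          change r + i * S.h = (i + 1) * S.h ↔ r = S.h
          constructor <;> intro h <;> linarith
        rw [if_neg h1, if_neg h2, add_zero, show Icc 0 (Q.p.real univ) ∩
          clock Q.p ⁻¹' {r | r + i * S.h ∈ ({j * S.h} : Set ℝ)} = ∅ from ?_, setIntegral_empty]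
        refine eq_empty_of_forall_notMem fun u hu => ?_
        have h3 : clock Q.p u + i * S.h = j * S.h := hu.2
        have h4 := hclk u
        rcases lt_or_gt_of_ne h1 with h5 | h5
        · have : (i : ℝ) + 2 ≤ j := by exact_mod_cast (show i + 2 ≤ j by omega)
          nlinarith [h4.2]
        · have : (j : ℝ) + 1 ≤ i := by exact_mod_cast h5
          nlinarith [h4.1]
      rw [Finset.sum_congr rfl e1, Finset.sum_add_distrib]
      congr 1
      -- The first node has no preceding block and the last has no following one; the conventions ω₀
      -- = 0 and ω_{N+1} = 0 compensate.
      · rcases Nat.eq_zero_or_pos j with h1 | h1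
        · subst h1
          simp [hω0, hq0]
        · rw [Finset.sum_eq_single (j - 1)]
          · rw [if_pos (by omega)]
          · intro b _ hb
            rw [if_neg (by omega)]
          · intro h; exact absurd (Finset.mem_range.2 (by omega)) h
      · rw [Finset.sum_ite_eq']
        split_ifs with h1
        · rfl
        · obtain rfl : j = S.N := by
            rw [Finset.mem_range] at h1; omega
          simp [hωN, hq0]
    rcases hrI.1.eq_or_lt with h1 | h1
    · have := key i hi.le
      rw [← h1, zero_add]
      exact this
    rcases hrI.2.eq_or_lt with h2 | h2
    · have := key (i + 1) hi
      push_cast at this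
      rw [h2, show S.h + i * S.h = ((i : ℝ) + 1) * S.h by ring]
      exact this
    rw [hatom r ⟨h1, h2⟩ i hi, Finset.sum_eq_single i]
    · rw [← Q.setIntegral_jump hq hrI (by omega)]
      congr 3
      ext u; simp
    · intro b _ hb
      rw [show Icc 0 (Q.p.real univ) ∩
          clock Q.p ⁻¹' {u | u + b * S.h ∈ ({r + i * S.h} : Set ℝ)} = ∅ from ?_, setIntegral_empty]
      refine eq_empty_of_forall_notMem fun u hu => ?_
      exact hb (S.add_block_inj (hclk u) ⟨h1, h2⟩ hu.2)
    · intro h; exact absurd (Finset.mem_range.2 hi) h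
  · intro B hB hd
    have hBC : ∀ i : ℕ, i < S.N → Disjoint {r | r + i * S.h ∈ B} Q.jumps := fun i hi =>
      Set.disjoint_left.2 fun r hr hr' => Set.disjoint_left.1 hd hr (hmemCs i hi r hr')
    have hBm : ∀ i : ℕ, MeasurableSet {r | r + i * S.h ∈ B} := fun i =>
      (measurable_add_const ((i : ℝ) * S.h)) hB
    rw [hcont B hB fun t ht => ?_, hpush B hB]
    · have e1 : ∀ i ∈ Finset.range S.N,
          ∫ u in Icc 0 (Q.p.real univ) ∩ clock Q.p ⁻¹' {r | r + i * S.h ∈ B},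
            q (Q.control (i + 1) u) =
          ∫ t in (fun r => r + i * S.h) '' ({r | r + i * S.h ∈ B} ∩ Ioo 0 S.h),
            q (Q.k t) ∂(contPart ν) := by
        intro i hi
        have := Q.integral_cont (E := ℝ) hq hqm (Finset.mem_range.1 hi) (hBm i)
          (hBC i (Finset.mem_range.1 hi)) (H := fun _ => 1) aestronglyMeasurable_const
        simpa only [smul_eq_mul, mul_one] using this
      have himg : ∀ i : ℕ, (fun r => r + i * S.h) '' ({r | r + i * S.h ∈ B} ∩ Ioo 0 S.h) =
          B ∩ (fun t => t - i * S.h) ⁻¹' Ioo 0 S.h := by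
        intro i
        ext t
        constructor
        · rintro ⟨r, ⟨h1, h2⟩, rfl⟩
          exact ⟨h1, by simpa using h2⟩
        · rintro ⟨h1, h2⟩
          exact ⟨t - i * S.h, ⟨by simpa using h1, h2⟩, by ring⟩
      have hfin : IsFiniteMeasure (contPart ν) := by unfold contPart; infer_instance
      have hki : Integrable (fun t => q (Q.k t)) (contPart ν) :=
        Integrable.of_bound (hqm.comp Q.k_measurable).aestronglyMeasurable 1
          (ae_of_all _ fun t => (hq1 _).trans (Q.norm1_k_le t))
      rw [Finset.sum_congr rfl e1, ← integral_biUnion_finset]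
      -- A set avoiding all jumps is, up to a null set outside [0,T], the disjoint union of its
      -- traces on the open blocks.
      · refine setIntegral_congr_set ?_
        have h0 : contPart ν (Icc 0 S.T)ᶜ = 0 :=
          le_antisymm ((Measure.restrict_le_self _).trans hνs.le) zero_le
        have h1 : ∀ᵐ t ∂(contPart ν), t ∈ Icc 0 S.T := h0
        filter_upwards [h1] with t ht
        refine propext ⟨fun htB => ?_, fun h => ?_⟩
        · obtain ⟨i, hi, r, hr, -, rfl⟩ := hNodeCs t ht (Set.disjoint_left.1 hd htB)
          exact mem_biUnion (Finset.mem_coe.2 (Finset.mem_range.2 hi)) ⟨r, ⟨htB, hr⟩, rfl⟩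
        · obtain ⟨i, -, r, hr, rfl⟩ := mem_iUnion₂.1 h
          exact hr.1
      · intro i _
        rw [himg]
        exact hB.inter ((measurable_sub_const _) measurableSet_Ioo)
      · intro i _ i' _ hii
        refine Set.disjoint_left.2 ?_
        rintro _ ⟨r, ⟨-, h1⟩, rfl⟩ ⟨r', ⟨-, h2⟩, h3⟩
        exact hii (S.add_block_inj (Ioo_subset_Icc_self h1) h2 h3.symm)
      · exact fun i _ => hki.integrableOn
    · by_cases h1 : t ∈ Icc 0 S.T
      · obtain ⟨i, hi, r, hr, hrj, rfl⟩ := hNodeCs t h1 (Set.disjoint_left.1 hd ht)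
        have h2 : Q.p.real {r} = 0 := by
          by_contra h3
          exact hrj (Or.inl h3)
        rw [hatom r hr i hi, ← Q.integral_jump hq (Ioo_subset_Icc_self hr) (by omega)
          ⟨zero_le_one, le_rfl⟩, h2, mul_zero, add_zero, intervalIntegral.integral_same]
      · exact hsupp _ (measurableSet_singleton t) (Set.disjoint_singleton_left.2 h1)

end ClockData

namespace IsImpulseControl

variable {S : DelaySystem n m} {μ : Fin m → SignedMeasure ℝ} {ν : Measure ℝ}
  {ω : ℤ → ℝ → ℝ → Fin m → ℝ} (hc : IsImpulseControl S μ ν ω) (Q : ClockData S μ ν ω)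
include hc

theorem ω_zero (r : ℝ) : ω 0 r = 0 := by
  funext s
  exact_mod_cast hc.eq_zero 0 r s (Or.inl zero_lt_one)

theorem ω_succ (r : ℝ) : ω (S.N + 1) r = 0 := by
  funext s
  exact_mod_cast hc.eq_zero (S.N + 1) r s (Or.inr (Nat.lt_succ_self _))

theorem intervalIntegrable_ω {i : ℕ} (hi : i ≤ S.N + 1) {r : ℝ} (hr : r ∈ Icc 0 S.h) (a b : ℝ)
    (ha : a ∈ Icc (0 : ℝ) 1) (hb : b ∈ Icc (0 : ℝ) 1) :
    IntervalIntegrable (ω i r) volume a b := by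
  have h0 : IntegrableOn (ω i r) (Icc 0 1) := by
    rcases Nat.eq_zero_or_pos i with h | h
    · subst h
      rw [Nat.cast_zero, hc.ω_zero]; exact integrableOn_zero
    · rcases hi.eq_or_lt with h1 | h1
      · subst h1
        push_cast
        rw [hc.ω_succ]; exact integrableOn_zero
      · exact (hc.memLp i r h (by omega) hr).integrable le_top
  rw [intervalIntegrable_iff]
  exact h0.mono_set (uIoc_subset_uIcc.trans (uIcc_subset_Icc ha hb))

/-- `eq_push` for the coordinate functional: atoms are integrals of the attached controls, and the
rest has density k j with respect to the continuous part of ν. -/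
theorem μ_eq_push (j : Fin m) : μ j = Q.unfolded.push fun l s => Q.control l s j := by
  have hfin := hc.isFiniteMeasure
  have h01 : (0 : ℝ) ∈ Icc (0 : ℝ) 1 := by simp
  have h11 : (1 : ℝ) ∈ Icc (0 : ℝ) 1 := by simp
  have hh := S.h_pos
  have hI : ∀ i : ℕ, i ≤ S.N + 1 → ∀ r ∈ Icc 0 S.h,
      IntervalIntegrable (fun s => ω i r s j) volume 0 1 := by
    intro i hi r hr
    have := hc.intervalIntegrable_ω hi hr 0 1 h01 h11
    exact ⟨this.1.eval j, this.2.eval j⟩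
  refine Q.eq_push (q := fun w => w j) hfin hc.variation.2.1 hc.ω_zero hc.ω_succ
    (fun c _ w => rfl) (measurable_pi_apply j) (fun w => abs_le_norm1 w j)
    (supportedOn_iff.1 (hc.ranges.1 j)) ?_ ?_ ?_
  · intro r hr i hi
    rw [hc.atom r hr (i + 1) (by omega) (by omega) j]
    push_cast
    rw [add_sub_cancel_right]
  · intro i hi
    have := hc.atom_node i (by omega) (by omega) j
    rw [intervalIntegral.integral_add (hI i (by omega) _ ⟨hh.le, le_rfl⟩)
      (by exact_mod_cast hI (i + 1) (by omega) _ ⟨le_rfl, hh.le⟩)] at this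
    rw [this]
    push_cast; rfl
  · intro B hB h0
    have h1 : contPartSigned (μ j) B = μ j B := by
      have hms : MeasurableSet {t | μ j {t} = 0} := by
        have h2 : {t | μ j {t} = 0}ᶜ.Countable := by
          refine (countable_atoms (μ j).totalVariation).mono fun t ht => ?_
          intro h
          exact ht (SignedMeasure.null_of_totalVariation_zero _ h)
        simpa using h2.measurableSet.compl
      rw [contPartSigned, VectorMeasure.restrict_apply _ hms hB]
      congr 1
      exact inter_eq_left.2 h0
    have hcf : IsFiniteMeasure (contPart ν) := by unfold contPart; infer_instance
    rw [← h1, Q.contPartSigned_eq j, withDensityᵥ_apply _ hB]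
    exact Integrable.of_bound ((measurable_pi_apply j).comp Q.k_measurable).aestronglyMeasurable 1
          (ae_of_all _ fun t => (abs_le_norm1 _ j).trans (Q.norm1_k_le t))

/-- `eq_push` for the norm; the continuous part is recovered because the polar density k has norm 1
almost everywhere for that part. -/
theorem ν_eq_push : ∀ [IsFiniteMeasure ν],
    ν.toSignedMeasure = Q.unfolded.push fun l s => norm1 (Q.control l s) := by
  intro hfin
  have h01 : (0 : ℝ) ∈ Icc (0 : ℝ) 1 := by simp
  have h11 : (1 : ℝ) ∈ Icc (0 : ℝ) 1 := by simp
  have hh := S.h_pos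
  have hI : ∀ i : ℕ, i ≤ S.N + 1 → ∀ r ∈ Icc 0 S.h,
      IntervalIntegrable (fun s => norm1 (ω i r s)) volume 0 1 := by
    intro i hi r hr
    have := hc.intervalIntegrable_ω hi hr 0 1 h01 h11
    unfold norm1
    have h1 : ∀ j, IntervalIntegrable (fun s => |ω i r s j|) volume 0 1 := fun j =>
      ⟨(this.1.eval j).abs, (this.2.eval j).abs⟩
    rw [intervalIntegrable_iff]
    exact integrable_finsetSum _ fun j _ => (intervalIntegrable_iff.1 (h1 j))
  refine Q.eq_push (q := norm1) hfin hc.variation.2.1 hc.ω_zero hc.ω_succ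
    (fun c hc w => by rw [norm1_smul, abs_of_nonneg hc]) ImpulseDelay.measurable_norm1
    (fun w => (abs_of_nonneg (norm1_nonneg w)).le) ?_ ?_ ?_ ?_
  · intro B hB hd
    rw [Measure.toSignedMeasure_apply_measurable hB, measureReal_def,
      measure_mono_null hd.subset_compl_right hc.variation.2.1, ENNReal.toReal_zero]
  · intro r hr i hi
    rw [Measure.toSignedMeasure_apply_measurable (measurableSet_singleton _),
      hc.atom_variation r hr (i + 1) (by omega) (by omega)]
    push_cast
    rw [add_sub_cancel_right]
  · intro i hi
    have := hc.atom_variation_node i (by omega) (by omega)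
    rw [intervalIntegral.integral_add (hI i (by omega) _ ⟨hh.le, le_rfl⟩)
      (by exact_mod_cast hI (i + 1) (by omega) _ ⟨le_rfl, hh.le⟩)] at this
    rw [this, Measure.toSignedMeasure_apply_measurable (measurableSet_singleton _)]
    push_cast; rfl
  · intro B hB h0
    rw [Measure.toSignedMeasure_apply_measurable hB]
    have h1 : ∀ t ∈ B, ν {t} = 0 := fun t ht => by
      have := h0 t ht
      rw [Measure.toSignedMeasure_apply_measurable (measurableSet_singleton _), measureReal_def,
        ENNReal.toReal_eq_zero_iff] at this
      exact this.resolve_right (measure_ne_top _ _)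
    have h2 : contPart ν B = ν B := by
      rw [contPart, Measure.restrict_apply hB, inter_eq_left.2 (show B ⊆ {t | ν {t} = 0} from h1)]
    have h3 : ∫ t in B, norm1 (Q.k t) ∂(contPart ν) = ∫ t in B, 1 ∂(contPart ν) :=
      integral_congr_ae (ae_restrict_of_ae Q.norm1_k_ae)
    rw [h3, setIntegral_const, smul_eq_mul, mul_one, measureReal_def, measureReal_def, h2]

end IsImpulseControl

end ImpulseDelay

end

/-! ### The stack of blocks in unfolded time -/

noncomputable section

namespace ImpulseDelay

theorem nullSingletonClass_contPart (ν : Measure ℝ) [IsFiniteMeasure ν] :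
    NullSingletonClass (contPart ν) := ⟨contPart_singleton ν⟩

/-- Extension by constants of a function from an interval. -/
def clampTo {E : Type*} (a b : ℝ) (y : ℝ → E) (t : ℝ) : E := y (max a (min b t))

theorem clampTo_of_mem {E : Type*} {a b : ℝ} {y : ℝ → E} {t : ℝ} (ht : t ∈ Icc a b) :
    clampTo a b y t = y t := by rw [clampTo, min_eq_right ht.2, max_eq_right ht.1]

theorem continuous_clampTo {E : Type*} [TopologicalSpace E] {a b : ℝ} (hab : a ≤ b) {y : ℝ → E}
    (hy : ContinuousOn y (Icc a b)) : Continuous (clampTo a b y) :=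
  hy.comp_continuous (by fun_prop) fun _ => ⟨le_max_left _ _, max_le hab (min_le_left _ _)⟩

theorem DelaySystem.neg_le_zero (S : DelaySystem n m) : -(S.M * S.h) ≤ 0 :=
  neg_nonpos.2 (mul_nonneg (Nat.cast_nonneg _) S.h_pos.le)

theorem DelaySystem.past_mem (S : DelaySystem n m) {l : ℤ} (hl : l ≤ 0) (hM : 1 - S.M ≤ l) {r : ℝ}
    (hr : r ∈ Icc 0 S.h) : r + (l - 1) * S.h ∈ Icc (-(S.M * S.h)) 0 := by
  have h1 : (1 : ℝ) - S.M ≤ l := by exact_mod_cast hM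
  have h2 : (l : ℝ) ≤ 0 := by exact_mod_cast hl
  have h3 := S.h_pos
  constructor
  · nlinarith [hr.1]
  · nlinarith [hr.2]

theorem DelaySystem.past_mem' (S : DelaySystem n m) {l : ℤ} (hl : l ≤ 0) (hM : 1 - S.M ≤ l) {r : ℝ}
    (hr : r ∈ Ico 0 S.h) : r + (l - 1) * S.h ∈ Ico (-(S.M * S.h)) 0 := by
  refine ⟨(S.past_mem hl hM ⟨hr.1, hr.2.le⟩).1, ?_⟩
  have h2 : (l : ℝ) ≤ 0 := by exact_mod_cast hl
  nlinarith [hr.2, S.h_pos]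

/-- The solution is unconstrained outside [-Mh,T], hence possibly not measurable as a function on ℝ.
It is modified there, using the continuous past and bounded variation on [0,T]. -/
theorem IsImpulseSolution.exists_measurable {S : DelaySystem n m} {μ : Fin m → SignedMeasure ℝ}
    {ν : Measure ℝ} {ω : ℤ → ℝ → ℝ → Fin m → ℝ} {x : ℝ → Fin n → ℝ} {v : ℝ → ℝ}
    (hs : IsImpulseSolution S μ ν ω x v) :
    ∃ x' : ℝ → Fin n → ℝ, Measurable x' ∧ ∀ t ∈ Icc (-(S.M * S.h)) S.T, x' t = x t := by
  classical
  have h1 := measurable_comp_projIcc_of_boundedVariationOn_pi S.T_nonneg hs.x_bv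
  have h2 := (continuous_clampTo S.neg_le_zero S.ξ₀_continuous).measurable
  refine ⟨(Iio 0).piecewise (clampTo (-(S.M * S.h)) 0 S.ξ₀) fun t => x (projIcc 0 S.T S.T_nonneg t),
    h2.piecewise measurableSet_Iio h1, fun t ht => ?_⟩
  by_cases h : t ∈ Iio (0 : ℝ)
  · rw [piecewise_eq_of_mem _ _ _ h, clampTo_of_mem ⟨ht.1, le_of_lt h⟩, hs.x_past t ⟨ht.1, h⟩]
  · rw [piecewise_eq_of_notMem _ _ _ h, projIcc_of_mem _ (show t ∈ Icc 0 S.T from ⟨not_lt.1 h, ht.2⟩)]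

namespace UnfoldedControl

variable {S : DelaySystem n m} (R : UnfoldedControl S)

theorem measurable_field {Y : ℤ → ℝ → Fin n → ℝ} (hY : ∀ l, Measurable (Y l)) (l : ℤ) :
    Measurable (R.field Y l) := by
  have h1 : Measurable fun s => (R.time s + (l - 1) * S.h, fun k : Fin (S.M + 1) => Y (l - (k : ℕ)) s) :=
    (R.continuous_time.measurable.add_const _).prodMk (measurable_pi_lambda _ fun _ => hY _)
  refine (R.a_measurable.smul (S.f_contDiff.continuous.measurable.comp h1)).add ?_
  refine Finset.measurable_fun_sum _ fun j _ => ?_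
  exact ((measurable_pi_apply j).comp (R.w_measurable l)).smul
    ((S.g_contDiff j).continuous.measurable.comp h1)

theorem norm_field_le {C : ℝ} (hC0 : 0 ≤ C) (hf : ∀ p, ‖S.f p‖ ≤ C) (hg : ∀ j p, ‖S.g j p‖ ≤ C)
    (Y : ℤ → ℝ → Fin n → ℝ) (l : ℤ) (s : ℝ) : ‖R.field Y l s‖ ≤ 2 * C := by
  rw [two_mul]
  refine (norm_add_le _ _).trans (add_le_add ?_ ?_)
  · rw [norm_smul, Real.norm_of_nonneg (R.a_nonneg s)]
    exact (mul_le_of_le_one_left (norm_nonneg _) (R.a_le_one s)).trans (hf _)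
  · exact (norm_sum_smul_le _ fun j => hg j _).trans (mul_le_of_le_one_left hC0 (R.norm1_w_le l s))

theorem intervalIntegrable_field {Y : ℤ → ℝ → Fin n → ℝ} (hY : ∀ l, Measurable (Y l)) (l : ℤ)
    (a b : ℝ) : IntervalIntegrable (R.field Y l) volume a b := by
  obtain ⟨C, h0, hf, hg⟩ := S.exists_bound
  exact intervalIntegrable_of_bounded (R.measurable_field hY l).aestronglyMeasurable
    (R.norm_field_le h0 hf hg Y l) a b

theorem integrableOn_field {Y : ℤ → ℝ → Fin n → ℝ} (hY : ∀ l, Measurable (Y l)) (l : ℤ) :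
    IntegrableOn (R.field Y l) (Icc 0 R.L) := by
  rw [integrableOn_Icc_iff_integrableOn_Ioc,
    ← intervalIntegrable_iff_integrableOn_Ioc_of_le R.L_pos.le]
  exact R.intervalIntegrable_field hY l _ _

end UnfoldedControl

namespace ClockData

variable {S : DelaySystem n m} {μ : Fin m → SignedMeasure ℝ} {ν : Measure ℝ}
  {ω : ℤ → ℝ → ℝ → Fin m → ℝ} (Q : ClockData S μ ν ω)

/-- The blocks of a path in unfolded time, the jumps being resolved by the arcs `ζ`. -/
def stack (ζ : ℤ → ℝ → ℝ → Fin n → ℝ) (x' : ℝ → Fin n → ℝ) (l : ℤ) : ℝ → Fin n → ℝ :=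
  if 1 ≤ l ∧ l ≤ S.N then
    glue (clock Q.p) Q.jumps
      (fun r s => clampTo 0 1 (ζ l r) ((s - cumulLeft Q.p r) / Q.p.real {r}))
      fun s => x' (clock Q.p s + (l - 1) * S.h)
  else fun s => if s < Q.p.real univ then
    clampTo (-(S.M * S.h)) 0 S.ξ₀ (clock Q.p s + (l - 1) * S.h) else S.x₀

theorem not_jump {s : ℝ} (h : clock Q.p s ∉ Q.jumps) :
    clock Q.p s ∈ Ioo 0 S.h ∧ s < Q.p.real univ ∧ Q.p.real {clock Q.p s} = 0 := by
  have h1 := Q.isClock.clock_mem s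
  have hh : clock Q.p s ≠ S.h := fun h' => h (Or.inr (Or.inr h'))
  refine ⟨⟨h1.1.lt_of_ne fun h' => h (Or.inr (Or.inl h'.symm)), h1.2.lt_of_ne hh⟩, ?_, ?_⟩
  · by_contra h2
    refine hh (le_antisymm h1.2 ?_)
    rw [← Q.isClock.clock_total]
    exact Q.isClock.clock_mono (not_lt.1 h2)
  · by_contra h2
    exact h (Or.inl h2)

section arcs

variable {x : ℝ → Fin n → ℝ} {v : ℝ → ℝ} {ζ : ℤ → ℝ → ℝ → Fin n → ℝ} {θ : ℤ → ℝ → ℝ → ℝ}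
  (harc : IsJumpArcs S ω x v ζ θ) {x' : ℝ → Fin n → ℝ} (hxm : Measurable x')
  (hx' : ∀ t ∈ Icc (-(S.M * S.h)) S.T, x' t = x t)
include harc hxm

theorem measurable_stack (l : ℤ) : Measurable (Q.stack ζ x' l) := by
  have hm := Q.isClock.measurable_clock
  unfold stack
  split_ifs with h
  · refine measurable_glue hm Q.countable_jumps (fun r hr => ?_) (hxm.comp (hm.add_const _))
    have h1 := harc.ζ_continuous l r h.1 (by omega) (Q.jumps_subset hr) (by omega)
    exact (continuous_clampTo zero_le_one h1).measurable.comp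
      (show Measurable fun s => (s - cumulLeft Q.p r) / Q.p.real {r} by fun_prop)
  · exact ((continuous_clampTo S.neg_le_zero S.ξ₀_continuous).measurable.comp
      (hm.add_const _)).ite measurableSet_Iio measurable_const

omit hxm
-- During a jump all blocks, past ones included, show their arcs at one common parameter. The
-- delayed arguments of the unfolded system therefore coincide with those of the jump equation.
theorem stack_of_mem {l : ℤ} (hM : 1 - S.M ≤ l) (hN : l ≤ S.N) {r : ℝ} (hr : r ∈ Icc 0 S.h)
    {s : ℝ} (hs : s ∈ Ioo (cumulLeft Q.p r) (cumulLeft Q.p r + Q.p.real {r})) :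
    Q.stack ζ x' l s = ζ l r ((s - cumulLeft Q.p r) / Q.p.real {r}) := by
  have := Q.isClock.finite
  obtain ⟨h1, h2, h3⟩ := Q.clock_eq_of_mem hr hs
  have hP : 0 < Q.p.real {r} := by linarith [hs.1, hs.2]
  set τ := (s - cumulLeft Q.p r) / Q.p.real {r} with hτ
  have hτI : τ ∈ Ioo (0 : ℝ) 1 := by
    rw [hτ]
    exact ⟨div_pos (by linarith [hs.1]) hP, by rw [div_lt_one hP]; linarith [hs.2]⟩
  rw [stack]
  split_ifs with h
  · rw [glue_of_mem (by rwa [h2]), h2, clampTo_of_mem (Ioo_subset_Icc_self hτI)]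
  · have hl : l ≤ 0 := by omega
    have hL : s < Q.p.real univ := by
      have h4 := (Q.isClock.cumul_mem r).2
      rw [← cumulLeft_add_atom] at h4
      exact hs.2.trans_le h4
    beta_reduce
    rw [if_pos hL, h2, clampTo_of_mem (S.past_mem hl hM hr)]
    obtain ⟨a, rfl⟩ : ∃ a : ℕ, l = -a := ⟨(-l).toNat, by omega⟩
    rcases Nat.eq_zero_or_pos a with ha | ha
    · subst ha
      -- The parameter is strictly below 1, so the exceptional value `S.x₀` of the arc of block 0 is
      -- not met.
      have := (harc.ζ_zero r hr τ (Ioo_subset_Icc_self hτI)).1 (Or.inl hτI.2)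
      simp only [Nat.cast_zero, neg_zero, Int.cast_zero] at this ⊢
      rw [this]
      congr 1; ring
    · rw [harc.ζ_neg a ha (by omega) r hr τ (Ioo_subset_Icc_self hτI)]
      congr 1; push_cast; ring

omit harc
include hx' in
theorem stack_of_notMem (hpast : ∀ t ∈ Ico (-(S.M * S.h)) 0, x t = S.ξ₀ t) {l : ℤ}
    (hM : 1 - S.M ≤ l) (hN : l ≤ S.N) {s : ℝ} (hs : clock Q.p s ∉ Q.jumps) :
    Q.stack ζ x' l s = x (clock Q.p s + (l - 1) * S.h) := by
  obtain ⟨h1, h2, -⟩ := Q.not_jump hs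
  rw [stack]
  split_ifs with h
  · have h3 := S.block_mem h.1 h.2 (Ioo_subset_Icc_self h1)
    rw [glue_of_notMem hs, hx' _ ⟨S.neg_le_zero.trans h3.1, h3.2⟩]
  · have hl : l ≤ 0 := by omega
    beta_reduce
    rw [if_pos h2, clampTo_of_mem (S.past_mem hl hM (Ioo_subset_Icc_self h1)),
      hpast _ (S.past_mem' hl hM (Ioo_subset_Ico_self h1))]

end arcs

end ClockData

end ImpulseDelay

end

/-! ### The unfolded field on jumps and between jumps -/

noncomputable section

namespace ImpulseDelay

/-- An atomless measure ignores the countably many removed points and the left endpoint, so removing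
the jumps from a block interval costs nothing. -/
theorem image_add_diff_ae_eq {κ : Measure ℝ} [NullSingletonClass κ] {C : Set ℝ} (hC : C.Countable)
    {r h : ℝ} (hr : r < h) (c : ℝ) :
    ((fun u => u + c) '' ((Ioc 0 r \ C) ∩ Ioo 0 h) : Set ℝ) =ᵐ[κ] Icc c (r + c) := by
  have hN : κ ((fun u => u + c) '' (C ∪ {0})) = 0 :=
    ((hC.union (countable_singleton 0)).image _).measure_zero _
  filter_upwards [compl_mem_ae_iff.2 hN] with t ht
  refine propext ⟨?_, fun h1 => ?_⟩
  · rintro ⟨u, ⟨⟨h1, -⟩, -⟩, rfl⟩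
    exact ⟨by linarith [h1.1], by linarith [h1.2]⟩
  · have h2 : t - c ∉ C ∪ {0} := fun h => ht ⟨_, h, by ring⟩
    have h3 : 0 < t - c := by
      refine lt_of_le_of_ne (by linarith [h1.1]) fun h => h2 (Or.inr h.symm)
    exact ⟨t - c, ⟨⟨⟨h3, by linarith [h1.2]⟩, fun h => h2 (Or.inl h)⟩, h3, by linarith [h1.2]⟩,
      by ring⟩

theorem tendsto_of_tendsto_add {E : Type*} [TopologicalSpace E] {x : ℝ → E} {c r : ℝ} {y : E}
    (h : Tendsto (fun r' => x (r' + c)) (𝓝[<] r) (𝓝 y)) : Tendsto x (𝓝[<] (r + c)) (𝓝 y) := by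
  have h1 : Tendsto (fun t => t - c) (𝓝[<] (r + c)) (𝓝[<] r) := by
    refine tendsto_nhdsWithin_iff.2 ⟨?_, ?_⟩
    · have : Tendsto (fun t : ℝ => t - c) (𝓝 (r + c)) (𝓝 (r + c - c)) :=
        (continuous_sub_right c).tendsto _
      rw [add_sub_cancel_right] at this
      exact this.mono_left nhdsWithin_le_nhds
    · filter_upwards [self_mem_nhdsWithin] with t ht
      have : t < r + c := ht
      exact mem_Iio.2 (by linarith)
  have h2 := h.comp h1
  simpa [Function.comp_def] using h2

theorem DelaySystem.delay_mem (S : DelaySystem n m) {t : ℝ} (ht : t ∈ Icc 0 S.T) {k : ℕ} (hk : k ≤ S.M) :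
    t - k * S.h ∈ Icc (-(S.M * S.h)) S.T := by
  have h1 : (k : ℝ) ≤ S.M := by exact_mod_cast hk
  have h2 := S.h_pos
  have h3 : (0 : ℝ) ≤ k * S.h := by positivity
  constructor
  · nlinarith [ht.1]
  · linarith [ht.2]

namespace ClockData

variable {S : DelaySystem n m} {μ : Fin m → SignedMeasure ℝ} {ν : Measure ℝ}
  {ω : ℤ → ℝ → ℝ → Fin m → ℝ} (Q : ClockData S μ ν ω)
  {x : ℝ → Fin n → ℝ} {v : ℝ → ℝ} {ζ : ℤ → ℝ → ℝ → Fin n → ℝ} {θ : ℤ → ℝ → ℝ → ℝ}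

theorem unfolded_a (s : ℝ) : Q.unfolded.a s = Q.jumpsᶜ.indicator Q.D (clock Q.p s) := rfl

theorem unfolded_w : Q.unfolded.w = Q.control := rfl

/-- On a jump the clock is at rest, so the drift drops out and the field is that of the jump
equation divided by the length of the interval. -/
theorem field_of_mem (harc : IsJumpArcs S ω x v ζ θ) {x' : ℝ → Fin n → ℝ} {l : ℤ} (h1 : 1 ≤ l)
    (hN : l ≤ S.N) {r : ℝ} (hr : r ∈ Icc 0 S.h) {s : ℝ}
    (hs : s ∈ Ioo (cumulLeft Q.p r) (cumulLeft Q.p r + Q.p.real {r})) :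
    Q.unfolded.field (Q.stack ζ x') l s = (Q.p.real {r})⁻¹ •
      ∑ j, Q.ω' l r ((s - cumulLeft Q.p r) / Q.p.real {r}) j • S.g j (r + (l - 1) * S.h,
        fun k => ζ (l - (k : ℕ)) r ((s - cumulLeft Q.p r) / Q.p.real {r})) := by
  obtain ⟨h2, h3, h4⟩ := Q.clock_eq_of_mem hr hs
  have h5 : (fun k : Fin (S.M + 1) => Q.stack ζ x' (l - (k : ℕ)) s) =
      fun k : Fin (S.M + 1) => ζ (l - (k : ℕ)) r ((s - cumulLeft Q.p r) / Q.p.real {r}) := by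
    funext k
    have := k.2
    exact Q.stack_of_mem harc (by omega) (by omega) hr hs
  rw [UnfoldedControl.field, h5, Q.time_eq h2, h3, unfolded_a, h3,
    indicator_of_notMem (by simpa using h4), zero_smul, zero_add, Finset.smul_sum]
  refine Finset.sum_congr rfl fun j _ => ?_
  rw [unfolded_w, Q.control_of_mem hr l hs, Pi.smul_apply, smul_eq_mul, mul_smul]

/-- Between jumps the stack consists of values of x itself, so the field is the delay dynamics with
drift weighted by the clock rate. -/
theorem field_of_notMem {x' : ℝ → Fin n → ℝ} (hx' : ∀ t ∈ Icc (-(S.M * S.h)) S.T, x' t = x t)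
    (hpast : ∀ t ∈ Ico (-(S.M * S.h)) 0, x t = S.ξ₀ t) {l : ℤ} (h1 : 1 ≤ l) (hN : l ≤ S.N) {s : ℝ}
    (hs0 : s ∈ Icc 0 (Q.p.real univ)) (hs : clock Q.p s ∉ Q.jumps) :
    Q.unfolded.field (Q.stack ζ x') l s =
      Q.D (clock Q.p s) • S.f (clock Q.p s + (l - 1) * S.h, S.delayed x (clock Q.p s + (l - 1) * S.h)) +
      ∑ j, Q.control l s j • S.g j (clock Q.p s + (l - 1) * S.h,
        S.delayed x (clock Q.p s + (l - 1) * S.h)) := by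
  have h5 : (fun k : Fin (S.M + 1) => Q.stack ζ x' (l - (k : ℕ)) s) =
      S.delayed x (clock Q.p s + (l - 1) * S.h) := by
    funext k
    have := k.2
    rw [Q.stack_of_notMem hx' hpast (by omega) (by omega) hs, DelaySystem.delayed]
    congr 1; push_cast; ring
  rw [UnfoldedControl.field, h5, Q.time_eq hs0, unfolded_a, indicator_of_mem hs, unfolded_w]

section

variable (hc : IsImpulseControl S μ ν ω) (hsol : IsImpulseSolution S μ ν ω x v)
  (harc : IsJumpArcs S ω x v ζ θ) {x' : ℝ → Fin n → ℝ} (hxm : Measurable x')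
  (hx' : ∀ t ∈ Icc (-(S.M * S.h)) S.T, x' t = x t)

include harc in
-- The jump equation, with its parameter interval [0,1] stretched to the fibre of the clock over r.
theorem arc_jump {l : ℤ} (h1 : 1 ≤ l) (hN : l ≤ S.N) {r : ℝ} (hr : r ∈ Icc 0 S.h) {τ : ℝ}
    (hτ : τ ∈ Icc (0 : ℝ) 1) : ζ l r τ = ζ l r 0 +
      ∫ s in cumulLeft Q.p r..(cumulLeft Q.p r + τ * Q.p.real {r}),
        Q.unfolded.field (Q.stack ζ x') l s := by
  rw [harc.ζ_ode l r h1 (by omega) hr (by omega) τ hτ,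
    integral_rescale (G := fun s => ∑ j, Q.ω' l r s j • S.g j (r + (l - 1) * S.h,
      fun k => ζ (l - (k : ℕ)) r s)) measureReal_nonneg
      (fun s hs => Q.field_of_mem harc h1 hN hr hs) hτ
      fun h => by simp [Q.ω'_eq_zero hr h]]
  congr 1
  refine intervalIntegral.integral_congr_ae ?_
  rw [uIoc_of_le hτ.1]
  filter_upwards [Q.ae_ω' hr (by omega : 0 ≤ l) hτ] with s hs hs'
  rw [hs hs']

include hc hxm hx' in
-- The density `Q.D` carries the new time to Lebesgue measure, giving the drift integral; the
-- density ρ carries it to the block of the continuous part of ν, and the factor k turns this into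
-- μᶜ.
theorem integral_field_cont (hpast : ∀ t ∈ Ico (-(S.M * S.h)) 0, x t = S.ξ₀ t)
    {i : ℕ} (hi : i < S.N)
    {r : ℝ} (hr : r ∈ Ioo 0 S.h) :
    ∫ s in Icc 0 (Q.p.real univ) ∩ clock Q.p ⁻¹' (Ioc 0 r \ Q.jumps),
      Q.unfolded.field (Q.stack ζ x') (i + 1) s =
    (∫ t' in (i * S.h)..(r + i * S.h), S.f (t', S.delayed x t')) +
      ∑ j, ∫ᵛ t' in Icc (i * S.h) (r + i * S.h), S.g j (t', S.delayed x t') ∂<•(contPartSigned (μ j)) := by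
  have hfin := hc.isFiniteMeasure
  have hcf : IsFiniteMeasure (contPart ν) := by unfold contPart; infer_instance
  have hna := nullSingletonClass_contPart ν
  have hp := Q.isClock
  have hpf := hp.finite
  have hm := hp.measurable_clock
  obtain ⟨C, hC0, hCf, hCg⟩ := S.exists_bound
  have hIT : ∀ u ∈ Icc 0 S.h, u + i * S.h ∈ Icc 0 S.T := fun u hu => S.add_block_mem hi hu
  have hdel : ∀ t ∈ Icc 0 S.T, S.delayed x t = S.delayed x' t := fun t ht => by
    funext k
    exact (hx' _ (S.delay_mem ht (Nat.lt_succ_iff.1 k.2))).symm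
  have hB : MeasurableSet (Ioc 0 r \ Q.jumps) := measurableSet_Ioc.diff Q.countable_jumps.measurableSet
  have hBC : Disjoint (Ioc 0 r \ Q.jumps) Q.jumps := disjoint_sdiff_left
  have hdm : Measurable fun t => (t, S.delayed x' t) :=
    measurable_id.prodMk (DelaySystem.measurable_delayed hxm)
  have hfm : Measurable fun t => S.f (t, S.delayed x' t) := S.f_contDiff.continuous.measurable.comp hdm
  have hgm : ∀ j, Measurable fun t => S.g j (t, S.delayed x' t) := fun j =>
    (S.g_contDiff j).continuous.measurable.comp hdm
  have hshift : Measurable fun u : ℝ => u + i * S.h := measurable_add_const _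
  have hA : MeasurableSet (Icc 0 (Q.p.real univ) ∩ clock Q.p ⁻¹' (Ioc 0 r \ Q.jumps)) :=
    measurableSet_Icc.inter (hm hB)
  have hAfin : volume (Icc 0 (Q.p.real univ) ∩ clock Q.p ⁻¹' (Ioc 0 r \ Q.jumps)) ≠ ⊤ :=
    measure_ne_top_of_subset inter_subset_left (by simp)
  have e1 : ∫ s in Icc 0 (Q.p.real univ) ∩ clock Q.p ⁻¹' (Ioc 0 r \ Q.jumps),
      Q.unfolded.field (Q.stack ζ x') (i + 1) s =
      ∫ s in Icc 0 (Q.p.real univ) ∩ clock Q.p ⁻¹' (Ioc 0 r \ Q.jumps),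
        (Q.D (clock Q.p s) • S.f (clock Q.p s + i * S.h, S.delayed x' (clock Q.p s + i * S.h)) +
          ∑ j, Q.control (i + 1) s j •
            S.g j (clock Q.p s + i * S.h, S.delayed x' (clock Q.p s + i * S.h))) := by
    refine setIntegral_congr_fun hA fun s hs => ?_
    have := Q.field_of_notMem (ζ := ζ) hx' hpast (l := i + 1) (by omega) (by omega) hs.1 hs.2.2
    rw [this]
    push_cast
    rw [add_sub_cancel_right, hdel _ (hIT _ (hp.clock_mem s))]
  rw [e1, integral_add, integral_finsetSum]
  · congr 1
    · have := hp.setIntegral_clock Q.D_measurable Q.D_nonneg Q.volume_eq hB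
        (H := fun u => S.f (u + i * S.h, S.delayed x' (u + i * S.h)))
        (hfm.comp hshift).aestronglyMeasurable
      rw [this, Measure.restrict_restrict hB]
      have h2 : ((Ioc 0 r \ Q.jumps) ∩ Ioo 0 S.h : Set ℝ) =ᵐ[volume] Ioc 0 r := by
        have h3 : (Ioc 0 r \ Q.jumps) ∩ Ioo 0 S.h = Ioc 0 r \ Q.jumps :=
          inter_eq_left.2 fun u hu => ⟨hu.1.1, hu.1.2.trans_lt hr.2⟩
        rw [h3]
        exact sdiff_null_ae_eq_self (Q.countable_jumps.measure_zero _)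
      rw [setIntegral_congr_set h2, ← intervalIntegral.integral_of_le hr.1.le,
        intervalIntegral.integral_comp_add_right (fun t => S.f (t, S.delayed x' t)), zero_add]
      refine intervalIntegral.integral_congr fun t ht => ?_
      rw [uIcc_of_le (by linarith [hr.1])] at ht
      have h3 : t ∈ Icc 0 S.T := ⟨(mul_nonneg (Nat.cast_nonneg _) S.h_pos.le).trans ht.1,
        ht.2.trans (hIT r (Ioo_subset_Icc_self hr)).2⟩
      rw [hdel t h3]
    · refine Finset.sum_congr rfl fun j _ => ?_
      have hkj : Integrable (fun t => Q.k t j) (contPart ν) :=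
        Integrable.of_bound ((measurable_pi_apply j).comp Q.k_measurable).aestronglyMeasurable 1
          (ae_of_all _ fun t => (abs_le_norm1 _ j).trans (Q.norm1_k_le t))
      have := Q.integral_cont (q := fun w => w j) (fun c _ w => rfl) (measurable_pi_apply j) hi hB hBC
        (H := fun t => S.g j (t, S.delayed x' t)) ((hgm j).comp hshift).aestronglyMeasurable
      rw [this, setIntegral_congr_set (image_add_diff_ae_eq Q.countable_jumps hr.2 _),
        Q.contPartSigned_eq j]
      have hae : (fun t => S.g j (t, S.delayed x' t)) =ᵐ[(contPart ν).restrict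
          (Icc (i * S.h) (r + i * S.h))] fun t => S.g j (t, S.delayed x t) := by
        filter_upwards [ae_restrict_mem measurableSet_Icc] with t ht
        have h3 : t ∈ Icc 0 S.T := ⟨(mul_nonneg (Nat.cast_nonneg _) S.h_pos.le).trans ht.1,
          ht.2.trans (hIT r (Ioo_subset_Icc_self hr)).2⟩
        rw [hdel t h3]
      have hgk : IntegrableOn (fun t => Q.k t j • S.g j (t, S.delayed x' t))
          (Icc (i * S.h) (r + i * S.h)) (contPart ν) := by
        refine Integrable.of_bound ((((measurable_pi_apply j).comp Q.k_measurable).smul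
          (hgm j)).aestronglyMeasurable) (1 * C) (ae_of_all _ fun t => ?_)
        rw [norm_smul]
        exact mul_le_mul ((abs_le_norm1 _ j).trans (Q.norm1_k_le t)) (hCg _ _) (norm_nonneg _)
          zero_le_one
      rw [setIntegral_withDensityᵥ hkj measurableSet_Icc ((hgm j).aestronglyMeasurable.congr hae)
        (hgk.congr (by filter_upwards [hae] with t ht; rw [ht]))]
      refine integral_congr_ae ?_
      filter_upwards [hae] with t ht
      rw [ht]
  · intro j _
    refine Measure.integrableOn_of_bounded (M := 1 * C) hAfin ?_ (ae_of_all _ fun t => ?_)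
    · exact ((((measurable_pi_apply j).comp (Q.measurable_control _)).smul
        ((hgm j).comp (hshift.comp hm))).aestronglyMeasurable)
    · rw [norm_smul]
      exact mul_le_mul ((abs_le_norm1 _ j).trans (Q.norm1_control_le _ t)) (hCg _ _) (norm_nonneg _)
          zero_le_one
  · refine Measure.integrableOn_of_bounded (M := 1 * C) hAfin ?_ (ae_of_all _ fun t => ?_)
    · exact ((Q.D_measurable.comp hm).smul (hfm.comp (hshift.comp hm))).aestronglyMeasurable
    · rw [norm_smul, Real.norm_of_nonneg (Q.D_nonneg _)]
      exact mul_le_mul (Q.D_le_one _) (hCf _) (norm_nonneg _) zero_le_one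
  · refine integrable_finsetSum _ fun j _ => ?_
    refine Measure.integrableOn_of_bounded (M := 1 * C) hAfin ?_ (ae_of_all _ fun t => ?_)
    · exact ((((measurable_pi_apply j).comp (Q.measurable_control _)).smul
        ((hgm j).comp (hshift.comp hm))).aestronglyMeasurable)
    · rw [norm_smul]
      exact mul_le_mul ((abs_le_norm1 _ j).trans (Q.norm1_control_le _ t)) (hCg _ _) (norm_nonneg _)
          zero_le_one

end

end ClockData

end ImpulseDelay

end

/-! ### Every impulse process has an unfolding -/

noncomputable section

namespace ImpulseDelay

namespace ClockData

variable {S : DelaySystem n m} {μ : Fin m → SignedMeasure ℝ} {ν : Measure ℝ}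
  {ω : ℤ → ℝ → ℝ → Fin m → ℝ} (Q : ClockData S μ ν ω)
  {x : ℝ → Fin n → ℝ} {v : ℝ → ℝ} {ζ : ℤ → ℝ → ℝ → Fin n → ℝ} {θ : ℤ → ℝ → ℝ → ℝ}

theorem countable_jumps_spec : (0 : ℝ) ∈ Q.jumps ∧ S.h ∈ Q.jumps ∧
    ∀ r, Q.p.real {r} ≠ 0 → r ∈ Q.jumps :=
  ⟨Or.inr (Or.inl rfl), Or.inr (Or.inr rfl), fun _ h => Or.inl h⟩

/-- The impulse solution in terms of the unfolded field, on one block. -/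
theorem block_eq_x (hc : IsImpulseControl S μ ν ω) (harc : IsJumpArcs S ω x v ζ θ)
    (hpast : ∀ t ∈ Ico (-(S.M * S.h)) 0, x t = S.ξ₀ t) {x' : ℝ → Fin n → ℝ} (hxm : Measurable x')
    (hx' : ∀ t ∈ Icc (-(S.M * S.h)) S.T, x' t = x t) {i : ℕ} (hi : i < S.N)
    (hx : ∀ t ∈ Ioo (i * S.h) ((i + 1) * S.h),
      x t = ζ (i + 1) 0 1 + (∫ t' in (i * S.h)..t, S.f (t', S.delayed x t'))
        + (∑ j, ∫ᵛ t' in Icc (i * S.h) t, S.g j (t', S.delayed x t') ∂<•(contPartSigned (μ j)))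
        + ∑' r : Ioc 0 (t - i * S.h), (ζ (i + 1) r 1 - Function.leftLim x (r + i * S.h))) :
    (∀ r ∈ Ioo 0 S.h, x (r + i * S.h) = ζ (i + 1) 0 0 +
      ∫ s in (0 : ℝ)..cumul Q.p r, Q.unfolded.field (Q.stack ζ x') (i + 1) s) ∧
    ∀ r ∈ Icc 0 S.h, ∀ τ ∈ Icc (0 : ℝ) 1, ζ (i + 1) r τ = ζ (i + 1) 0 0 +
      ∫ s in (0 : ℝ)..(cumulLeft Q.p r + τ * Q.p.real {r}),
        Q.unfolded.field (Q.stack ζ x') (i + 1) s := by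
  have hcast : ((i + 1 : ℤ) : ℝ) - 1 = i := by push_cast; ring
  have hinit := fun r => harc.ζ_init (i + 1) r (by omega) (by omega)
  simp only [hcast] at hinit
  refine Q.isClock.unfold_eq Q.countable_jumps Q.countable_jumps_spec.1 Q.countable_jumps_spec.2.2
    (X := fun r => x (r + i * S.h)) (z := ζ (i + 1))
    (Q.unfolded.integrableOn_field (Q.measurable_stack harc hxm) (i + 1))
    (fun r hr τ hτ => Q.arc_jump harc (by omega) (by omega) hr hτ) ?_ ?_
  · intro r hr y hy
    rw [hinit r hr]
    exact leftLim_eq_of_tendsto (tendsto_of_tendsto_add hy)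
  · intro r hr
    have h1 := hx (r + i * S.h) ⟨by linarith [hr.1], by linarith [hr.2]⟩
    rw [add_sub_cancel_right] at h1
    rw [h1, Q.integral_field_cont hc hxm hx' hpast hi hr, ← add_assoc]
    congr 1
    refine tsum_congr fun r' => ?_
    rw [hinit r' ⟨r'.2.1, r'.2.2.trans hr.2.le⟩]

/-- The total variation of an impulse solution in terms of the unfolded control, on one block. -/
theorem block_eq_v (hc : IsImpulseControl S μ ν ω) (harc : IsJumpArcs S ω x v ζ θ) {i : ℕ}
    (hi : i < S.N)
    (hv : ∀ t ∈ Ioo (i * S.h) ((i + 1) * S.h),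
      v t = θ (i + 1) 0 1 + (contPart ν).real (Icc (i * S.h) t)
        + ∑' r : Ioc 0 (t - i * S.h), (θ (i + 1) r 1 - Function.leftLim v (r + i * S.h))) :
    (∀ r ∈ Ioo 0 S.h, v (r + i * S.h) = θ (i + 1) 0 0 +
      ∫ s in (0 : ℝ)..cumul Q.p r, norm1 (Q.control (i + 1) s)) ∧
    ∀ r ∈ Icc 0 S.h, ∀ τ ∈ Icc (0 : ℝ) 1, θ (i + 1) r τ = θ (i + 1) 0 0 +
      ∫ s in (0 : ℝ)..(cumulLeft Q.p r + τ * Q.p.real {r}), norm1 (Q.control (i + 1) s) := by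
  have hfin := hc.isFiniteMeasure
  have hcf : IsFiniteMeasure (contPart ν) := by unfold contPart; infer_instance
  have hna := nullSingletonClass_contPart ν
  have hcast : ((i + 1 : ℤ) : ℝ) - 1 = i := by push_cast; ring
  have hinit := fun r => harc.θ_init (i + 1) r (by omega) (by omega)
  simp only [hcast] at hinit
  have hhom : ∀ c : ℝ, 0 ≤ c → ∀ w : Fin m → ℝ, norm1 (c • w) = c * norm1 w := fun c hc w => by
    rw [norm1_smul, abs_of_nonneg hc]
  refine Q.isClock.unfold_eq Q.countable_jumps Q.countable_jumps_spec.1 Q.countable_jumps_spec.2.2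
    (X := fun r => v (r + i * S.h)) (z := θ (i + 1)) ?_ ?_ ?_ ?_
  · exact Measure.integrableOn_of_bounded (M := 1) (by simp)
      (ImpulseDelay.measurable_norm1.comp (Q.measurable_control _)).aestronglyMeasurable
      (ae_of_all _ fun s => by
        rw [Real.norm_of_nonneg (norm1_nonneg _)]; exact Q.norm1_control_le _ s)
  · intro r hr τ hτ
    rw [harc.θ_eq (i + 1) r (by omega) (by omega) hr (by omega) τ hτ,
      Q.integral_jump hhom hr (by omega) hτ]
  · intro r hr y hy
    rw [hinit r hr]
    exact leftLim_eq_of_tendsto (tendsto_of_tendsto_add hy)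
  · intro r hr
    have h1 := hv (r + i * S.h) ⟨by linarith [hr.1], by linarith [hr.2]⟩
    rw [add_sub_cancel_right] at h1
    have h2 := Q.integral_cont (E := ℝ) hhom ImpulseDelay.measurable_norm1 hi
      (measurableSet_Ioc.diff Q.countable_jumps.measurableSet) (B := Ioc 0 r \ Q.jumps)
      disjoint_sdiff_left (H := fun _ => 1) aestronglyMeasurable_const
    simp only [smul_eq_mul, mul_one] at h2
    have h3 : ∫ t in Icc (i * S.h) (r + i * S.h), norm1 (Q.k t) ∂(contPart ν) =
        ∫ t in Icc (i * S.h) (r + i * S.h), 1 ∂(contPart ν) :=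
      integral_congr_ae (ae_restrict_of_ae Q.norm1_k_ae)
    rw [h1, h2, setIntegral_congr_set (image_add_diff_ae_eq Q.countable_jumps hr.2 _), h3,
      setIntegral_const, smul_eq_mul, mul_one]
    congr 1
    refine tsum_congr fun r' => ?_
    rw [hinit r' ⟨r'.2.1, r'.2.2.trans hr.2.le⟩]

end ClockData

/-- A process `(x,v)` with variation measure `ν` and vector measure `μ` is represented in unfolded
time by the control `R`, the stack `Y`, and the distribution function `P` of the clock. -/
structure IsUnfolding {S : DelaySystem n m} (R : UnfoldedControl S) (Y : ℤ → ℝ → Fin n → ℝ)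
    (P : ℝ → ℝ) (μ : Fin m → SignedMeasure ℝ) (ν : Measure ℝ) (x : ℝ → Fin n → ℝ) (v : ℝ → ℝ) :
    Prop where
  isTrajectory : R.IsTrajectory Y
  P_mem : ∀ r, P r ∈ Icc 0 R.L
  time_le_iff : ∀ s ∈ Icc 0 R.L, ∀ r ∈ Icc 0 S.h, R.time s ≤ r ↔ s ≤ P r
  countable : {r ∈ Ioo 0 S.h | ∃ s ∈ Icc 0 R.L, R.time s = r ∧ s ≠ P r}.Countable
  x_eq : ∀ i : ℕ, i < S.N → ∀ r ∈ Ico 0 S.h, 0 < r + i * S.h → x (r + i * S.h) = Y (i + 1) (P r)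
  x_T : x S.T = Y S.N R.L
  x_init : x 0 = S.x₀
  v_eq : ∀ i : ℕ, i < S.N → ∀ r ∈ Ico 0 S.h, 0 < r + i * S.h → v (r + i * S.h) =
    (∑ i' ∈ Finset.range i, ∫ s in (0 : ℝ)..R.L, norm1 (R.w (i' + 1) s)) +
      ∫ s in (0 : ℝ)..P r, norm1 (R.w (i + 1) s)
  v_T : v S.T = ∑ i ∈ Finset.range S.N, ∫ s in (0 : ℝ)..R.L, norm1 (R.w (i + 1) s)
  v_init : v 0 = 0
  μ_eq : ∀ j, μ j = R.push fun l s => R.w l s j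
  ν_eq : ∀ [IsFiniteMeasure ν], ν.toSignedMeasure = R.push fun l s => norm1 (R.w l s)

/-- On each block, `unfold_eq` writes both x and the arcs as one primitive of the unfolded field.
The node conditions then identify the starting value of each block with the end of the previous one,
and induction along the blocks does the same for v. -/
theorem IsImpulseProcess.exists_unfolding {S : DelaySystem n m} {μ : Fin m → SignedMeasure ℝ}
    {ν : Measure ℝ} {ω : ℤ → ℝ → ℝ → Fin m → ℝ} {x : ℝ → Fin n → ℝ} {v : ℝ → ℝ}
    (hproc : IsImpulseProcess S μ ν ω x v) :
    ∃ (R : UnfoldedControl S) (Y : ℤ → ℝ → Fin n → ℝ) (P : ℝ → ℝ), IsUnfolding R Y P μ ν x v := by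
  obtain ⟨hc, hsol⟩ := hproc
  obtain ⟨Q⟩ := hc.nonempty_clockData
  obtain ⟨ζ, θ, harc, hnode, hblock⟩ := hsol.arcs
  obtain ⟨x', hxm, hx'⟩ := hsol.exists_measurable
  have hpast := hsol.x_past
  have hp := Q.isClock
  have hpf := hp.finite
  have hh := S.h_pos
  have h11 : (1 : ℝ) ∈ Icc (0 : ℝ) 1 := by simp
  have h0h : (0 : ℝ) ∈ Icc 0 S.h := ⟨le_rfl, hh.le⟩
  have hhh : S.h ∈ Icc 0 S.h := ⟨hh.le, le_rfl⟩
  set F := Q.unfolded.field (Q.stack ζ x') with hF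
  have hL : Q.unfolded.L = Q.p.real univ := rfl
  have hcast : ∀ i : ℕ, ((i + 1 : ℤ) : ℝ) - 1 = i := fun i => by push_cast; ring
  have hX : ∀ i : ℕ, i < S.N → _ := fun i hi => Q.block_eq_x hc harc hpast hxm hx' hi fun t ht => by
    have := (hblock (i + 1) (by omega) (by omega) t (by push_cast; simpa using ht)).2.2.1
    rw [hcast] at this
    exact this
  have hV : ∀ i : ℕ, i < S.N → _ := fun i hi => Q.block_eq_v hc harc hi fun t ht => by
    have := (hblock (i + 1) (by omega) (by omega) t (by push_cast; simpa using ht)).2.2.2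
    rw [hcast] at this
    exact this
  have hYz : ∀ i : ℕ, i < S.N → ∀ s ∈ Icc 0 (Q.p.real univ),
      Q.stack ζ x' (i + 1) s = ζ (i + 1) 0 0 + ∫ s' in (0 : ℝ)..s, F (i + 1) s' := by
    intro i hi s hs
    have hr := hp.clock_mem s
    have hs' := (hp.clock_eq_iff hs hr).1 rfl
    rw [← cumulLeft_add_atom] at hs'
    by_cases hj : clock Q.p s ∈ Q.jumps
    · rw [ClockData.stack, if_pos ⟨by omega, by omega⟩, glue_of_mem hj]
      have hP : 0 ≤ Q.p.real {clock Q.p s} := measureReal_nonneg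
      have hτ : (s - cumulLeft Q.p (clock Q.p s)) / Q.p.real {clock Q.p s} ∈ Icc (0 : ℝ) 1 :=
        ⟨div_nonneg (by linarith [hs'.1]) hP, div_le_one_of_le₀ (by linarith [hs'.2]) hP⟩
      rw [clampTo_of_mem hτ, (hX i hi).2 _ hr _ hτ]
      congr 2
      -- If the jump has no mass, division by zero gives arc parameter 0, and s is forced to be the
      -- single point of the fibre.
      rcases hP.eq_or_lt with h0 | h0
      · rw [← h0] at hs' ⊢
        rw [mul_zero, add_zero]
        linarith [hs'.1, hs'.2]
      · rw [div_mul_cancel₀ _ h0.ne']; ring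
    · obtain ⟨h1, h2, h3⟩ := Q.not_jump hj
      rw [Q.stack_of_notMem hx' hpast (by omega) (by omega) hj]
      push_cast
      rw [add_sub_cancel_right, (hX i hi).1 _ h1]
      congr 2
      rw [← cumulLeft_add_atom]
      rw [h3] at hs' ⊢
      linarith [hs'.1, hs'.2]
  have htot : ∀ r ∈ Icc 0 S.h, cumulLeft Q.p r + 1 * Q.p.real {r} = cumul Q.p r := fun r _ => by
    rw [one_mul, cumulLeft_add_atom]
  have hLmem : Q.p.real univ ∈ Icc 0 (Q.p.real univ) := ⟨hp.total_pos.le, le_rfl⟩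
  have hY0 : Q.stack ζ x' 0 (Q.p.real univ) = S.x₀ := by
    rw [ClockData.stack, if_neg (by omega)]
    simp
  have hprev : ∀ i : ℕ, i ≤ S.N → ζ (i + 1) 0 0 = Q.stack ζ x' i (Q.p.real univ) := by
    intro i hi
    rw [harc.ζ_init_node (i + 1) (by omega) (by omega), add_sub_cancel_right]
    cases i with
    | zero =>
      rw [Nat.cast_zero, hY0]
      exact (harc.ζ_zero S.h hhh 1 h11).2 rfl rfl
    | succ i =>
      push_cast
      rw [hYz i (by omega) _ hLmem, (hX i (by omega)).2 S.h hhh 1 h11, htot _ hhh, hp.cumul_h]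
  have hθ : ∀ i : ℕ, i ≤ S.N → θ (i + 1) 0 0 =
      ∑ i' ∈ Finset.range i, ∫ s in (0 : ℝ)..Q.p.real univ, norm1 (Q.control (i' + 1) s) := by
    intro i
    induction i with
    | zero =>
      intro _
      rw [harc.θ_init_node _ (by omega) (by omega)]
      simpa using harc.θ_zero S.h hhh 1 h11
    | succ i ih =>
      intro hi
      rw [harc.θ_init_node _ (by omega) (by omega), add_sub_cancel_right]
      push_cast
      rw [(hV i (by omega)).2 S.h hhh 1 h11, htot _ hhh, hp.cumul_h, ih (by omega),
        Finset.sum_range_succ]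
  refine ⟨Q.unfolded, Q.stack ζ x', cumul Q.p, ?_⟩
  exact {
    isTrajectory :=
      { measurable := Q.measurable_stack harc hxm
        past := by
          intro l hl hM s hs
          have hs1 : s ∈ Icc 0 (Q.p.real univ) := Ico_subset_Icc_self hs
          rw [ClockData.stack, if_neg (by omega), Q.time_eq hs1]
          rw [if_pos (show s < Q.p.real univ from hs.2), clampTo_of_mem (S.past_mem hl hM (hp.clock_mem s))]
        init := hY0
        eq := by
          intro l h1 hN s hs
          obtain ⟨i, rfl⟩ : ∃ i : ℕ, l = i + 1 := ⟨(l - 1).toNat, by omega⟩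
          rw [hYz i (by omega) s hs, hprev i (by omega), add_sub_cancel_right]
          rfl }
    P_mem := hp.cumul_mem
    time_le_iff := by
      intro s hs r hr
      rw [Q.time_eq hs, hp.clock_le_iff hr.1, min_eq_left (show s ≤ Q.p.real univ from hs.2)]
    countable := by
      refine Q.countable_jumps.mono ?_
      rintro r ⟨hr, s, hs, h1, h2⟩
      rw [Q.time_eq hs, hp.clock_eq_iff hs (Ioo_subset_Icc_self hr)] at h1
      refine Or.inl fun h3 : Q.p.real {r} = 0 => h2 ?_
      have h4 := cumulLeft_add_atom (p := Q.p) r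
      rw [h3, add_zero] at h4
      exact le_antisymm h1.2 (h4 ▸ h1.1)
    x_eq := by
      intro i hi r hr h0
      rw [hYz i hi _ (hp.cumul_mem r)]
      -- At a node the process takes the end value of the arc at r = 0 of the new block, in
      -- agreement with `cumul Q.p 0`, which includes the atom at 0.
      rcases hr.1.eq_or_lt with h1 | h1
      · rw [← h1, zero_add] at h0 ⊢
        have hi0 : i ≠ 0 := by rintro rfl; simp at h0
        have h2 := (hnode (i + 1) (by omega) (by omega)).1
        push_cast at h2
        rw [add_sub_cancel_right] at h2
        rw [h2, (hX i hi).2 0 h0h 1 h11, htot _ h0h]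
      · exact (hX i hi).1 r ⟨h1, hr.2⟩
    x_T := by
      have h2 := (hnode (S.N + 1) (by have := S.one_le_N; omega) le_rfl).1
      push_cast at h2
      rw [add_sub_cancel_right] at h2
      -- The extra arc with index N+1 is driven by the zero control, so it is constant and x(T) is
      -- the end of block N.
      rw [DelaySystem.T, h2, harc.ζ_ode (S.N + 1) 0 (by omega) le_rfl h0h (fun _ => rfl) 1 h11,
        hprev S.N le_rfl, hL, hc.ω_succ]
      simp
    x_init := hsol.x_init
    v_eq := by
      intro i hi r hr h0
      rw [hL, Q.unfolded_w, ← hθ i hi.le]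
      rcases hr.1.eq_or_lt with h1 | h1
      · rw [← h1, zero_add] at h0 ⊢
        have hi0 : i ≠ 0 := by rintro rfl; simp at h0
        have h2 := (hnode (i + 1) (by omega) (by omega)).2
        push_cast at h2
        rw [add_sub_cancel_right] at h2
        rw [h2, (hV i hi).2 0 h0h 1 h11, htot _ h0h]
      · exact (hV i hi).1 r ⟨h1, hr.2⟩
    v_T := by
      have h2 := (hnode (S.N + 1) (by have := S.one_le_N; omega) le_rfl).2
      push_cast at h2
      rw [add_sub_cancel_right] at h2
      rw [DelaySystem.T, h2, harc.θ_eq (S.N + 1) 0 (by omega) le_rfl h0h (fun _ => rfl) 1 h11,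
        hθ S.N le_rfl, hc.ω_succ]
      simp [Q.unfolded_w, hL]
    v_init := hsol.v_init
    μ_eq := hc.μ_eq_push Q
    ν_eq := hc.ν_eq_push Q }

end ImpulseDelay

end

noncomputable section

namespace ImpulseDelay

/-! ### Bi-Lipschitz changes of time -/

/-- A measurable rate bounded between positive constants. -/
structure ClockRate where
  b : ℝ → ℝ
  measurable : Measurable b
  c : ℝ
  c_pos : 0 < c
  le_b : ∀ s, c ≤ b s
  C : ℝ
  b_le : ∀ s, b s ≤ C

namespace ClockRate

variable (κ : ClockRate)

theorem b_pos (s : ℝ) : 0 < κ.b s := κ.c_pos.trans_le (κ.le_b s)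

theorem intervalIntegrable (s t : ℝ) : IntervalIntegrable κ.b volume s t :=
  intervalIntegrable_of_bounded κ.measurable.aestronglyMeasurable
    (fun s => by rw [Real.norm_of_nonneg (κ.b_pos s).le]; exact κ.b_le s) s t

/-- The time shown by the clock with rate `b`. -/
def time (s : ℝ) : ℝ := ∫ u in (0 : ℝ)..s, κ.b u

theorem time_zero : κ.time 0 = 0 := intervalIntegral.integral_same

theorem continuous_time : Continuous κ.time :=
  intervalIntegral.continuous_primitive κ.intervalIntegrable 0

theorem time_sub (s t : ℝ) : κ.time t - κ.time s = ∫ u in s..t, κ.b u :=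
  intervalIntegral.integral_interval_sub_left (κ.intervalIntegrable _ _) (κ.intervalIntegrable _ _)

theorem mul_le_time_sub {s t : ℝ} (h : s ≤ t) : κ.c * (t - s) ≤ κ.time t - κ.time s := by
  have := intervalIntegral.integral_mono_on h (intervalIntegrable_const (c := κ.c) (μ := volume))
    (κ.intervalIntegrable s t) fun u _ => κ.le_b u
  rw [intervalIntegral.integral_const, smul_eq_mul, mul_comm] at this
  rwa [time_sub]

theorem strictMono_time : StrictMono κ.time := fun s t h => by
  have := κ.mul_le_time_sub h.le
  have := mul_pos κ.c_pos (sub_pos.2 h)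
  linarith

theorem surjective_time : Function.Surjective κ.time := by
  refine κ.continuous_time.surjective ?_ ?_
  · refine tendsto_atTop_mono' _ ?_ (tendsto_id.const_mul_atTop κ.c_pos)
    filter_upwards [eventually_ge_atTop 0] with s hs
    have := κ.mul_le_time_sub hs
    rw [κ.time_zero] at this
    simpa using this
  · refine tendsto_atBot_mono' _ ?_ (tendsto_id.const_mul_atBot κ.c_pos)
    filter_upwards [eventually_le_atBot 0] with s hs
    have := κ.mul_le_time_sub hs
    rw [κ.time_zero] at this
    simp only [id_eq]
    linarith

/-- The clock as a change of variables. -/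
def iso : ℝ ≃o ℝ := StrictMono.orderIsoOfSurjective κ.time κ.strictMono_time κ.surjective_time

theorem symm_time (s : ℝ) : κ.iso.symm (κ.time s) = s := κ.iso.symm_apply_apply s

theorem time_symm (t : ℝ) : κ.time (κ.iso.symm t) = t := κ.iso.apply_symm_apply t

theorem measurable_symm : Measurable κ.iso.symm := κ.iso.symm.toHomeomorph.measurable

theorem measurableEmbedding_time : MeasurableEmbedding κ.time :=
  κ.iso.toHomeomorph.measurableEmbedding

/-- Change of variables for a bi-Lipschitz clock, checked on rational intervals, where it is the
definition of the clock as a primitive of its rate. -/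
theorem map_time :
    Measure.map κ.time (volume.withDensity fun s => ENNReal.ofReal (κ.b s)) = volume := by
  symm
  refine Real.measure_ext_Ioo_rat fun a b => ?_
  rcases le_or_gt (b : ℝ) a with h | h
  · simp [Ioo_eq_empty_of_le h]
  have e : κ.time ⁻¹' Ioo (a : ℝ) b = Ioo (κ.iso.symm a) (κ.iso.symm b) := by
    ext s
    rw [mem_preimage, mem_Ioo, mem_Ioo, κ.iso.symm_apply_lt, κ.iso.lt_symm_apply]
    rfl
  have hle : κ.iso.symm (a : ℝ) ≤ κ.iso.symm b := κ.iso.symm.monotone h.le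
  rw [κ.measurableEmbedding_time.map_apply, e, withDensity_apply _ measurableSet_Ioo,
    Real.volume_Ioo, ← ofReal_integral_eq_lintegral_ofReal, ← integral_Ioc_eq_integral_Ioo,
    ← intervalIntegral.integral_of_le hle, ← time_sub, time_symm, time_symm]
  · have h1 := (intervalIntegrable_iff_integrableOn_Ioc_of_le hle).1
      (κ.intervalIntegrable (κ.iso.symm a) (κ.iso.symm b))
    exact h1.mono_set Ioo_subset_Ioc_self
  · exact ae_of_all _ fun s => (κ.b_pos s).le

theorem integral_comp {E : Type*} [NormedAddCommGroup E] [NormedSpace ℝ E] (G : ℝ → E) {s t : ℝ}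
    (hst : s ≤ t) : ∫ u in κ.time s..κ.time t, G u = ∫ u in s..t, κ.b u • G (κ.time u) := by
  have h1 : κ.time s ≤ κ.time t := κ.strictMono_time.monotone hst
  have e : κ.time ⁻¹' Ioc (κ.time s) (κ.time t) = Ioc s t := by
    ext u
    simp only [mem_preimage, mem_Ioc, κ.strictMono_time.lt_iff_lt, κ.strictMono_time.le_iff_le]
  rw [intervalIntegral.integral_of_le h1, intervalIntegral.integral_of_le hst]
  conv_lhs => rw [← κ.map_time]
  rw [κ.measurableEmbedding_time.setIntegral_map, e,
    setIntegral_withDensity_eq_setIntegral_toReal_smul₀ (by have := κ.measurable; fun_prop)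
      (ae_of_all _ fun _ => ENNReal.ofReal_lt_top) _ measurableSet_Ioc]
  refine integral_congr_ae (ae_of_all _ fun u => ?_)
  simp only [ENNReal.toReal_ofReal (κ.b_pos u).le]

end ClockRate

/-! ### Regularization of an unfolded control -/

namespace UnfoldedControl

variable {S : DelaySystem n m} (R : UnfoldedControl S)

/-- The normalizing factor of the regularized clock. -/
def scale (ε : ℝ) : ℝ := S.h / (S.h + ε * R.L)

theorem scale_pos {ε : ℝ} (hε : 0 < ε) : 0 < R.scale ε :=
  div_pos S.h_pos (add_pos S.h_pos (mul_pos hε R.L_pos))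

theorem scale_le_one {ε : ℝ} (hε : 0 < ε) : R.scale ε ≤ 1 :=
  div_le_one_of_le₀ (by have := mul_pos hε R.L_pos; linarith)
    (add_pos S.h_pos (mul_pos hε R.L_pos)).le

theorem one_sub_scale_le {ε : ℝ} (hε : 0 < ε) : 1 - R.scale ε ≤ ε * (R.L / S.h) := by
  have h1 := S.h_pos
  have h2 := mul_pos hε R.L_pos
  rw [scale, one_sub_div (by positivity), add_sub_cancel_left, mul_div_assoc']
  exact div_le_div_of_nonneg_left h2.le h1 (by linarith)

/-- The regularized clock. -/
def rate {ε : ℝ} (hε : 0 < ε) : ClockRate where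
  b s := R.scale ε * (R.a s + ε)
  measurable := (R.a_measurable.add_const _).const_mul _
  c := R.scale ε * ε
  c_pos := mul_pos (R.scale_pos hε) hε
  le_b s := mul_le_mul_of_nonneg_left (by linarith [R.a_nonneg s]) (R.scale_pos hε).le
  C := R.scale ε * (1 + ε)
  b_le s := mul_le_mul_of_nonneg_left (by linarith [R.a_le_one s]) (R.scale_pos hε).le

variable {ε : ℝ} (hε : 0 < ε)

theorem rate_time (s : ℝ) : (R.rate hε).time s = R.scale ε * (R.time s + ε * s) := by
  rw [ClockRate.time, rate]
  simp only
  rw [intervalIntegral.integral_const_mul, intervalIntegral.integral_add (R.intervalIntegrable_a _ _)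
    intervalIntegrable_const, intervalIntegral.integral_const, time, sub_zero, smul_eq_mul,
    mul_comm s]

theorem rate_time_L : (R.rate hε).time R.L = S.h := by
  have h1 := S.h_pos
  have h2 := mul_pos hε R.L_pos
  rw [rate_time, time_L, scale, div_mul_cancel₀ _ (by positivity)]

theorem rate_time_mem {s : ℝ} (hs : s ∈ Icc 0 R.L) : (R.rate hε).time s ∈ Icc 0 S.h := by
  rw [← R.rate_time_L hε]
  exact ⟨(R.rate hε).time_zero ▸ (R.rate hε).strictMono_time.monotone hs.1,
    (R.rate hε).strictMono_time.monotone hs.2⟩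

theorem rate_time_mem' {s : ℝ} (hs : s ∈ Ico 0 R.L) : (R.rate hε).time s ∈ Ico 0 S.h := by
  refine ⟨(R.rate_time_mem hε (Ico_subset_Icc_self hs)).1, ?_⟩
  rw [← R.rate_time_L hε]
  exact (R.rate hε).strictMono_time hs.2

theorem abs_rate_sub_le (s : ℝ) : |(R.rate hε).b s - R.a s| ≤ ε * (R.L / S.h + 1) := by
  have h1 := R.one_sub_scale_le hε
  have h2 := R.scale_le_one hε
  have h3 := (R.scale_pos hε).le
  have h4 := R.a_nonneg s
  have h5 := R.a_le_one s
  have e : (R.rate hε).b s = R.scale ε * (R.a s + ε) := rfl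
  rw [e, abs_le]
  constructor <;> nlinarith

theorem abs_time_sub_le {s : ℝ} (hs : s ∈ Icc 0 R.L) :
    |(R.rate hε).time s - R.time s| ≤ ε * (2 * R.L) := by
  have h1 := R.one_sub_scale_le hε
  have h2 := R.scale_le_one hε
  have h3 := (R.scale_pos hε).le
  have h4 := R.time_mem hs
  have h5 := S.h_pos
  have h6 : (1 - R.scale ε) * S.h ≤ ε * R.L := by
    have := mul_le_mul_of_nonneg_right h1 h5.le
    rwa [mul_assoc, div_mul_cancel₀ _ h5.ne'] at this
  have h7 : (1 - R.scale ε) * R.time s ≤ ε * R.L :=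
    (mul_le_mul_of_nonneg_left h4.2 (by linarith)).trans h6
  have h8 : 0 ≤ (1 - R.scale ε) * R.time s := mul_nonneg (by linarith) h4.1
  have h9 : R.scale ε * (ε * s) ≤ ε * R.L := by
    refine (mul_le_of_le_one_left (mul_nonneg hε.le hs.1) h2).trans ?_
    exact mul_le_mul_of_nonneg_left hs.2 hε.le
  have h10 : 0 ≤ R.scale ε * (ε * s) := mul_nonneg h3 (mul_nonneg hε.le hs.1)
  rw [rate_time, abs_le]
  constructor <;> nlinarith

/-- The bounded control on `[0,T]` obtained from the regularized clock. -/
def regControl (t : ℝ) : Fin m → ℝ :=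
  ((R.rate hε).b ((R.rate hε).iso.symm (t - ⌊t / S.h⌋ * S.h)))⁻¹ •
    R.w (⌊t / S.h⌋ + 1) ((R.rate hε).iso.symm (t - ⌊t / S.h⌋ * S.h))

/-- For fixed ε the rate is bounded below, so w/b is bounded; the bound degenerates as ε → 0. Cone
values persist because 1/b is positive. -/
theorem isBoundedControl_regControl : S.IsBoundedControl (R.regControl hε) where
  measurable := by
    have h1 : Measurable fun t : ℝ => ⌊t / S.h⌋ := Int.measurable_floor.comp (measurable_id.div_const _)
    have h2 : Measurable fun t : ℝ => (R.rate hε).iso.symm (t - ⌊t / S.h⌋ * S.h) := by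
      refine (R.rate hε).measurable_symm.comp (measurable_id.sub ?_)
      exact (measurable_from_top (f := fun k : ℤ => (k : ℝ)).comp h1).mul_const _
    have h3 : Measurable fun q : ℝ × ℤ => R.w (q.2 + 1) q.1 :=
      measurable_from_prod_countable_left fun y => R.w_measurable (y + 1)
    exact ((R.rate hε).measurable.comp h2).inv.smul (h3.comp (h2.prodMk h1))
  mem_K t := S.K_cone _ (inv_nonneg.2 ((R.rate hε).b_pos _).le) _ (R.w_mem _ _)
  bounded := by
    refine ⟨(R.rate hε).c⁻¹, fun t => ?_⟩
    rw [regControl, norm1_smul, abs_of_pos (inv_pos.2 ((R.rate hε).b_pos _))]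
    refine (mul_le_of_le_one_right (inv_nonneg.2 ((R.rate hε).b_pos _).le) (R.norm1_w_le _ _)).trans ?_
    exact inv_anti₀ (R.rate hε).c_pos ((R.rate hε).le_b _)

/-- The floor picks out block l exactly while the clock reading is below h; at s = L it would
already select the next block, hence the half-open interval. -/
theorem regControl_eq {s : ℝ} (hs : s ∈ Ico 0 R.L) (l : ℤ) :
    (R.rate hε).b s • R.regControl hε ((R.rate hε).time s + (l - 1) * S.h) = R.w l s := by
  have h1 := R.rate_time_mem' hε hs
  have hh := S.h_pos
  have h2 : ⌊((R.rate hε).time s + (l - 1) * S.h) / S.h⌋ = l - 1 := by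
    rw [Int.floor_eq_iff, le_div_iff₀ hh, div_lt_iff₀ hh]
    push_cast
    constructor <;> nlinarith [h1.1, h1.2]
  rw [regControl, h2]
  push_cast
  rw [add_sub_cancel_right, sub_add_cancel, ClockRate.symm_time, smul_smul,
    mul_inv_cancel₀ ((R.rate hε).b_pos s).ne', one_smul]

/-- The blocks of a path along the regularized clock. -/
def regStack (y : ℝ → Fin n → ℝ) (l : ℤ) (s : ℝ) : Fin n → ℝ :=
  y ((R.rate hε).time s + (l - 1) * S.h)

/-- The right-hand side of the system along the regularized clock. -/
def regField (y : ℝ → Fin n → ℝ) (l : ℤ) (s : ℝ) : Fin n → ℝ :=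
  (R.rate hε).b s • S.f ((R.rate hε).time s + (l - 1) * S.h, fun k => R.regStack hε y (l - (k : ℕ)) s) +
    ∑ j, R.w l s j • S.g j ((R.rate hε).time s + (l - 1) * S.h,
      fun k => R.regStack hε y (l - (k : ℕ)) s)

/-- Chain rule for the change of time: the factor 1/b in the control cancels, so the control terms
keep the original w and only the drift feels the new rate. -/
theorem smul_field {s : ℝ} (hs : s ∈ Ico 0 R.L) (y : ℝ → Fin n → ℝ) (l : ℤ) :
    (R.rate hε).b s • S.field (R.regControl hε) y ((R.rate hε).time s + (l - 1) * S.h) =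
      R.regField hε y l s := by
  have h1 : S.delayed y ((R.rate hε).time s + (l - 1) * S.h) =
      fun k : Fin (S.M + 1) => R.regStack hε y (l - (k : ℕ)) s := by
    funext k
    rw [regStack, DelaySystem.delayed]
    congr 1; push_cast; ring
  rw [DelaySystem.field, regField, smul_add, h1, Finset.smul_sum]
  congr 1
  refine Finset.sum_congr rfl fun j _ => ?_
  rw [← R.regControl_eq hε hs l, Pi.smul_apply, smul_smul, smul_eq_mul]

/-- Integrals over a block in terms of the regularized clock. -/
theorem integral_block {E : Type*} [NormedAddCommGroup E] [NormedSpace ℝ E] (G : ℝ → E) (l : ℤ)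
    {s : ℝ} (hs : s ∈ Icc 0 R.L) :
    ∫ t in ((l - 1) * S.h)..((R.rate hε).time s + (l - 1) * S.h), G t =
      ∫ u in (0 : ℝ)..s, (R.rate hε).b u • G ((R.rate hε).time u + (l - 1) * S.h) := by
  rw [← (R.rate hε).integral_comp (fun t => G (t + (l - 1) * S.h)) hs.1, (R.rate hε).time_zero,
    intervalIntegral.integral_comp_add_right, zero_add]

theorem regStack_eq {y : ℝ → Fin n → ℝ} (hy : S.IsTrajectory (R.regControl hε) y) {l : ℤ}
    (h1 : 1 ≤ l) (hN : l ≤ S.N) {s : ℝ} (hs : s ∈ Icc 0 R.L) :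
    R.regStack hε y l s = R.regStack hε y (l - 1) R.L + ∫ u in (0 : ℝ)..s, R.regField hε y l u := by
  have h2 := S.block_mem h1 hN (R.rate_time_mem hε hs)
  have h3 := S.block_mem h1 hN (r := 0) ⟨le_rfl, S.h_pos.le⟩
  rw [zero_add] at h3
  have h4 : R.regStack hε y (l - 1) R.L = y ((l - 1) * S.h) := by
    rw [regStack, rate_time_L]
    congr 1; push_cast; ring
  rw [h4, regStack, hy.sub_eq (R.isBoundedControl_regControl hε) h3 h2, R.integral_block hε _ l hs]
  congr 1
  rw [intervalIntegral.integral_of_le hs.1, intervalIntegral.integral_of_le hs.1,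
    integral_Ioc_eq_integral_Ioo, integral_Ioc_eq_integral_Ioo]
  refine setIntegral_congr_fun measurableSet_Ioo fun u hu => ?_
  exact R.smul_field hε ⟨hu.1.le, hu.2.trans_le hs.2⟩ y l

theorem regStack_zero {y : ℝ → Fin n → ℝ} (hy : S.IsTrajectory (R.regControl hε) y) :
    R.regStack hε y 0 R.L = S.x₀ := by
  rw [regStack, rate_time_L, ← hy.init]
  congr 1; push_cast; ring

theorem regStack_past {y : ℝ → Fin n → ℝ} (hy : S.IsTrajectory (R.regControl hε) y) {l : ℤ}
    (hl : l ≤ 0) (hM : 1 - S.M ≤ l) {s : ℝ} (hs : s ∈ Ico 0 R.L) :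
    R.regStack hε y l s = S.ξ₀ ((R.rate hε).time s + (l - 1) * S.h) :=
  hy.past _ (S.past_mem' hl hM (R.rate_time_mem' hε hs))

theorem measurable_regField {y : ℝ → Fin n → ℝ} (hy : Measurable y) (l : ℤ) :
    Measurable (R.regField hε y l) := by
  have h0 : ∀ l' : ℤ, Measurable fun s => (R.rate hε).time s + (l' - 1) * S.h := fun l' =>
    (R.rate hε).continuous_time.measurable.add_const _
  have h1 : Measurable fun s => ((R.rate hε).time s + (l - 1) * S.h,
      fun k : Fin (S.M + 1) => R.regStack hε y (l - (k : ℕ)) s) :=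
    (h0 l).prodMk (measurable_pi_lambda _ fun _ => hy.comp (h0 _))
  refine ((R.rate hε).measurable.smul (S.f_contDiff.continuous.measurable.comp h1)).add ?_
  refine Finset.measurable_fun_sum _ fun j _ => ?_
  exact ((measurable_pi_apply j).comp (R.w_measurable l)).smul
    ((S.g_contDiff j).continuous.measurable.comp h1)

theorem norm_regField_le (hε1 : ε ≤ 1) {C : ℝ} (hC0 : 0 ≤ C) (hf : ∀ p, ‖S.f p‖ ≤ C)
    (hg : ∀ j p, ‖S.g j p‖ ≤ C) (y : ℝ → Fin n → ℝ) (l : ℤ) (s : ℝ) :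
    ‖R.regField hε y l s‖ ≤ 3 * C := by
  have h1 : ‖(R.rate hε).b s‖ ≤ 2 := by
    rw [Real.norm_of_nonneg ((R.rate hε).b_pos s).le]
    have : (R.rate hε).b s ≤ 1 * (R.a s + ε) :=
      mul_le_mul_of_nonneg_right (R.scale_le_one hε) (by linarith [R.a_nonneg s])
    linarith [R.a_le_one s]
  have : 3 * C = 2 * C + C := by ring
  rw [this]
  refine (norm_add_le _ _).trans (add_le_add ?_ ?_)
  · rw [norm_smul]
    exact mul_le_mul h1 (hf _) (norm_nonneg _) (by norm_num)
  · exact (norm_sum_smul_le _ fun j => hg j _).trans (mul_le_of_le_one_left hC0 (R.norm1_w_le l s))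

end UnfoldedControl

end ImpulseDelay

end

/-! ### Uniform convergence in unfolded time -/

noncomputable section

namespace ImpulseDelay

/-- Gronwall's inequality in integral form. -/
theorem le_of_le_add_integral {e : ℝ → ℝ} {L A B : ℝ} (hL : 0 < L) (hB : 0 ≤ B)
    (he : ContinuousOn e (Icc 0 L)) (he0 : ∀ s ∈ Icc 0 L, 0 ≤ e s)
    (h : ∀ s ∈ Icc 0 L, e s ≤ A + ∫ u in (0 : ℝ)..s, B * e u) :
    ∀ s ∈ Icc 0 L, e s ≤ 2 * A * Real.exp ((2 * B + 1) * L) := by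
  set κ := 2 * B + 1 with hκ
  have hκ0 : 0 < κ := by positivity
  have hc : ContinuousOn (fun s => e s * Real.exp (-(κ * s))) (Icc 0 L) :=
    he.mul (by fun_prop)
  obtain ⟨s0, hs0, hmax⟩ := isCompact_Icc.exists_isMaxOn ⟨0, left_mem_Icc.2 hL.le⟩ hc
  set M := e s0 * Real.exp (-(κ * s0)) with hM
  have hM0 : 0 ≤ M := mul_nonneg (he0 s0 hs0) (Real.exp_pos _).le
  have hle : ∀ s ∈ Icc 0 L, e s ≤ M * Real.exp (κ * s) := fun s hs => by
    have h1 : e s * Real.exp (-(κ * s)) ≤ M := hmax hs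
    rw [Real.exp_neg, ← div_eq_mul_inv, div_le_iff₀ (Real.exp_pos _)] at h1
    exact h1
  have hA0 : 0 ≤ A := by
    have := h 0 (left_mem_Icc.2 hL.le)
    rw [intervalIntegral.integral_same, add_zero] at this
    exact (he0 0 (left_mem_Icc.2 hL.le)).trans this
  have h2 : ∫ u in (0 : ℝ)..s0, B * e u ≤ ∫ u in (0 : ℝ)..s0, B * (M * Real.exp (κ * u)) := by
    have hec : ContinuousOn e (uIcc 0 s0) := by
      rw [uIcc_of_le hs0.1]; exact he.mono (Icc_subset_Icc_right hs0.2)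
    refine intervalIntegral.integral_mono_on hs0.1 (hec.const_smul B).intervalIntegrable
      (Continuous.intervalIntegrable (by fun_prop) _ _) fun u hu => ?_
    exact mul_le_mul_of_nonneg_left (hle u ⟨hu.1, hu.2.trans hs0.2⟩) hB
  have h3 : ∫ u in (0 : ℝ)..s0, B * (M * Real.exp (κ * u)) =
      B * M * (κ⁻¹ * (Real.exp (κ * s0) - 1)) := by
    simp_rw [← mul_assoc]
    rw [intervalIntegral.integral_const_mul, intervalIntegral.integral_comp_mul_left _ hκ0.ne',
      integral_exp]
    simp only [mul_zero, Real.exp_zero, smul_eq_mul]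
    ring
  -- The weight 2B+1 makes the integral at most half of e at the maximum point s0 of the weighted
  -- function, so it is absorbed into the left-hand side; this is the source of the factor 2 in the
  -- bound.
  have h4 : B * M * (κ⁻¹ * (Real.exp (κ * s0) - 1)) ≤ M * Real.exp (κ * s0) / 2 := by
    have h5 : B * κ⁻¹ ≤ 1 / 2 := by
      rw [← div_eq_mul_inv, div_le_iff₀ hκ0]; linarith
    have h6 : B * κ⁻¹ * (M * (Real.exp (κ * s0) - 1)) ≤ 1 / 2 * (M * (Real.exp (κ * s0) - 1)) := by
      refine mul_le_mul_of_nonneg_right h5 (mul_nonneg hM0 ?_)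
      have := Real.one_le_exp (mul_nonneg hκ0.le hs0.1)
      linarith
    nlinarith
  have h5 : M * Real.exp (κ * s0) = e s0 := by
    rw [hM, mul_assoc, ← Real.exp_add]; simp
  have h6 : M ≤ 2 * A := by
    have h7 := h s0 hs0
    have h8 : e s0 ≤ 2 * A := by linarith [h2.trans (h3.le.trans h4)]
    have h9 : Real.exp (-(κ * s0)) ≤ 1 :=
      Real.exp_le_one_iff.2 (neg_nonpos.2 (mul_nonneg hκ0.le hs0.1))
    exact (mul_le_of_le_one_right (he0 s0 hs0) h9).trans h8
  intro s hs
  refine (hle s hs).trans (mul_le_mul h6 ?_ (Real.exp_pos _).le (by positivity))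
  exact Real.exp_le_exp.2 (mul_le_mul_of_nonneg_left hs.2 hκ0.le)

/-- The `i`-th regularization parameter. -/
def eps (i : ℕ) : ℝ := 1 / ((i : ℝ) + 1)

theorem eps_pos (i : ℕ) : 0 < eps i := Nat.one_div_pos_of_nat

theorem eps_le_one (i : ℕ) : eps i ≤ 1 := by
  rw [eps, div_le_one (by positivity)]
  linarith [(Nat.cast_nonneg i : (0 : ℝ) ≤ i)]

theorem tendsto_eps : Tendsto eps atTop (𝓝 0) := tendsto_one_div_add_atTop_nhds_zero_nat

theorem eventually_eps_mul_le (c : ℝ) {δ : ℝ} (hδ : 0 < δ) : ∀ᶠ i in atTop, eps i * c ≤ δ := by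
  have h1 : Tendsto (fun i => eps i * c) atTop (𝓝 0) := by simpa using tendsto_eps.mul_const c
  exact h1.eventually (eventually_le_nhds hδ)

namespace UnfoldedControl

variable {S : DelaySystem n m} (R : UnfoldedControl S)

/-- The approximating trajectories. -/
def ApproxBy (y : ℕ → ℝ → Fin n → ℝ) : Prop :=
  ∀ i, S.IsTrajectory (R.regControl (eps_pos i)) (y i)

theorem exists_approxBy : ∃ y, R.ApproxBy y := by
  choose y hy using fun i => (R.isBoundedControl_regControl (eps_pos i)).exists_trajectory
  exact ⟨y, hy⟩

/-- Uniform boundedness and convergence on a block. -/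
def BlockConv (Y : ℤ → ℝ → Fin n → ℝ) (y : ℕ → ℝ → Fin n → ℝ) (l : ℤ) : Prop :=
  (∃ B, ∀ s ∈ Ico 0 R.L, ‖Y l s‖ ≤ B ∧ ∀ i, ‖R.regStack (eps_pos i) (y i) l s‖ ≤ B) ∧
    ∀ δ > 0, ∀ᶠ i in atTop, ∀ s ∈ Ico 0 R.L, ‖R.regStack (eps_pos i) (y i) l s - Y l s‖ ≤ δ

variable {R} {Y : ℤ → ℝ → Fin n → ℝ} {y : ℕ → ℝ → Fin n → ℝ}

/-- On past blocks both stacks evaluate the same continuous history, at clock readings that are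
uniformly close. -/
theorem blockConv_past (hY : R.IsTrajectory Y) (hy : R.ApproxBy y) {l : ℤ} (hl : l ≤ 0)
    (hM : 1 - S.M ≤ l) : R.BlockConv Y y l := by
  have hmem : ∀ s ∈ Ico 0 R.L, R.time s + (l - 1) * S.h ∈ Icc (-(S.M * S.h)) 0 := fun s hs =>
    S.past_mem hl hM (R.time_mem (Ico_subset_Icc_self hs))
  have hmem' : ∀ i, ∀ s ∈ Ico 0 R.L,
      (R.rate (eps_pos i)).time s + (l - 1) * S.h ∈ Icc (-(S.M * S.h)) 0 := fun i s hs =>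
    S.past_mem hl hM (R.rate_time_mem (eps_pos i) (Ico_subset_Icc_self hs))
  constructor
  · obtain ⟨B, hB⟩ := isCompact_Icc.exists_bound_of_continuousOn S.ξ₀_continuous
    refine ⟨B, fun s hs => ⟨?_, fun i => ?_⟩⟩
    · rw [hY.past l hl hM s hs]; exact hB _ (hmem s hs)
    · rw [R.regStack_past _ (hy i) hl hM hs]; exact hB _ (hmem' i s hs)
  · intro δ hδ
    have huc := isCompact_Icc.uniformContinuousOn_of_continuous S.ξ₀_continuous
    obtain ⟨η, hη, h⟩ := Metric.uniformContinuousOn_iff.1 huc δ hδ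
    filter_upwards [eventually_eps_mul_le (2 * R.L) (half_pos hη)] with i hi s hs
    rw [hY.past l hl hM s hs, R.regStack_past _ (hy i) hl hM hs, ← dist_eq_norm]
    refine (h _ (hmem' i s hs) _ (hmem s hs) ?_).le
    rw [Real.dist_eq, add_sub_add_right_eq_sub]
    linarith [R.abs_time_sub_le (eps_pos i) (Ico_subset_Icc_self hs)]

theorem continuousOn_stack (hY : R.IsTrajectory Y) {l : ℤ} (h1 : 1 ≤ l) (hN : l ≤ S.N) :
    ContinuousOn (Y l) (Icc 0 R.L) := by
  refine ContinuousOn.congr ?_ (hY.eq l h1 hN)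
  exact ((intervalIntegral.continuous_primitive
    (R.intervalIntegrable_field hY.measurable l) 0).const_add _).continuousOn

theorem intervalIntegrable_regField (hy : R.ApproxBy y) (i : ℕ) (l : ℤ) (a b : ℝ) :
    IntervalIntegrable (R.regField (eps_pos i) (y i) l) volume a b := by
  obtain ⟨C, h0, hf, hg⟩ := S.exists_bound
  exact intervalIntegrable_of_bounded
    (R.measurable_regField (eps_pos i) (hy i).measurable l).aestronglyMeasurable
    (R.norm_regField_le (eps_pos i) (eps_le_one i) h0 hf hg (y i) l) a b

theorem continuousOn_regStack (hy : R.ApproxBy y) (i : ℕ) {l : ℤ} (h1 : 1 ≤ l) (hN : l ≤ S.N) :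
    ContinuousOn (R.regStack (eps_pos i) (y i) l) (Icc 0 R.L) := by
  refine ContinuousOn.congr ?_ fun s hs => R.regStack_eq (eps_pos i) (hy i) h1 hN hs
  exact ((intervalIntegral.continuous_primitive
    (intervalIntegrable_regField hy i l) 0).const_add _).continuousOn

/-- The estimate of the difference of the fields by the difference of the current blocks. -/
theorem field_estimate {l : ℤ} (h1 : 1 ≤ l) (hN : l ≤ S.N)
    (hprev : ∀ l' < l, 1 - S.M ≤ l' → R.BlockConv Y y l')
    (hcur : ∃ B, ∀ s ∈ Ico 0 R.L, ‖Y l s‖ ≤ B ∧ ∀ i, ‖R.regStack (eps_pos i) (y i) l s‖ ≤ B) :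
    ∃ Λ, 0 ≤ Λ ∧ ∀ δ > 0, ∀ᶠ i in atTop, ∀ s ∈ Ico 0 R.L,
      ‖R.regField (eps_pos i) (y i) l s - R.field Y l s‖ ≤
        δ + Λ * ‖R.regStack (eps_pos i) (y i) l s - Y l s‖ := by
  obtain ⟨C, hC0, hCf, hCg⟩ := S.exists_bound
  have hB : ∀ k : Fin (S.M + 1), ∃ B, ∀ s ∈ Ico 0 R.L, ‖Y (l - (k : ℕ)) s‖ ≤ B ∧
      ∀ i, ‖R.regStack (eps_pos i) (y i) (l - (k : ℕ)) s‖ ≤ B := by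
    intro k
    have hk := k.2
    rcases Nat.eq_zero_or_pos (k : ℕ) with h | h
    · rw [h, Nat.cast_zero, sub_zero]; exact hcur
    · exact (hprev _ (by omega) (by omega)).1
  choose B hB using hB
  set B' : ℝ := ∑ k, |B k| with hB'
  have hB'k : ∀ k, B k ≤ B' := fun k => (le_abs_self _).trans
    (Finset.single_le_sum (f := fun k => |B k|) (fun _ _ => abs_nonneg _) (Finset.mem_univ k))
  have hB'0 : 0 ≤ B' := Finset.sum_nonneg fun _ _ => abs_nonneg _
  obtain ⟨Λ, hΛ0, hΛ⟩ := S.exists_lipschitz B'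
  refine ⟨2 * Λ, by positivity, fun δ hδ => ?_⟩
  -- Chosen so that 2Λ·2η' ≤ δ/2: time shift and earlier blocks together use half of δ, and the
  -- change of rate uses the other half.
  set η' := δ / (8 * (Λ + 1)) with hη'
  have hη'0 : 0 < η' := by positivity
  have hη'Λ : 2 * Λ * (2 * η') ≤ δ / 2 := by
    have : η' * (8 * (Λ + 1)) = δ := by rw [hη']; field_simp
    nlinarith
  have hconv : ∀ᶠ i in atTop, ∀ k : Fin (S.M + 1), 0 < (k : ℕ) → ∀ s ∈ Ico 0 R.L,
      ‖R.regStack (eps_pos i) (y i) (l - (k : ℕ)) s - Y (l - (k : ℕ)) s‖ ≤ η' := by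
    rw [eventually_all]
    intro k
    by_cases h : 0 < (k : ℕ)
    · have hk := k.2
      filter_upwards [(hprev (l - (k : ℕ)) (by omega) (by omega)).2 η' hη'0] with i hi _ using hi
    · exact Eventually.of_forall fun i h' => absurd h' h
  filter_upwards [hconv, eventually_eps_mul_le (2 * R.L) hη'0,
    eventually_eps_mul_le ((R.L / S.h + 1) * C) (half_pos hδ)] with i hi1 hi2 hi3 s hs
  have hsI := Ico_subset_Icc_self hs
  set e := ‖R.regStack (eps_pos i) (y i) l s - Y l s‖ with he
  set z : Fin (S.M + 1) → Fin n → ℝ := fun k => R.regStack (eps_pos i) (y i) (l - (k : ℕ)) s with hz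
  set z' : Fin (S.M + 1) → Fin n → ℝ := fun k => Y (l - (k : ℕ)) s with hz'
  set t := (R.rate (eps_pos i)).time s + (l - 1) * S.h with ht
  set t' := R.time s + (l - 1) * S.h with ht'
  have e0 : 0 ≤ e := norm_nonneg _
  have hzB : ‖z‖ ≤ B' := (pi_norm_le_iff_of_nonneg hB'0).2 fun k => ((hB k s hs).2 i).trans (hB'k k)
  have hzB' : ‖z'‖ ≤ B' := (pi_norm_le_iff_of_nonneg hB'0).2 fun k => ((hB k s hs).1).trans (hB'k k)
  have hzz : ‖z - z'‖ ≤ η' + e := by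
    refine (pi_norm_le_iff_of_nonneg (by positivity)).2 fun k => ?_
    rcases Nat.eq_zero_or_pos (k : ℕ) with h | h
    · have h2 : (z - z') k = R.regStack (eps_pos i) (y i) l s - Y l s := by
        simp only [hz, hz', Pi.sub_apply, h, Nat.cast_zero, sub_zero]
      rw [h2]; linarith
    · exact (hi1 k h s hs).trans (by linarith)
  have htt : |t - t'| ≤ η' := by
    rw [ht, ht', add_sub_add_right_eq_sub]
    exact (R.abs_time_sub_le (eps_pos i) hsI).trans hi2
  have hmax : max |t - t'| ‖z - z'‖ ≤ 2 * η' + e :=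
    max_le (by linarith) (by linarith)
  have hL := hΛ t (S.block_mem h1 hN (R.rate_time_mem (eps_pos i) hsI)) t'
    (S.block_mem h1 hN (R.time_mem hsI)) z z' hzB hzB'
  have hLm : Λ * max |t - t'| ‖z - z'‖ ≤ Λ * (2 * η' + e) := mul_le_mul_of_nonneg_left hmax hΛ0
  -- Three errors: the change of clock rate in the drift, and the Lipschitz differences of the drift
  -- and of the control fields.
  have key : R.regField (eps_pos i) (y i) l s - R.field Y l s =
      ((R.rate (eps_pos i)).b s - R.a s) • S.f (t, z) + R.a s • (S.f (t, z) - S.f (t', z')) +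
        ∑ j, R.w l s j • (S.g j (t, z) - S.g j (t', z')) := by
    simp only [regField, field, smul_sub, sub_smul, Finset.sum_sub_distrib]
    abel
  rw [key]
  have n1 : ‖((R.rate (eps_pos i)).b s - R.a s) • S.f (t, z)‖ ≤ δ / 2 := by
    rw [norm_smul, Real.norm_eq_abs]
    refine (mul_le_mul (R.abs_rate_sub_le (eps_pos i) s) (hCf _) (norm_nonneg _) ?_).trans ?_
    · have := S.h_pos; have := R.L_pos; have := eps_pos i; positivity
    · rwa [mul_assoc]
  have n2 : ‖R.a s • (S.f (t, z) - S.f (t', z'))‖ ≤ Λ * (2 * η' + e) := by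
    rw [norm_smul, Real.norm_of_nonneg (R.a_nonneg s)]
    exact (mul_le_of_le_one_left (norm_nonneg _) (R.a_le_one s)).trans (hL.1.trans hLm)
  have n3 : ‖∑ j, R.w l s j • (S.g j (t, z) - S.g j (t', z'))‖ ≤ Λ * (2 * η' + e) :=
    (norm_sum_smul_le _ fun j => (hL.2 j).trans hLm).trans
      (mul_le_of_le_one_left (by positivity) (R.norm1_w_le l s))
  have n4 := norm_add₃_le (a := ((R.rate (eps_pos i)).b s - R.a s) • S.f (t, z))
    (b := R.a s • (S.f (t, z) - S.f (t', z'))) (c := ∑ j, R.w l s j • (S.g j (t, z) - S.g j (t', z')))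
  nlinarith

/-- Within one block the error obeys an integral inequality whose constant term comes from the
starting values, the earlier blocks and the clock; Gronwall's inequality propagates it. The bound
and the convergence hold up to s = L, where the next block starts. -/
theorem blockConv_step (hY : R.IsTrajectory Y) (hy : R.ApproxBy y) {l : ℤ} (h1 : 1 ≤ l)
    (hN : l ≤ S.N) (hprev : ∀ l' < l, 1 - S.M ≤ l' → R.BlockConv Y y l')
    (hbase : ∀ δ > 0, ∀ᶠ i in atTop,
      ‖R.regStack (eps_pos i) (y i) (l - 1) R.L - Y (l - 1) R.L‖ ≤ δ)
    (hbdd : ∃ B, ∀ i, ‖R.regStack (eps_pos i) (y i) (l - 1) R.L‖ ≤ B) :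
    (∃ B, ∀ s ∈ Icc 0 R.L, ‖Y l s‖ ≤ B ∧ ∀ i, ‖R.regStack (eps_pos i) (y i) l s‖ ≤ B) ∧
    ∀ δ > 0, ∀ᶠ i in atTop, ∀ s ∈ Icc 0 R.L, ‖R.regStack (eps_pos i) (y i) l s - Y l s‖ ≤ δ := by
  obtain ⟨C, hC0, hCf, hCg⟩ := S.exists_bound
  have hLp := R.L_pos
  have hbound : ∃ B, ∀ s ∈ Icc 0 R.L, ‖Y l s‖ ≤ B ∧
      ∀ i, ‖R.regStack (eps_pos i) (y i) l s‖ ≤ B := by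
    obtain ⟨B, hB⟩ := hbdd
    have hint : ∀ {F : ℝ → Fin n → ℝ}, (∀ s, ‖F s‖ ≤ 3 * C) → ∀ s ∈ Icc 0 R.L,
        ‖∫ u in (0 : ℝ)..s, F u‖ ≤ 3 * C * R.L := by
      intro F hF s hs
      have := intervalIntegral.norm_integral_le_of_norm_le_const (a := 0) (b := s) (f := F)
        (C := 3 * C) fun u _ => hF u
      rw [sub_zero, abs_of_nonneg hs.1] at this
      exact this.trans (mul_le_mul_of_nonneg_left hs.2 (by positivity))
    refine ⟨max B ‖Y (l - 1) R.L‖ + 3 * C * R.L, fun s hs => ⟨?_, fun i => ?_⟩⟩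
    · rw [hY.eq l h1 hN s hs]
      refine (norm_add_le _ _).trans (add_le_add (le_max_right _ _) (hint (fun u => ?_) s hs))
      exact (R.norm_field_le hC0 hCf hCg Y l u).trans (by linarith)
    · rw [R.regStack_eq (eps_pos i) (hy i) h1 hN hs]
      refine (norm_add_le _ _).trans (add_le_add ((hB i).trans (le_max_left _ _))
        (hint (fun u => ?_) s hs))
      exact R.norm_regField_le (eps_pos i) (eps_le_one i) hC0 hCf hCg (y i) l u
  refine ⟨hbound, fun δ hδ => ?_⟩
  obtain ⟨B, hB⟩ := hbound
  obtain ⟨Λ, hΛ0, hΛ⟩ := field_estimate h1 hN hprev ⟨B, fun s hs => hB s (Ico_subset_Icc_self hs)⟩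
  set X := Real.exp ((2 * Λ + 1) * R.L) with hX
  have hX0 : 0 < X := Real.exp_pos _
  -- With this η the Gronwall bound 2(η + ηL)X is exactly δ.
  set η := δ / (2 * (1 + R.L) * X) with hη
  have hη0 : 0 < η := by positivity
  filter_upwards [hbase η hη0, hΛ η hη0] with i hi1 hi2
  have hc : ContinuousOn (fun s => ‖R.regStack (eps_pos i) (y i) l s - Y l s‖) (Icc 0 R.L) :=
    ((continuousOn_regStack hy i h1 hN).sub (continuousOn_stack hY h1 hN)).norm
  have := le_of_le_add_integral (A := η + η * R.L) hLp hΛ0 hc (fun _ _ => norm_nonneg _) ?_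
  · intro s hs
    refine (this s hs).trans (le_of_eq ?_)
    rw [hη, ← hX]
    field_simp
  · intro s hs
    have hF := intervalIntegrable_regField hy i l 0 s
    have hF' := R.intervalIntegrable_field hY.measurable l 0 s
    have e1 : R.regStack (eps_pos i) (y i) l s - Y l s =
        (R.regStack (eps_pos i) (y i) (l - 1) R.L - Y (l - 1) R.L) +
          ∫ u in (0 : ℝ)..s, (R.regField (eps_pos i) (y i) l u - R.field Y l u) := by
      rw [intervalIntegral.integral_sub hF hF', R.regStack_eq (eps_pos i) (hy i) h1 hN hs,
        hY.eq l h1 hN s hs]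
      abel
    have hec : IntervalIntegrable (fun u => Λ * ‖R.regStack (eps_pos i) (y i) l u - Y l u‖)
        volume 0 s := by
      refine ContinuousOn.intervalIntegrable ?_
      rw [uIcc_of_le hs.1]
      exact (hc.mono (Icc_subset_Icc_right hs.2)).const_smul Λ
    have e2 : ‖∫ u in (0 : ℝ)..s, (R.regField (eps_pos i) (y i) l u - R.field Y l u)‖ ≤
        ∫ u in (0 : ℝ)..s, (η + Λ * ‖R.regStack (eps_pos i) (y i) l u - Y l u‖) := by
      -- The field estimate is not available at the endpoint L, which is a null set.
      have hne : ∀ᵐ u ∂(volume : Measure ℝ), u ≠ R.L :=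
        (measure_eq_zero_iff_ae_notMem.1 (Real.volume_singleton (a := R.L))).mono fun u hu h => hu h
      refine intervalIntegral.norm_integral_le_of_norm_le hs.1 ?_ (intervalIntegrable_const.add hec)
      filter_upwards [hne] with u hu hu'
      exact hi2 u ⟨hu'.1.le, (hu'.2.trans hs.2).lt_of_ne hu⟩
    rw [intervalIntegral.integral_add intervalIntegrable_const hec,
      intervalIntegral.integral_const, sub_zero, smul_eq_mul] at e2
    rw [e1]
    refine (norm_add_le _ _).trans ?_
    have : s * η ≤ η * R.L := by rw [mul_comm]; exact mul_le_mul_of_nonneg_left hs.2 hη0.le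
    linarith

/-- Uniform convergence of the approximating blocks. -/
theorem tendsto_regStack (hY : R.IsTrajectory Y) (hy : R.ApproxBy y) {l : ℤ} (h1 : 1 ≤ l)
    (hN : l ≤ S.N) :
    (∃ B, ∀ s ∈ Icc 0 R.L, ‖Y l s‖ ≤ B ∧ ∀ i, ‖R.regStack (eps_pos i) (y i) l s‖ ≤ B) ∧
    ∀ δ > 0, ∀ᶠ i in atTop, ∀ s ∈ Icc 0 R.L, ‖R.regStack (eps_pos i) (y i) l s - Y l s‖ ≤ δ := by
  -- Strong induction, because block l depends on up to M earlier ones. The first block starts from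
  -- the exact value `S.x₀` for all approximations.
  have key : ∀ i : ℕ, ∀ l : ℤ, l = i + 1 → l ≤ S.N →
      (∃ B, ∀ s ∈ Icc 0 R.L, ‖Y l s‖ ≤ B ∧ ∀ i, ‖R.regStack (eps_pos i) (y i) l s‖ ≤ B) ∧
      ∀ δ > 0, ∀ᶠ i in atTop, ∀ s ∈ Icc 0 R.L,
        ‖R.regStack (eps_pos i) (y i) l s - Y l s‖ ≤ δ := by
    intro i
    induction i using Nat.strong_induction_on with
    | _ i ih =>
      rintro l rfl hl
      have hLm : R.L ∈ Icc 0 R.L := ⟨R.L_pos.le, le_rfl⟩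
      refine blockConv_step hY hy (by omega) hl ?_ ?_ ?_
      · intro l' hl' hM
        rcases le_or_gt l' 0 with h | h
        · exact blockConv_past hY hy h hM
        · obtain ⟨⟨B, hB⟩, h2⟩ := ih (l' - 1).toNat (by omega) l' (by omega) (by omega)
          refine ⟨⟨B, fun s hs => hB s (Ico_subset_Icc_self hs)⟩, fun δ hδ => ?_⟩
          filter_upwards [h2 δ hδ] with i hi s hs using hi s (Ico_subset_Icc_self hs)
      · intro δ hδ
        cases i with
        | zero =>
          simp only [Nat.cast_zero, zero_add, sub_self]
          refine Eventually.of_forall fun i => ?_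
          rw [R.regStack_zero (eps_pos i) (hy i), hY.init, sub_self, norm_zero]
          exact hδ.le
        | succ i =>
          filter_upwards [(ih i (by omega) (i + 1) rfl (by omega)).2 δ hδ] with k hk
          have := hk R.L hLm
          push_cast
          rwa [add_sub_cancel_right]
      · cases i with
        | zero =>
          simp only [Nat.cast_zero, zero_add, sub_self]
          exact ⟨‖S.x₀‖, fun i => by rw [R.regStack_zero (eps_pos i) (hy i)]⟩
        | succ i =>
          obtain ⟨B, hB⟩ := (ih i (by omega) (i + 1) rfl (by omega)).1
          refine ⟨B, fun k => ?_⟩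
          push_cast
          rw [add_sub_cancel_right]
          exact (hB R.L hLm).2 k
  exact key (l - 1).toNat l (by omega) hN

/-- Uniform convergence of the fields along the approximations. -/
theorem tendsto_regField (hY : R.IsTrajectory Y) (hy : R.ApproxBy y) {l : ℤ} (h1 : 1 ≤ l)
    (hN : l ≤ S.N) {s : ℝ} (hs : s ∈ Ico 0 R.L) :
    Tendsto (fun i => R.regField (eps_pos i) (y i) l s) atTop (𝓝 (R.field Y l s)) := by
  obtain ⟨⟨B, hB⟩, hconv⟩ := tendsto_regStack hY hy h1 hN
  have hprev : ∀ l' < l, 1 - S.M ≤ l' → R.BlockConv Y y l' := by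
    intro l' hl' hM
    rcases le_or_gt l' 0 with h | h
    · exact blockConv_past hY hy h hM
    · obtain ⟨⟨B, hB⟩, h2⟩ := tendsto_regStack hY hy (l := l') (by omega) (by omega)
      refine ⟨⟨B, fun s hs => hB s (Ico_subset_Icc_self hs)⟩, fun δ hδ => ?_⟩
      filter_upwards [h2 δ hδ] with i hi s hs using hi s (Ico_subset_Icc_self hs)
  obtain ⟨Λ, hΛ0, hΛ⟩ := field_estimate h1 hN hprev ⟨B, fun s hs => hB s (Ico_subset_Icc_self hs)⟩
  rw [Metric.tendsto_nhds]
  intro δ hδ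
  have h4 : 0 < δ / (4 * (Λ + 1)) := by positivity
  filter_upwards [hΛ (δ / 4) (by positivity), hconv _ h4] with i hi1 hi2
  rw [dist_eq_norm]
  have h5 := hi1 s hs
  have h6 := hi2 s (Ico_subset_Icc_self hs)
  have h7 : Λ * ‖R.regStack (eps_pos i) (y i) l s - Y l s‖ ≤ δ / 4 := by
    refine (mul_le_mul_of_nonneg_left h6 hΛ0).trans ?_
    rw [mul_div_assoc', div_le_div_iff₀ (by positivity) (by norm_num)]
    nlinarith
  linarith

end UnfoldedControl

end ImpulseDelay

end

/-! ### Weak-* convergence of image measures under converging clocks -/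

noncomputable section

namespace ImpulseDelay

theorem isFiniteMeasure_variation (s : SignedMeasure ℝ) : IsFiniteMeasure s.variation := by
  rw [← SignedMeasure.totalVariation_eq_variation]; infer_instance

theorem SupportedOn.restrict_eq {T : ℝ} {s : SignedMeasure ℝ} (h : SupportedOn T s) :
    s.restrict (Icc 0 T) = s := by
  refine VectorMeasure.ext fun B hB => ?_
  rw [VectorMeasure.restrict_apply _ measurableSet_Icc hB]
  have h1 := (supportedOn_iff.1 h) (B \ Icc 0 T) (hB.diff measurableSet_Icc) disjoint_sdiff_left
  have h2 := s.of_union (A := B ∩ Icc 0 T) (B := B \ Icc 0 T) (disjoint_sdiff_inter.symm)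
    (hB.inter measurableSet_Icc) (hB.diff measurableSet_Icc)
  rw [inter_union_sdiff, h1, add_zero] at h2
  exact h2.symm

theorem integrable_variation {s : SignedMeasure ℝ} {f : ℝ → ℝ} (hf : Continuous f) {C : ℝ}
    (hC : ∀ t, ‖f t‖ ≤ C) : s.Integrable f := by
  have := isFiniteMeasure_variation s
  exact Integrable.of_bound hf.aestronglyMeasurable C (ae_of_all _ hC)

theorem exists_bound_clampTo {T : ℝ} (hT : 0 ≤ T) {ψ : ℝ → ℝ} (hψ : ContinuousOn ψ (Icc 0 T)) :
    ∃ C, ∀ t, ‖clampTo 0 T ψ t‖ ≤ C := by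
  obtain ⟨C, hC⟩ := isCompact_Icc.exists_bound_of_continuousOn hψ
  exact ⟨C, fun t => hC _ ⟨le_max_left _ _, max_le hT (min_le_left _ _)⟩⟩

namespace UnfoldedControl

variable {S : DelaySystem n m} (R : UnfoldedControl S)

theorem integral_push {G : ℤ → ℝ → ℝ} (hG : ∀ i : ℕ, i < S.N → IntegrableOn (G (i + 1)) (Icc 0 R.L))
    {ψ : ℝ → ℝ} (hψ : ContinuousOn ψ (Icc 0 S.T)) :
    ∫ᵛ t in Icc 0 S.T, ψ t ∂<•(R.push G) = ∑ i ∈ Finset.range S.N, ∫ s in (0 : ℝ)..R.L,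
      G (i + 1) s • clampTo 0 S.T ψ (R.time s + i * S.h) := by
  obtain ⟨C, hC⟩ := exists_bound_clampTo S.T_nonneg hψ
  have hc := continuous_clampTo S.T_nonneg hψ
  have hm : ∀ i : ℕ, Measurable fun s => R.time s + i * S.h := fun i =>
    R.continuous_time.measurable.add_const _
  rw [← VectorMeasure.setIntegral_congr_fun fun t ht => clampTo_of_mem ht,
    (R.supportedOn_push hG).restrict_eq, push,
    VectorMeasure.integral_finsetSum_vectorMeasure fun i _ => integrable_variation hc hC]
  refine Finset.sum_congr rfl fun i hi => ?_
  have hG' := hG i (Finset.mem_range.1 hi)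
  have hcc : Continuous fun s => clampTo 0 S.T ψ (R.time s + i * S.h) :=
    hc.comp (R.continuous_time.add continuous_const)
  rw [VectorMeasure.integral_map (hm i) hc.aestronglyMeasurable
    (integrable_variation hcc fun s => hC _), integral_withDensityᵥ hG' hcc.aestronglyMeasurable,
    intervalIntegral.integral_of_le R.L_pos.le, integral_Icc_eq_integral_Ioc]
  exact Integrable.mul_bdd (c := C) hG' hcc.aestronglyMeasurable (ae_of_all _ fun s => hC _)

/-- The integral over the first `i` blocks along the regularized clock. -/
theorem integral_blocks {E : Type*} [NormedAddCommGroup E] [NormedSpace ℝ E] {ε : ℝ} (hε : 0 < ε)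
    {G : ℝ → E} (hG : ∀ a b, IntervalIntegrable G volume a b) (i : ℕ) :
    ∫ t in (0 : ℝ)..(i * S.h), G t = ∑ i' ∈ Finset.range i, ∫ u in (0 : ℝ)..R.L,
      (R.rate hε).b u • G ((R.rate hε).time u + i' * S.h) := by
  induction i with
  | zero => simp
  | succ i ih =>
    have h1 := R.integral_block hε G (i + 1) (s := R.L) ⟨R.L_pos.le, le_rfl⟩
    rw [R.rate_time_L, show ((i + 1 : ℤ) : ℝ) - 1 = i by push_cast; ring] at h1
    rw [Finset.sum_range_succ, ← ih, ← h1, intervalIntegral.integral_add_adjacent_intervals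
      (hG _ _) (hG _ _)]
    congr 1
    push_cast; ring

theorem integral_blocks_add {E : Type*} [NormedAddCommGroup E] [NormedSpace ℝ E] {ε : ℝ} (hε : 0 < ε)
    {G : ℝ → E} (hG : ∀ a b, IntervalIntegrable G volume a b) (i : ℕ) {s : ℝ} (hs : s ∈ Icc 0 R.L) :
    ∫ t in (0 : ℝ)..((R.rate hε).time s + i * S.h), G t = (∑ i' ∈ Finset.range i,
      ∫ u in (0 : ℝ)..R.L, (R.rate hε).b u • G ((R.rate hε).time u + i' * S.h)) +
      ∫ u in (0 : ℝ)..s, (R.rate hε).b u • G ((R.rate hε).time u + i * S.h) := by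
  have h1 := R.integral_block hε G (i + 1) hs
  rw [show ((i + 1 : ℤ) : ℝ) - 1 = i by push_cast; ring] at h1
  rw [← R.integral_blocks hε hG, ← h1, intervalIntegral.integral_add_adjacent_intervals
    (hG _ _) (hG _ _)]

/-- Densities which converge along the regularized clocks define weakly-* convergent measures. -/
theorem tendsto_integral_push {D : ℕ → ℝ → ℝ} (hD : ∀ i, Measurable (D i))
    (hDb : ∀ i, ∃ C, ∀ t, ‖D i t‖ ≤ C) {Gs : ℕ → ℤ → ℝ → ℝ} {G : ℤ → ℝ → ℝ} {C : ℝ}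
    (hGs : ∀ i l, Measurable (Gs i l)) (hGsC : ∀ i l s, ‖Gs i l s‖ ≤ C)
    (hG : ∀ i : ℕ, i < S.N → IntegrableOn (G (i + 1)) (Icc 0 R.L))
    (hDG : ∀ i (l : ℤ), ∀ s ∈ Ico 0 R.L,
      (R.rate (eps_pos i)).b s • D i ((R.rate (eps_pos i)).time s + (l - 1) * S.h) = Gs i l s)
    (hlim : ∀ l : ℤ, 1 ≤ l → l ≤ S.N → ∀ s ∈ Ico 0 R.L,
      Tendsto (fun i => Gs i l s) atTop (𝓝 (G l s)))
    {ψ : ℝ → ℝ} (hψ : ContinuousOn ψ (Icc 0 S.T)) :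
    Tendsto (fun i => ∫ t in Icc 0 S.T, D i t • ψ t) atTop
      (𝓝 (∫ᵛ t in Icc 0 S.T, ψ t ∂<•(R.push G))) := by
  obtain ⟨B, hB⟩ := exists_bound_clampTo S.T_nonneg hψ
  have hc := continuous_clampTo S.T_nonneg hψ
  have h1 : ∀ i, ∫ t in Icc 0 S.T, D i t • ψ t = ∑ i' ∈ Finset.range S.N, ∫ s in (0 : ℝ)..R.L,
      Gs i (i' + 1) s • clampTo 0 S.T ψ ((R.rate (eps_pos i)).time s + i' * S.h) := fun i => by
    rw [setIntegral_congr_fun (g := fun t => D i t • clampTo 0 S.T ψ t) measurableSet_Icc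
      fun t ht => by simp only [clampTo_of_mem ht], integral_Icc_eq_integral_Ioc,
      ← intervalIntegral.integral_of_le S.T_nonneg, DelaySystem.T,
      R.integral_blocks (eps_pos i) fun a b => ?_]
    · refine Finset.sum_congr rfl fun i' _ => ?_
      rw [intervalIntegral.integral_of_le R.L_pos.le, intervalIntegral.integral_of_le R.L_pos.le,
        integral_Ioc_eq_integral_Ioo, integral_Ioc_eq_integral_Ioo]
      refine setIntegral_congr_fun measurableSet_Ioo fun s hs => ?_
      have := hDG i (i' + 1) s ⟨hs.1.le, hs.2⟩
      rw [show ((i' + 1 : ℤ) : ℝ) - 1 = i' by push_cast; ring] at this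
      simp only [← this, smul_assoc]
    · obtain ⟨A, hA⟩ := hDb i
      refine intervalIntegrable_of_bounded (C := A * B)
        ((hD i).smul hc.measurable).aestronglyMeasurable (fun t => ?_) a b
      rw [Pi.smul_apply', norm_smul]
      exact mul_le_mul (hA t) (hB t) (norm_nonneg _) ((norm_nonneg _).trans (hA t))
  simp_rw [h1]
  rw [R.integral_push hG hψ]
  refine tendsto_finsetSum _ fun i' hi' => ?_
  have hi := Finset.mem_range.1 hi'
  -- Pulled back to the fixed interval [0,L], the integrands converge pointwise: the densities by
  -- hypothesis, the test function because the regularized clocks converge.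
  refine intervalIntegral.tendsto_integral_filter_of_dominated_convergence (fun _ => C * B)
    (Eventually.of_forall fun i => ?_) (Eventually.of_forall fun i => ae_of_all _ fun s _ => ?_)
    intervalIntegrable_const ?_
  · refine ((hGs i _).smul (hc.measurable.comp ?_)).aestronglyMeasurable
    exact (R.rate (eps_pos i)).continuous_time.measurable.add_const _
  · rw [norm_smul]
    exact mul_le_mul (hGsC i _ s) (hB _) (norm_nonneg _) ((norm_nonneg _).trans (hGsC i 0 s))
  · have hne : ∀ᵐ s : ℝ, s ≠ R.L := by simp [ae_iff]
    filter_upwards [hne] with s hsL hs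
    rw [uIoc_of_le R.L_pos.le] at hs
    have hs' : s ∈ Ico 0 R.L := ⟨hs.1.le, lt_of_le_of_ne hs.2 hsL⟩
    refine (hlim (i' + 1) (by lia) (by lia) s hs').smul ((hc.tendsto _).comp ?_)
    refine Tendsto.add_const _ ?_
    rw [tendsto_iff_dist_tendsto_zero]
    refine squeeze_zero (fun _ => dist_nonneg)
      (fun i => R.abs_time_sub_le (eps_pos i) (Ico_subset_Icc_self hs')) ?_
    simpa using tendsto_eps.mul_const (2 * R.L)

end UnfoldedControl

end ImpulseDelay

end

/-! ### Weak-* limits of the controls, their variations and the trajectories -/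

noncomputable section

namespace ImpulseDelay

theorem setIntegral_withDensityᵥ_restrict {T : ℝ} {D : ℝ → ℝ} (hD : Measurable D) {C : ℝ}
    (hC : ∀ t, ‖D t‖ ≤ C) {ψ : ℝ → ℝ} (hψ : ContinuousOn ψ (Icc 0 T)) :
    ∫ᵛ t in Icc 0 T, ψ t ∂<•((volume.restrict (Icc 0 T)).withDensityᵥ D) =
      ∫ t in Icc 0 T, D t • ψ t := by
  have h1 : ((volume : Measure ℝ).restrict (Icc 0 T)).restrict (Icc 0 T) =
      volume.restrict (Icc 0 T) := by
    rw [Measure.restrict_restrict measurableSet_Icc, inter_self]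
  have h2 : IntegrableOn D (Icc 0 T) :=
    IntegrableOn.of_bound (by simp) hD.aestronglyMeasurable C (ae_of_all _ hC)
  rw [setIntegral_withDensityᵥ h2 measurableSet_Icc
    (by rw [h1]; exact hψ.aestronglyMeasurable measurableSet_Icc), h1]
  rw [IntegrableOn, h1]
  exact hψ.integrableOn_Icc.bdd_mul hD.aestronglyMeasurable (ae_of_all _ hC)

namespace UnfoldedControl

variable {S : DelaySystem n m} {R : UnfoldedControl S}

theorem integrableOn_w (R : UnfoldedControl S) (l : ℤ) (j : Fin m) :
    IntegrableOn (fun s => R.w l s j) (Icc 0 R.L) :=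
  IntegrableOn.of_bound (by simp)
    ((measurable_pi_apply j).comp (R.w_measurable l)).aestronglyMeasurable 1
    (ae_of_all _ fun s => (abs_le_norm1 _ j).trans (R.norm1_w_le l s))

theorem norm_norm1_w_le (R : UnfoldedControl S) (l : ℤ) (s : ℝ) : ‖norm1 (R.w l s)‖ ≤ 1 := by
  rw [Real.norm_of_nonneg (norm1_nonneg _)]; exact R.norm1_w_le l s

theorem integrableOn_norm1_w (R : UnfoldedControl S) (l : ℤ) :
    IntegrableOn (fun s => norm1 (R.w l s)) (Icc 0 R.L) :=
  IntegrableOn.of_bound (by simp)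
    (measurable_norm1.comp (R.w_measurable l)).aestronglyMeasurable 1
    (ae_of_all _ (R.norm_norm1_w_le l))

theorem norm1_regControl (R : UnfoldedControl S) {ε : ℝ} (hε : 0 < ε) (l : ℤ) {s : ℝ}
    (hs : s ∈ Ico 0 R.L) :
    (R.rate hε).b s • norm1 (R.regControl hε ((R.rate hε).time s + (l - 1) * S.h)) =
      norm1 (R.w l s) := by
  rw [← R.regControl_eq hε hs l, norm1_smul, abs_of_pos ((R.rate hε).b_pos s), smul_eq_mul]

/-- The regularized controls converge weakly-* to the transported control. -/
theorem weakStar_regControl (R : UnfoldedControl S) : WeakStar S.T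
    (fun i => controlMeasure S.T (primitive (R.regControl (eps_pos i))))
    (fun j => R.push fun l s => R.w l s j) := by
  intro ψ hψ j
  have hU := fun i => R.isBoundedControl_regControl (eps_pos i)
  have hb : ∀ i, ∃ C, ∀ t, ‖R.regControl (eps_pos i) t j‖ ≤ C := fun i => by
    obtain ⟨C, hC⟩ := (hU i).bounded
    exact ⟨C, fun t => (abs_le_norm1 _ j).trans (hC t)⟩
  have hm : ∀ i, Measurable fun t => R.regControl (eps_pos i) t j := fun i =>
    (measurable_pi_apply j).comp (hU i).measurable
  have h1 : ∀ i, ∫ᵛ t in Icc 0 S.T, ψ t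
      ∂<•(controlMeasure S.T (primitive (R.regControl (eps_pos i))) j) =
      ∫ t in Icc 0 S.T, R.regControl (eps_pos i) t j • ψ t := fun i => by
    obtain ⟨C, hC⟩ := hb i
    rw [(hU i).controlMeasure_primitive]
    exact setIntegral_withDensityᵥ_restrict (hm i) hC hψ
  simp_rw [h1]
  refine R.tendsto_integral_push (Gs := fun _ l s => R.w l s j) (C := 1) hm hb
    (fun _ l => (measurable_pi_apply j).comp (R.w_measurable l))
    (fun _ l s => (abs_le_norm1 _ j).trans (R.norm1_w_le l s))
    (fun i _ => R.integrableOn_w _ j) (fun i l s hs => ?_)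
    (fun l _ _ s _ => tendsto_const_nhds) hψ
  exact congrFun (R.regControl_eq (eps_pos i) hs l) j

/-- The variations of the regularized controls converge weakly-*. -/
theorem weakStarPos_regControl (R : UnfoldedControl S) {ν : Measure ℝ} [IsFiniteMeasure ν]
    (hν : ν.toSignedMeasure = R.push fun l s => norm1 (R.w l s)) : WeakStarPos S.T
    (fun i => totalVar (controlMeasure S.T (primitive (R.regControl (eps_pos i))))) ν := by
  intro ψ hψ
  have hU := fun i => R.isBoundedControl_regControl (eps_pos i)
  have h1 : ∀ i, ∫ t in Icc 0 S.T, ψ t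
      ∂(totalVar (controlMeasure S.T (primitive (R.regControl (eps_pos i))))) =
      ∫ t in Icc 0 S.T, norm1 (R.regControl (eps_pos i) t) • ψ t := fun i => by
    have hm := (hU i).measurable_norm1
    rw [(hU i).totalVar_controlMeasure, setIntegral_withDensity_eq_setIntegral_toReal_smul₀
      hm.ennreal_ofReal.aemeasurable
      (ae_of_all _ fun _ => ENNReal.ofReal_lt_top) _ measurableSet_Icc,
      Measure.restrict_restrict measurableSet_Icc, inter_self]
    simp only [ENNReal.toReal_ofReal (norm1_nonneg _)]
  have h2 : ∫ t in Icc 0 S.T, ψ t ∂ν = ∫ᵛ t in Icc 0 S.T, ψ t ∂<•ν.toSignedMeasure := by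
    rw [Measure.toSignedMeasure_restrict_eq_restrict_toSignedMeasure _ _ measurableSet_Icc,
      VectorMeasure.integral_toSignedMeasure]
  simp_rw [h1]
  rw [h2, hν]
  refine R.tendsto_integral_push (Gs := fun _ l s => norm1 (R.w l s)) (C := 1)
    (fun i => (hU i).measurable_norm1) (fun i => ?_)
    (fun _ l => measurable_norm1.comp (R.w_measurable l))
    (fun _ l s => R.norm_norm1_w_le l s)
    (fun i _ => R.integrableOn_norm1_w _) (fun i l s hs => R.norm1_regControl (eps_pos i) l hs)
    (fun l _ _ s _ => tendsto_const_nhds) hψ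
  obtain ⟨C, hC⟩ := (hU i).bounded
  exact ⟨C, fun t => by rw [Real.norm_of_nonneg (norm1_nonneg _)]; exact hC t⟩

/-- The Stieltjes measures of the approximating trajectories converge weakly-*. -/
theorem weakStar_trajectory {Y : ℤ → ℝ → Fin n → ℝ} (hY : R.IsTrajectory Y)
    {y : ℕ → ℝ → Fin n → ℝ} (hy : R.ApproxBy y) : WeakStar S.T
    (fun i k => (volume.restrict (Icc 0 S.T)).withDensityᵥ fun t =>
      S.field (R.regControl (eps_pos i)) (y i) t k)
    (fun k => R.push fun l s => R.field Y l s k) := by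
  intro ψ hψ k
  have hU := fun i => R.isBoundedControl_regControl (eps_pos i)
  have hm : ∀ i, Measurable fun t => S.field (R.regControl (eps_pos i)) (y i) t k := fun i =>
    (measurable_pi_apply k).comp (DelaySystem.measurable_field (hU i).measurable (hy i).measurable)
  have hb : ∀ i, ∃ C, ∀ t, ‖S.field (R.regControl (eps_pos i)) (y i) t k‖ ≤ C := fun i => by
    obtain ⟨C, -, hC⟩ := (hU i).exists_field_bound
    exact ⟨C, fun t => (norm_le_pi_norm _ k).trans (hC _ t)⟩
  have h1 : ∀ i, ∫ᵛ t in Icc 0 S.T, ψ t ∂<•((volume.restrict (Icc 0 S.T)).withDensityᵥ fun t =>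
      S.field (R.regControl (eps_pos i)) (y i) t k) =
      ∫ t in Icc 0 S.T, S.field (R.regControl (eps_pos i)) (y i) t k • ψ t := fun i => by
    obtain ⟨C, hC⟩ := hb i
    exact setIntegral_withDensityᵥ_restrict (hm i) hC hψ
  simp_rw [h1]
  obtain ⟨C, hC0, hf, hg⟩ := S.exists_bound
  refine R.tendsto_integral_push (Gs := fun i l s => R.regField (eps_pos i) (y i) l s k)
    (G := fun l s => R.field Y l s k) (C := 3 * C) hm hb
    (fun i l => (measurable_pi_apply k).comp (R.measurable_regField (eps_pos i) (hy i).measurable l))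
    (fun i l s => (norm_le_pi_norm _ k).trans
      (R.norm_regField_le (eps_pos i) (eps_le_one i) hC0 hf hg _ l s))
    (fun i _ => (R.integrableOn_field hY.measurable _).eval k) (fun i l s hs => ?_) (fun l h1 hN s hs => ?_) hψ
  · exact congrFun (R.smul_field (eps_pos i) hs (y i) l) k
  · exact ((continuous_apply k).tendsto _).comp (tendsto_regField hY hy h1 hN hs)

end UnfoldedControl

end ImpulseDelay

end

/-! ### Identification of the Stieltjes measures -/

noncomputable section

namespace ImpulseDelay

namespace UnfoldedControl

variable {S : DelaySystem n m} {R : UnfoldedControl S}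

/-- Up to time r+ih the earlier blocks contribute completely and block i exactly up to parameter P
r. Since r < h, later blocks contribute nothing; at r = h the start of the next block could. -/
theorem push_Icc {G : ℤ → ℝ → ℝ} (hG : ∀ i : ℕ, i < S.N → IntegrableOn (G (i + 1)) (Icc 0 R.L))
    {P : ℝ → ℝ} (hP : ∀ r, P r ∈ Icc 0 R.L)
    (hPt : ∀ s ∈ Icc 0 R.L, ∀ r ∈ Icc 0 S.h, R.time s ≤ r ↔ s ≤ P r)
    {i : ℕ} (hi : i < S.N) {r : ℝ} (hr : r ∈ Ico 0 S.h) :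
    R.push G (Icc 0 (r + i * S.h)) = (∑ i' ∈ Finset.range i, ∫ s in (0 : ℝ)..R.L, G (i' + 1) s) +
      ∫ s in (0 : ℝ)..P r, G (i + 1) s := by
  have hh := S.h_pos
  have hnn : ∀ i' : ℕ, 0 ≤ (i' : ℝ) * S.h := fun i' => by positivity
  rw [R.push_apply hG measurableSet_Icc, ← Finset.sum_subset (Finset.range_mono (Nat.succ_le_of_lt hi)),
    Finset.sum_range_succ]
  · congr 1
    · refine Finset.sum_congr rfl fun i' hi' => ?_
      have h1 : ((i' : ℝ) + 1) * S.h ≤ i * S.h :=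
        mul_le_mul_of_nonneg_right (by exact_mod_cast Finset.mem_range.1 hi') hh.le
      rw [intervalIntegral.integral_of_le R.L_pos.le, ← integral_Icc_eq_integral_Ioc,
        inter_eq_left.2 fun s hs => ?_]
      have h2 := R.time_mem hs
      exact ⟨add_nonneg h2.1 (hnn i'), by linarith [h2.2, hr.1]⟩
    · rw [intervalIntegral.integral_of_le (hP r).1, ← integral_Icc_eq_integral_Ioc]
      congr 2
      ext s
      constructor
      · rintro ⟨hs, h1⟩
        exact ⟨hs.1, (hPt s hs r (Ico_subset_Icc_self hr)).1 (by have := h1.2; linarith)⟩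
      · intro hs
        have hs' : s ∈ Icc 0 R.L := ⟨hs.1, hs.2.trans (hP r).2⟩
        have h2 := R.time_mem hs'
        have h3 := (hPt s hs' r (Ico_subset_Icc_self hr)).2 hs.2
        exact ⟨hs', add_nonneg h2.1 (hnn i), by linarith⟩
  · intro i' _ hi'
    have h1 : ((i : ℝ) + 1) * S.h ≤ i' * S.h := by
      refine mul_le_mul_of_nonneg_right ?_ hh.le
      have : i + 1 ≤ i' := by simpa using hi'
      exact_mod_cast this
    rw [show Icc 0 R.L ∩ R.time ⁻¹' {r' | r' + i' * S.h ∈ Icc 0 (r + i * S.h)} = ∅ from ?_,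
      setIntegral_empty]
    refine eq_empty_of_forall_notMem fun s hs => ?_
    have h2 := (R.time_mem hs.1).1
    have h3 : R.time s + i' * S.h ≤ r + i * S.h := hs.2.2
    linarith [hr.2]

theorem push_Icc_T {G : ℤ → ℝ → ℝ}
    (hG : ∀ i : ℕ, i < S.N → IntegrableOn (G (i + 1)) (Icc 0 R.L)) :
    R.push G (Icc 0 S.T) = ∑ i' ∈ Finset.range S.N, ∫ s in (0 : ℝ)..R.L, G (i' + 1) s := by
  rw [R.push_apply hG measurableSet_Icc]
  refine Finset.sum_congr rfl fun i' hi' => ?_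
  rw [intervalIntegral.integral_of_le R.L_pos.le, ← integral_Icc_eq_integral_Ioc,
    inter_eq_left.2 fun s hs => ?_]
  exact S.add_block_mem (Finset.mem_range.1 hi') (R.time_mem hs)

theorem IsTrajectory.eq_apply {Y : ℤ → ℝ → Fin n → ℝ} (hY : R.IsTrajectory Y) {i : ℕ}
    (hi : i < S.N) {s : ℝ} (hs : s ∈ Icc 0 R.L) (k : Fin n) :
    ∫ s' in (0 : ℝ)..s, R.field Y (i + 1) s' k = Y (i + 1) s k - Y i R.L k := by
  have h1 := congrFun (hY.eq (i + 1) (by lia) (by lia) s hs) k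
  have h2 := (ContinuousLinearMap.proj (R := ℝ) (φ := fun _ : Fin n => ℝ) k).intervalIntegral_comp_comm
    (R.intervalIntegrable_field hY.measurable (i + 1) 0 s)
  rw [Pi.add_apply, add_sub_cancel_right] at h1
  rw [h1, add_sub_cancel_left]
  exact h2

/-- The sum telescopes because every block starts at the end of the previous one. -/
theorem IsTrajectory.sum_eq {Y : ℤ → ℝ → Fin n → ℝ} (hY : R.IsTrajectory Y) (k : Fin n) {i : ℕ}
    (hi : i ≤ S.N) : ∑ i' ∈ Finset.range i, ∫ s in (0 : ℝ)..R.L, R.field Y (i' + 1) s k =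
      Y i R.L k - S.x₀ k := by
  rw [← hY.init, Finset.sum_congr rfl fun i' hi' => hY.eq_apply
    ((Finset.mem_range.1 hi').trans_le hi) (right_mem_Icc.2 R.L_pos.le) k]
  have := Finset.sum_range_sub (fun i : ℕ => Y i R.L k) i
  push_cast at this
  exact this

end UnfoldedControl

/-- `push_Icc` and the telescoping sum give the increment of x. Closed intervals match because
x(r+ih) is read at P r, after the whole jump at r has been run. -/
theorem IsUnfolding.isStieltjes {S : DelaySystem n m} {R : UnfoldedControl S}
    {Y : ℤ → ℝ → Fin n → ℝ} {P : ℝ → ℝ} {μ : Fin m → SignedMeasure ℝ} {ν : Measure ℝ}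
    {x : ℝ → Fin n → ℝ} {v : ℝ → ℝ} (hR : IsUnfolding R Y P μ ν x v) (k : Fin n) :
    IsStieltjes S.T (fun t => x t k) (R.push fun l s => R.field Y l s k) := by
  have hY := hR.isTrajectory
  have hG : ∀ i : ℕ, i < S.N → IntegrableOn (fun s => R.field Y (i + 1) s k) (Icc 0 R.L) :=
    fun i _ => (R.integrableOn_field hY.measurable _).eval k
  refine ⟨R.supportedOn_push hG, fun t ht => ?_⟩
  rcases ht.2.lt_or_eq with h | rfl
  · obtain ⟨i, hi, r, hr, rfl⟩ := S.exists_block (t := t) ⟨ht.1.le, h⟩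
    rw [UnfoldedControl.push_Icc hG hR.P_mem hR.time_le_iff hi hr, hY.sum_eq k hi.le,
      hY.eq_apply hi (hR.P_mem r)]
    beta_reduce
    rw [hR.x_eq i hi r hr ht.1, hR.x_init]
    ring
  · rw [UnfoldedControl.push_Icc_T hG, hY.sum_eq k le_rfl]
    beta_reduce
    rw [hR.x_T, hR.x_init]

theorem DelaySystem.IsTrajectory.isStieltjes {S : DelaySystem n m} {U : ℝ → Fin m → ℝ}
    {x : ℝ → Fin n → ℝ} (hx : S.IsTrajectory U x) (hU : S.IsBoundedControl U) (k : Fin n) :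
    IsStieltjes S.T (fun t => x t k)
      ((volume.restrict (Icc 0 S.T)).withDensityᵥ fun t => S.field U x t k) := by
  have hi := hU.intervalIntegrable_field hx.measurable
  have h1 : IntegrableOn (fun t => S.field U x t k) (Icc 0 S.T) := by
    have := (intervalIntegrable_iff_integrableOn_Icc_of_le S.T_nonneg).1 (hi 0 S.T)
    exact this.eval k
  refine ⟨supportedOn_iff.2 fun B hB hd => ?_, fun t ht => ?_⟩
  · rw [withDensityᵥ_apply h1 hB, Measure.restrict_restrict hB, hd.inter_eq, setIntegral_empty]
  · rw [withDensityᵥ_apply h1 measurableSet_Icc, Measure.restrict_restrict measurableSet_Icc,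
      inter_eq_left.2 (Icc_subset_Icc_right ht.2), integral_Icc_eq_integral_Ioc,
      ← intervalIntegral.integral_of_le ht.1.le]
    beta_reduce
    rw [hx.eq t ⟨ht.1.le, ht.2⟩, hx.init, Pi.add_apply,
      add_sub_cancel_left]
    exact (ContinuousLinearMap.proj (R := ℝ) (φ := fun _ : Fin n => ℝ) k).intervalIntegral_comp_comm
      (hi 0 t)

end ImpulseDelay

end

/-! ### Pointwise convergence outside a countable set -/

noncomputable section

namespace ImpulseDelay

namespace UnfoldedControl

variable {S : DelaySystem n m} (R : UnfoldedControl S)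

theorem integral_norm1_regControl {ε : ℝ} (hε : 0 < ε) (i : ℕ) {s : ℝ} (hs : s ∈ Icc 0 R.L) :
    ∫ t in (0 : ℝ)..((R.rate hε).time s + i * S.h), norm1 (R.regControl hε t) =
      (∑ i' ∈ Finset.range i, ∫ u in (0 : ℝ)..R.L, norm1 (R.w (i' + 1) u)) +
        ∫ u in (0 : ℝ)..s, norm1 (R.w (i + 1) u) := by
  have key : ∀ (i' : ℕ) (s' : ℝ), s' ∈ Icc 0 R.L → ∫ u in (0 : ℝ)..s', (R.rate hε).b u •
      norm1 (R.regControl hε ((R.rate hε).time u + i' * S.h)) =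
      ∫ u in (0 : ℝ)..s', norm1 (R.w (i' + 1) u) := fun i' s' hs' => by
    rw [intervalIntegral.integral_of_le hs'.1, intervalIntegral.integral_of_le hs'.1,
      integral_Ioc_eq_integral_Ioo, integral_Ioc_eq_integral_Ioo]
    refine setIntegral_congr_fun measurableSet_Ioo fun u hu => ?_
    have := R.norm1_regControl hε (i' + 1) (s := u) ⟨hu.1.le, hu.2.trans_le hs'.2⟩
    rwa [show ((i' + 1 : ℤ) : ℝ) - 1 = i' by push_cast; ring] at this
  rw [R.integral_blocks_add hε (R.isBoundedControl_regControl hε).intervalIntegrable_norm1 i hs,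
    key i s hs, Finset.sum_congr rfl fun i' _ => key i' R.L (right_mem_Icc.2 R.L_pos.le)]

/-- The parameter at which the regularized clock shows the time `r`. -/
def regParam (r : ℝ) (i : ℕ) : ℝ := (R.rate (eps_pos i)).iso.symm r

theorem regParam_mem {r : ℝ} (hr : r ∈ Icc 0 S.h) (i : ℕ) : R.regParam r i ∈ Icc 0 R.L := by
  refine ⟨?_, ?_⟩
  · rw [regParam, OrderIso.le_symm_apply]
    exact ((R.rate (eps_pos i)).time_zero).trans_le hr.1
  · rw [regParam, OrderIso.symm_apply_le]
    exact hr.2.trans_eq (R.rate_time_L (eps_pos i)).symm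

theorem rate_time_regParam (r : ℝ) (i : ℕ) : (R.rate (eps_pos i)).time (R.regParam r i) = r :=
  (R.rate (eps_pos i)).time_symm r

/-- At a time which the limit clock shows only once the parameters converge. -/
theorem tendsto_regParam {P : ℝ → ℝ}
    (hPt : ∀ s ∈ Icc 0 R.L, ∀ r ∈ Icc 0 S.h, R.time s ≤ r ↔ s ≤ P r) {r : ℝ} (hP : P r ≤ R.L)
    (hr : r ∈ Icc 0 S.h) (h : ∀ s ∈ Icc 0 R.L, R.time s = r → s = P r) :
    Tendsto (R.regParam r) atTop (𝓝 (P r)) := by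
  have hd : ∀ i, |r - R.time (R.regParam r i)| ≤ eps i * (2 * R.L) := fun i => by
    have := R.abs_time_sub_le (eps_pos i) (R.regParam_mem hr i)
    rwa [R.rate_time_regParam] at this
  refine tendsto_order.2 ⟨fun a ha => ?_, fun b hb => ?_⟩
  · rcases lt_or_ge a 0 with h0 | h0
    · exact Eventually.of_forall fun i => h0.trans_le (R.regParam_mem hr i).1
    · have haL : a ∈ Icc 0 R.L := ⟨h0, ha.le.trans hP⟩
      -- Below P r the limit clock cannot yet show r, since it shows r only at P r; this is the one
      -- place where uniqueness is used.
      have h1 : R.time a < r := lt_of_le_of_ne ((hPt a haL r hr).2 ha.le) fun e => ha.ne (h a haL e)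
      filter_upwards [eventually_eps_mul_le (2 * R.L) (half_pos (sub_pos.2 h1))] with i hi
      by_contra! h2
      have := R.time_mono h2
      have := (le_abs_self _).trans ((hd i).trans hi)
      linarith
  · rcases lt_or_ge R.L b with h0 | h0
    · exact Eventually.of_forall fun i => (R.regParam_mem hr i).2.trans_lt h0
    · have h1 : r < R.time b := by
        by_contra! h2
        by_cases hb0 : 0 ≤ b
        · exact absurd ((hPt b ⟨hb0, h0⟩ r hr).1 h2) (not_le.2 hb)
        · have := (hPt 0 ⟨le_rfl, R.L_pos.le⟩ r hr).1 (R.time_zero.trans_le hr.1)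
          linarith
      filter_upwards [eventually_eps_mul_le (2 * R.L) (half_pos (sub_pos.2 h1))] with i hi
      by_contra! h2
      have := R.time_mono h2
      have := (neg_abs_le _).trans' (neg_le_neg ((hd i).trans hi))
      linarith

/-- Uniform convergence of the stacks combined with continuity of the limit stack allows the
argument to move. -/
theorem tendsto_regStack_comp {R : UnfoldedControl S} {Y : ℤ → ℝ → Fin n → ℝ}
    (hY : R.IsTrajectory Y) {y : ℕ → ℝ → Fin n → ℝ} (hy : R.ApproxBy y) {l : ℤ} (h1 : 1 ≤ l)
    (hN : l ≤ S.N) {s : ℕ → ℝ} {s₀ : ℝ} (hs : ∀ i, s i ∈ Icc 0 R.L) (hs₀ : s₀ ∈ Icc 0 R.L)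
    (hlim : Tendsto s atTop (𝓝 s₀)) :
    Tendsto (fun i => R.regStack (eps_pos i) (y i) l (s i)) atTop (𝓝 (Y l s₀)) := by
  have h2 : Tendsto (fun i => Y l (s i)) atTop (𝓝 (Y l s₀)) :=
    ((continuousOn_stack hY h1 hN) s₀ hs₀).tendsto.comp
      (tendsto_nhdsWithin_iff.2 ⟨hlim, Eventually.of_forall hs⟩)
  have h3 : Tendsto (fun i => R.regStack (eps_pos i) (y i) l (s i) - Y l (s i)) atTop (𝓝 0) := by
    refine NormedAddGroup.tendsto_nhds_zero.2 fun δ hδ => ?_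
    filter_upwards [(tendsto_regStack hY hy h1 hN).2 (δ / 2) (half_pos hδ)] with i hi
    exact (hi _ (hs i)).trans_lt (half_lt_self hδ)
  simpa using h3.add h2

end UnfoldedControl

namespace IsUnfolding

variable {S : DelaySystem n m} {R : UnfoldedControl S} {Y : ℤ → ℝ → Fin n → ℝ} {P : ℝ → ℝ}
  {μ : Fin m → SignedMeasure ℝ} {ν : Measure ℝ} {x : ℝ → Fin n → ℝ} {v : ℝ → ℝ}
  (hR : IsUnfolding R Y P μ ν x v) {y : ℕ → ℝ → Fin n → ℝ} (hy : R.ApproxBy y)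

include hR hy

theorem tendsto_of_regular {i : ℕ} (hi : i < S.N) {r : ℝ} (hr : r ∈ Ioo 0 S.h)
    (h : ∀ s ∈ Icc 0 R.L, R.time s = r → s = P r) :
    Tendsto (fun k => y k (r + i * S.h)) atTop (𝓝 (x (r + i * S.h))) ∧
      Tendsto (fun k => ∫ t in (0 : ℝ)..(r + i * S.h), norm1 (R.regControl (eps_pos k) t)) atTop
        (𝓝 (v (r + i * S.h))) := by
  have hr' := Ioo_subset_Icc_self hr
  have h0 : 0 < r + i * S.h := by have := S.h_pos; have := hr.1; positivity
  have hs := R.regParam_mem hr'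
  have hlim := R.tendsto_regParam hR.time_le_iff (hR.P_mem r).2 hr' h
  rw [hR.x_eq i hi r (Ioo_subset_Ico_self hr) h0, hR.v_eq i hi r (Ioo_subset_Ico_self hr) h0]
  constructor
  · have := UnfoldedControl.tendsto_regStack_comp hR.isTrajectory hy (l := i + 1) (by lia) (by lia)
      hs (hR.P_mem r) hlim
    refine this.congr fun k => ?_
    rw [UnfoldedControl.regStack, R.rate_time_regParam,
      show ((i + 1 : ℤ) : ℝ) - 1 = i by push_cast; ring]
  · have h2 : Continuous fun s => ∫ u in (0 : ℝ)..s, norm1 (R.w (i + 1) u) :=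
      intervalIntegral.continuous_primitive (intervalIntegrable_of_bounded
        (measurable_norm1.comp (R.w_measurable _)).aestronglyMeasurable (R.norm_norm1_w_le _)) 0
    refine (((h2.tendsto _).comp hlim).const_add _).congr fun k => ?_
    have := R.integral_norm1_regControl (eps_pos k) i (hs k)
    rw [R.rate_time_regParam] at this
    exact this.symm

/-- Every regularized clock reaches h exactly at L, so no regularity of the limit clock is needed;
the variations at T even coincide with v(T) for every approximation. -/
theorem tendsto_T :
    Tendsto (fun k => y k S.T) atTop (𝓝 (x S.T)) ∧
      Tendsto (fun k => ∫ t in (0 : ℝ)..S.T, norm1 (R.regControl (eps_pos k) t)) atTop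
        (𝓝 (v S.T)) := by
  have hL := right_mem_Icc.2 R.L_pos.le
  have hN := S.one_le_N
  rw [hR.x_T, hR.v_T]
  constructor
  · have := UnfoldedControl.tendsto_regStack_comp hR.isTrajectory hy (l := S.N) (by lia) le_rfl
      (s := fun _ => R.L) (fun _ => hL) hL tendsto_const_nhds
    refine this.congr fun k => ?_
    rw [UnfoldedControl.regStack, R.rate_time_L, DelaySystem.T]
    congr 1
    push_cast; ring
  · refine tendsto_const_nhds.congr fun k => ?_
    have := R.integral_norm1_regControl (eps_pos k) S.N (s := 0) ⟨le_rfl, R.L_pos.le⟩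
    rw [ClockRate.time_zero, zero_add, intervalIntegral.integral_same, add_zero] at this
    exact this.symm

/-- The set of times at which convergence holds. -/
theorem exists_full_measure : ∃ E : Set ℝ, E ⊆ Icc 0 S.T ∧ volume (Icc 0 S.T \ E) = 0 ∧
    0 ∈ E ∧ S.T ∈ E ∧ ∀ t ∈ E, Tendsto (fun k => y k t) atTop (𝓝 (x t)) ∧
      Tendsto (fun k => ∫ t' in (0 : ℝ)..t, norm1 (R.regControl (eps_pos k) t')) atTop
        (𝓝 (v t)) := by
  set C := {r ∈ Ioo 0 S.h | ∃ s ∈ Icc 0 R.L, R.time s = r ∧ s ≠ P r}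
  refine ⟨{t ∈ Icc 0 S.T | t = 0 ∨ t = S.T ∨ ∃ i : ℕ, i < S.N ∧ ∃ r ∈ Ioo 0 S.h, r ∉ C ∧
    t = r + i * S.h}, fun t ht => ht.1, ?_, ⟨⟨le_rfl, S.T_nonneg⟩, Or.inl rfl⟩,
    ⟨⟨S.T_nonneg, le_rfl⟩, Or.inr (Or.inl rfl)⟩, ?_⟩
  -- The excluded times are translates of the countable set of positions that the limit clock shows
  -- at a parameter other than P r, together with nodes.
  · have hc : (⋃ i : ℕ, (fun r => r + i * S.h) '' insert 0 C).Countable :=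
      countable_iUnion fun i => (hR.countable.insert 0).image _
    refine measure_mono_null (fun t ht => ?_) (hc.measure_zero _)
    obtain ⟨ht, hE⟩ := ht
    have hT : t ≠ S.T := fun e => hE ⟨ht, Or.inr (Or.inl e)⟩
    obtain ⟨i, hi, r, hr, rfl⟩ := S.exists_block ⟨ht.1, lt_of_le_of_ne ht.2 hT⟩
    refine mem_iUnion.2 ⟨i, r, ?_, rfl⟩
    by_contra h
    rw [mem_insert_iff, not_or] at h
    exact hE ⟨ht, Or.inr (Or.inr ⟨i, hi, r, ⟨lt_of_le_of_ne hr.1 (Ne.symm h.1), hr.2⟩, h.2, rfl⟩)⟩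
  · rintro t ⟨-, rfl | rfl | ⟨i, hi, r, hr, hrC, rfl⟩⟩
    · simp only [intervalIntegral.integral_same, hR.v_init, hR.x_init, (hy _).init]
      exact ⟨tendsto_const_nhds, tendsto_const_nhds⟩
    · exact hR.tendsto_T hy
    · refine hR.tendsto_of_regular hy hi hr fun s hs h => ?_
      by_contra hne
      exact hrC ⟨hr, s, hs, h, hne⟩

end IsUnfolding

end ImpulseDelay

end

/-! ### The approximation theorem -/

theorem mainTheorem6 {n m : ℕ} (S : ImpulseDelay.DelaySystem n m)
    (μ : Fin m → MeasureTheory.SignedMeasure ℝ) (ν : MeasureTheory.Measure ℝ)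
    (ω : ℤ → ℝ → ℝ → Fin m → ℝ) (x : ℝ → Fin n → ℝ) (v : ℝ → ℝ)
    (hproc : ImpulseDelay.IsImpulseProcess S μ ν ω x v) :
    ∃ (u : ℕ → ℝ → Fin m → ℝ) (xs : ℕ → ℝ → Fin n → ℝ) (vs : ℕ → ℝ → ℝ),
      (∀ i, ImpulseDelay.IsStrictSenseProcess S (u i) (xs i) (vs i)) ∧
      (∀ i, ∀ t ∈ Set.Icc 0 S.T,
        vs i t = (ImpulseDelay.totalVar (ImpulseDelay.controlMeasure S.T (u i))).real
          (Set.Icc 0 t)) ∧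
      ImpulseDelay.WeakStar S.T (fun i => ImpulseDelay.controlMeasure S.T (u i)) μ ∧
      ImpulseDelay.WeakStarPos S.T
        (fun i => ImpulseDelay.totalVar (ImpulseDelay.controlMeasure S.T (u i))) ν ∧
      (∃ (dxs : ℕ → Fin n → MeasureTheory.SignedMeasure ℝ)
          (dx : Fin n → MeasureTheory.SignedMeasure ℝ),
        (∀ i k, ImpulseDelay.IsStieltjes S.T (fun t => xs i t k) (dxs i k)) ∧
        (∀ k, ImpulseDelay.IsStieltjes S.T (fun t => x t k) (dx k)) ∧
        ImpulseDelay.WeakStar S.T dxs dx) ∧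
      ∃ E : Set ℝ, E ⊆ Set.Icc 0 S.T ∧ MeasureTheory.volume (Set.Icc 0 S.T \ E) = 0 ∧
        0 ∈ E ∧ S.T ∈ E ∧
        ∀ t ∈ E, Filter.Tendsto (fun i => xs i t) Filter.atTop (nhds (x t)) ∧
          Filter.Tendsto (fun i => vs i t) Filter.atTop (nhds (v t)) := by
  have hνf := hproc.1.variation.1
  obtain ⟨R, Y, P, hR⟩ := hproc.exists_unfolding
  obtain ⟨y, hy⟩ := R.exists_approxBy
  have hU := fun i => R.isBoundedControl_regControl (ImpulseDelay.eps_pos i)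
  refine ⟨fun i => ImpulseDelay.primitive (R.regControl (ImpulseDelay.eps_pos i)), y,
    fun i t => ∫ s in (0 : ℝ)..t, ImpulseDelay.norm1 (R.regControl (ImpulseDelay.eps_pos i) s),
    fun i => (hy i).isStrictSenseProcess_primitive (hU i),
    fun i t ht => ((hU i).totalVar_controlMeasure_real le_rfl ht.1 ht.2).symm, ?_,
    R.weakStarPos_regControl hR.ν_eq,
    ⟨_, _, fun i k => (hy i).isStieltjes (hU i) k, hR.isStieltjes,
      ImpulseDelay.UnfoldedControl.weakStar_trajectory hR.isTrajectory hy⟩,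
    hR.exists_full_measure hy⟩
  have hμ : μ = fun j => R.push fun l s => R.w l s j := funext hR.μ_eq
  rw [hμ]
  exact R.weakStar_regControl
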